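/- Let $d,n\ge 1$ be integers and let $0<p_1,\dots,p_n,p<\infty$ satisfy $\sum_{j=1}^n \frac1{p_j}=n-1+\frac1p$. **Monotonicity.** Let $0\le\sigma_1,\dots,\sigma_n<\infty$ satisfy $$\frac1{p_j}\Big(1-\frac1{p_j}\Big)\sigma_k=\frac1{p_k}\Big(1-\frac1{p_k}\Big)\sigma_j\qquad (1\le j,k\le n).$$ For each $j$ let $\mu_j$ be a compactly supported (positive) finite Borel measure on $\mathbb R^d$ and let $u_j:(0,\infty)\times\mathbb R^d\to[0,\infty)$ be a solution of the heat equation $\partial_t u_j=\frac{\sigma_j}{4\pi}\Delta u_j$ with initial data $\mu_j$. This means the following: $u_j(t,\cdot)$ is measurable for each $t>0$; the equation holds at every point of $(0,\infty)\times\mathbb R^d$, where, if $\sigma_j>0$, $u_j$ is $C^2$ in $x$ with $u_j$ and $\Delta u_j$ continuous on $(0,\infty)\times\mathbb R^d$, while for $\sigma_j=0$ the equation reads $\partial_tu_j=0$ and no regularity in $x$ is asked; $\sup_{0<t\le T}\int_{\mathbb R^d} u_j(t,x)\,dx<\infty$ for every $T>0$; and $\int\varphi(x)u_j(t,x)\,dx\to\int\varphi\,d\mu_j$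 as $t\to0^+$ for every continuous compactly supported $\varphi$. Let $$Q(t):=\big\|u_1(t,\cdot)^{1/p_1}*\cdots*u_n(t,\cdot)^{1/p_n}\big\|_{L^p(\mathbb R^d)}\in[0,\infty]\qquad(t>0),$$ where $\|g\|_{L^p}=(\int|g|^p)^{1/p}$, also for $p<1$. If $p_1,\dots,p_n\ge1$, then $Q$ is nondecreasing on $(0,\infty)$; if $p_1,\dots,p_n\le1$, then $Q$ is nonincreasing on $(0,\infty)$. Moreover $0<Q(t)<\infty$ for all $t>0$ provided every $\mu_j$ is nonzero and $\sigma_j>0$ for every $j$ with $p_j\ne1$. **Sharp inequalities.** Let $C_1:=1$ and $C_r:=\big(r^{1/r}/|r'|^{1/r'}\big)^{1/2}$ for $0<r<\infty$, $r\ne1$, where $\frac1r+\frac1{r'}=1$. If $p_1,\dots,p_n\ge1$, then $$\|f_1*\cdots*f_n\|_{L^p(\mathbb R^d)}\le\Big(\frac{C_{p_1}\cdots C_{p_n}}{C_p}\Big)^d\prod_{j=1}^n\|f_j\|_{L^{p_j}(\mathbb R^d)}$$ for all nonnegative $f_j\in L^{p_j}(\mathbb R^d)$; if $p_1,\dots,p_n\le1$,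 then the reverse inequality holds for all nonnegative $f_j\in L^{p_j}(\mathbb R^d)$. In both cases the constant is the best possible. -/

import Mathlib

open MeasureTheory Set Filter Topology
open scoped ENNReal

/-- Iterated spatial convolution `f 0 * f 1 * ⋯ * f n` on `ℝᵈ` (Lebesgue measure) of `n + 1`
functions with values in `[0, ∞]`, where every convolution integral makes sense. -/
noncomputable def iteratedConv {d : ℕ} : (n : ℕ) →
    (Fin (n + 1) → EuclideanSpace ℝ (Fin d) → ℝ≥0∞) → EuclideanSpace ℝ (Fin d) → ℝ≥0∞
  | 0, f => f 0
  | n + 1, f => lconvolution (f 0) (iteratedConv n fun j => f j.succ) volume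

/-- `‖f 0 * ⋯ * f n‖_{L^q(ℝᵈ)}` for nonnegative real-valued functions `f j`, as an element
of `[0, ∞]`. For `0 < q < ∞` the (quasi-)norm is `(∫ |g| ^ q) ^ (1 / q)`. -/
noncomputable def convNorm {d : ℕ} (n : ℕ) (q : ℝ)
    (f : Fin (n + 1) → EuclideanSpace ℝ (Fin d) → ℝ) : ℝ≥0∞ :=
  eLpNorm (iteratedConv n fun j x => ENNReal.ofReal (f j x)) (ENNReal.ofReal q) volume

/-- `u` is a nonnegative solution on `(0, ∞) × ℝᵈ` of the heat equation
`∂ₜ u = (σ / 4π) Δ u` with initial data the measure `μ`.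

If `σ > 0`, this is a classical solution (of class `C²` in space, with `u` and `Δ u` continuous
in space-time). If `σ = 0`, the equation says `∂ₜ u = 0`, no smoothness in space is asked, and
`u t` is, for every `t > 0`, a fixed density of `μ`.

The mass is bounded on bounded time intervals; this is the class in which the solution with
given finite initial measure is unique (for `σ > 0` it is the convolution of `μ` with the heat
kernel). The initial data are attained in the sense of weak convergence of measures, tested on
continuous functions of compact support. -/
structure IsHeatSolution {d : ℕ} (σ : ℝ) (μ : Measure (EuclideanSpace ℝ (Fin d)))
    (u : ℝ → EuclideanSpace ℝ (Fin d) → ℝ) : Prop where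
  nonneg : ∀ t, 0 < t → ∀ x, 0 ≤ u t x
  aestronglyMeasurable : ∀ t, 0 < t → AEStronglyMeasurable (u t) volume
  contDiff : 0 < σ → ∀ t, 0 < t → ContDiff ℝ 2 (u t)
  continuousOn : 0 < σ → ContinuousOn
    (fun z : ℝ × EuclideanSpace ℝ (Fin d) => u z.1 z.2) (Ioi 0 ×ˢ univ)
  continuousOn_laplacian : 0 < σ → ContinuousOn
    (fun z : ℝ × EuclideanSpace ℝ (Fin d) => Laplacian.laplacian (u z.1) z.2)
    (Ioi 0 ×ˢ univ)
  heat_equation : ∀ t, 0 < t → ∀ x, HasDerivAt (fun s => u s x)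
    (σ / (4 * Real.pi) * Laplacian.laplacian (u t) x) t
  mass_bounded : ∀ T, 0 < T → ∃ M : ℝ≥0∞, M < ∞ ∧
    ∀ t, 0 < t → t ≤ T → ∫⁻ x, ENNReal.ofReal (u t x) ≤ M
  initial_data : ∀ φ : EuclideanSpace ℝ (Fin d) → ℝ, Continuous φ → HasCompactSupport φ →
    Tendsto (fun t => ∫ x, φ x * u t x) (𝓝[>] 0) (𝓝 (∫ x, φ x ∂μ))

/-- The constant `C_r = (r ^ (1/r) / |r'| ^ (1/r')) ^ (1/2)`, where `r' = r / (r - 1)` is the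
conjugate exponent (negative if `r < 1`); `C_1 = 1` (that is, `∞ ^ (1/∞) = 1`). -/
noncomputable def youngC (r : ℝ) : ℝ :=
  if r = 1 then 1
  else (r ^ (1 / r) / |r / (r - 1)| ^ (1 / (r / (r - 1)))) ^ (1 / 2 : ℝ)

/-- The constant `(C_{p 0} ⋯ C_{p n} / C_q) ^ d`. -/
noncomputable def youngConst (d n : ℕ) (p : Fin (n + 1) → ℝ) (q : ℝ) : ℝ≥0∞ :=
  ENNReal.ofReal (((∏ j, youngC (p j)) / youngC q) ^ d)

/-! The core is a pointwise closure property of heat flows. Let `T_p f` be the `1/p`-th power of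
`f^p` convolved with the heat kernel at a time proportional to `|1 - 1/p| / p`. If `1/p + 1/q = 1 +
1/r`, then `T_r (f * g) ≤ T_p f * T_q g` at every point when the exponents are at least 1, and the
inequality is reversed when they are at most 1 (`flowT_lconvolution`). Induction gives several
functions. Since `T_r` preserves the `L^r` norm, taking norms gives the monotonicity of `Q`: as soon
as some `p_k ≠ 1`, the hypothesis on the `σ_j` says that they are in the ratio of the `|1 - 1/p_j| /
p_j`.

The closure property is the sharp Young inequality used pointwise. The relevant roots `P`, `Q`, `R`
of the heat kernels are extremal Gaussians: `P * Q = C R` with `C` the sharp constant. Hence `C (f *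
g)(x) R(z - x)` is the integral over `u` of the convolution at `x` of `f P(u - ·)` and `g Q(z - u -
·)`. Taking the `L^r` norm in `x`, Minkowski's inequality and Young's inequality for each `u` bring
out the same `C`, which cancels.

The sharp Young inequality is proved on the line by Barthe's transport argument
(`lintegral_lintegral_rpow_mul_le`). It compares the convolution of `f^(1/p)` and `g^(1/q)` with a
mixed norm of `F` and `G`, where `f, F` and `g, G` have equal masses. Gaussians give equality, so
taking `F, G` Gaussian yields Young's inequality, and taking `f, g` Gaussian yields the reverse one.
Minkowski's inequality tensorises both, and Gaussians of nearly optimal widths show that the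
constant is best.

Testing a solution against cut-off plane waves computes its Fourier transform and identifies its
evolution between positive times with the heat semigroup. Finiteness of `Q` follows from Young's
inequality for exponents at least 1, and from Gaussian decay with polynomial weights for exponents
at most 1. -/

/-- The `L^p` (quasi-)norm `(∫ f ^ p) ^ (1 / p)` of a function with values in `[0, ∞]`. -/
noncomputable def lqNorm {α : Type*} [MeasurableSpace α] (p : ℝ) (f : α → ℝ≥0∞)
    (μ : Measure α) : ℝ≥0∞ :=
  (∫⁻ x, f x ^ p ∂μ) ^ (1 / p)

/-! ### Truncation in height and support. -/

section Truncation

variable {α : Type*}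

/-- The truncation of `f` at height `n`, restricted to `S n`. -/
noncomputable def truncOn (S : ℕ → Set α) (f : α → ℝ≥0∞) (n : ℕ) : α → ℝ≥0∞ :=
  (S n).indicator fun x => min (f x) n

theorem truncOn_mono {S : ℕ → Set α} (hS : Monotone S) (f : α → ℝ≥0∞) :
    Monotone (truncOn S f) := by
  intro m n hmn x
  unfold truncOn
  by_cases hx : x ∈ S m
  · rw [indicator_of_mem hx, indicator_of_mem (hS hmn hx)]
    exact min_le_min le_rfl (by exact_mod_cast hmn)
  · rw [indicator_of_notMem hx]
    exact zero_le

theorem truncOn_le (S : ℕ → Set α) (f : α → ℝ≥0∞) (n : ℕ) (x : α) : truncOn S f n x ≤ f x :=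
  (indicator_le_self _ _ x).trans (min_le_left _ _)

theorem tendsto_truncOn {S : ℕ → Set α} (hS : Monotone S) (hU : ⋃ n, S n = univ)
    (f : α → ℝ≥0∞) (x : α) : Tendsto (fun n => truncOn S f n x) atTop (𝓝 (f x)) := by
  obtain ⟨N, hN⟩ := mem_iUnion.1 (hU ▸ mem_univ x)
  have h1 : Tendsto (fun n : ℕ => min (f x) (n : ℝ≥0∞)) atTop (𝓝 (min (f x) ⊤)) :=
    (continuous_const.min continuous_id).continuousAt.tendsto.comp ENNReal.tendsto_nat_nhds_top
  rw [min_top_right] at h1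
  refine h1.congr' ?_
  filter_upwards [eventually_ge_atTop N] with n hn
  rw [truncOn, indicator_of_mem (hS hn hN)]

theorem measurable_truncOn [MeasurableSpace α] {S : ℕ → Set α} (hS : ∀ n, MeasurableSet (S n))
    {f : α → ℝ≥0∞} (hf : Measurable f) (n : ℕ) : Measurable (truncOn S f n) :=
  (hf.min measurable_const).indicator (hS n)

end Truncation

/-! ### Duality and Minkowski's inequality for `L^p` quasi-norms. -/

section Norm

variable {α β : Type*} [MeasurableSpace α] [MeasurableSpace β] {μ : Measure α} {ν : Measure β}

theorem lqNorm_mono {p : ℝ} (hp : 0 < p) {f g : α → ℝ≥0∞} (h : ∀ x, f x ≤ g x) :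
    lqNorm p f μ ≤ lqNorm p g μ := by
  unfold lqNorm
  gcongr
  exact h _

theorem lqNorm_const_mul {p : ℝ} (hp : 0 < p) {f : α → ℝ≥0∞} (hf : Measurable f) (c : ℝ≥0∞) :
    lqNorm p (fun x => c * f x) μ = c * lqNorm p f μ := by
  unfold lqNorm
  simp_rw [ENNReal.mul_rpow_of_nonneg _ _ hp.le]
  rw [lintegral_const_mul _ (by fun_prop), ENNReal.mul_rpow_of_nonneg _ _ (by positivity),
    ← ENNReal.rpow_mul, mul_one_div_cancel hp.ne', ENNReal.rpow_one]

theorem lqNorm_one (f : α → ℝ≥0∞) : lqNorm 1 f μ = ∫⁻ x, f x ∂μ := by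
  simp [lqNorm]

theorem lqNorm_eq_eLpNorm {p : ℝ} (hp : 0 < p) (f : α → ℝ≥0∞) :
    lqNorm p f μ = eLpNorm f (ENNReal.ofReal p) μ := by
  rw [eLpNorm_eq_lintegral_rpow_enorm_toReal (by simpa using hp) ENNReal.ofReal_ne_top,
    ENNReal.toReal_ofReal hp.le]
  simp [lqNorm]

theorem tendsto_lqNorm_truncOn {p : ℝ} (hp : 0 < p) {S : ℕ → Set α} (hS : Monotone S)
    (hU : ⋃ n, S n = univ) (hm : ∀ n, MeasurableSet (S n)) {f : α → ℝ≥0∞} (hf : Measurable f) :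
    Tendsto (fun n => lqNorm p (truncOn S f n) μ) atTop (𝓝 (lqNorm p f μ)) := by
  refine (ENNReal.continuous_rpow_const.tendsto _).comp ?_
  refine lintegral_tendsto_of_tendsto_of_monotone
    (fun n => ((measurable_truncOn hm hf n).pow_const p).aemeasurable) ?_ ?_
  · refine Eventually.of_forall fun x m n hmn => ?_
    exact ENNReal.rpow_le_rpow (truncOn_mono hS f hmn x) hp.le
  · refine Eventually.of_forall fun x => ?_
    exact (ENNReal.continuous_rpow_const.tendsto _).comp (tendsto_truncOn hS hU f x)

/-- The dual characterisation of the `L^r` norm. -/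
theorem lqNorm_le_of_forall_lintegral_mul_le [SigmaFinite μ] {r r' : ℝ}
    (hr : r.HolderConjugate r') {Φ : α → ℝ≥0∞} (hΦ : Measurable Φ) {B : ℝ≥0∞}
    (H : ∀ h : α → ℝ≥0∞, Measurable h → ∫⁻ x, Φ x * h x ∂μ ≤ B * lqNorm r' h μ) :
    lqNorm r Φ μ ≤ B := by
  have hr0 := hr.pos
  have hr1 := hr.symm.pos
  refine le_of_tendsto' (tendsto_lqNorm_truncOn hr0 (monotone_spanningSets μ)
    (iUnion_spanningSets μ) (measurableSet_spanningSets μ) hΦ) fun n => ?_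
  set Ψ := truncOn (spanningSets μ) Φ n with hΨ
  have hΨm : Measurable Ψ := measurable_truncOn (measurableSet_spanningSets μ) hΦ n
  set I := ∫⁻ x, Ψ x ^ r ∂μ with hI
  -- The truncation has bounded height and a support of finite measure. Finiteness of `I` is what
  -- permits the final division by `I ^ (1 / r')`.
  have hfin : I ≠ ∞ := by
    have : I ≤ ∫⁻ x in spanningSets μ n, (n : ℝ≥0∞) ^ r ∂μ := by
      rw [← lintegral_indicator (measurableSet_spanningSets μ n)]
      refine lintegral_mono fun x => ?_
      rw [hΨ, truncOn]
      by_cases hx : x ∈ spanningSets μ n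
      · simp only [indicator_of_mem hx]
        exact ENNReal.rpow_le_rpow (min_le_right _ _) hr0.le
      · simp [indicator_of_notMem hx, hr0]
    refine (this.trans_lt ?_).ne
    rw [setLIntegral_const]
    exact ENNReal.mul_lt_top (ENNReal.rpow_lt_top_of_nonneg hr0.le (by simp))
      (measure_spanningSets_lt_top μ n)
  have hsub : r - 1 ≥ 0 := by linarith [hr.lt]
  have h1 : I ≤ B * I ^ (1 / r') := by
    -- The test function is the equality case of Hölder's inequality for `Ψ`.
    have := H (fun x => Ψ x ^ (r - 1)) (hΨm.pow_const _)
    have h2 : lqNorm r' (fun x => Ψ x ^ (r - 1)) μ = I ^ (1 / r') := by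
      unfold lqNorm
      simp_rw [← ENNReal.rpow_mul, hr.sub_one_mul_conj]
      rfl
    rw [h2] at this
    refine le_trans (lintegral_mono fun x => ?_) this
    calc Ψ x ^ r = Ψ x ^ (1 : ℝ) * Ψ x ^ (r - 1) := by
          rw [← ENNReal.rpow_add_of_nonneg _ _ zero_le_one hsub]; congr 1; ring
      _ ≤ Φ x * Ψ x ^ (r - 1) := by
          rw [ENNReal.rpow_one]; gcongr; exact truncOn_le _ _ _ _
  change I ^ (1 / r) ≤ B
  rcases eq_or_ne I 0 with h0 | h0
  · rw [h0, ENNReal.zero_rpow_of_pos (by positivity)]; exact zero_le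
  have e : 1 / r = 1 - 1 / r' := by have := hr.inv_add_inv_eq_one; field_simp at this ⊢; linarith
  have hne : I ^ (1 / r') ≠ 0 := by simp [h0, hfin]
  have hne' : I ^ (1 / r') ≠ ∞ := ENNReal.rpow_ne_top_of_nonneg (by positivity) hfin
  rw [e, ENNReal.rpow_sub _ _ h0 hfin, ENNReal.rpow_one]
  exact ENNReal.div_le_of_le_mul h1

/-- **Minkowski's integral inequality**. -/
theorem lqNorm_lintegral_le [SigmaFinite μ] [SFinite ν] {r : ℝ} (hr : 1 ≤ r)
    {K : α → β → ℝ≥0∞} (hK : Measurable (Function.uncurry K)) :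
    lqNorm r (fun x => ∫⁻ y, K x y ∂ν) μ ≤ ∫⁻ y, lqNorm r (fun x => K x y) μ ∂ν := by
  rcases hr.eq_or_lt with rfl | hr
  · simp_rw [lqNorm_one]
    exact (lintegral_lintegral_swap hK.aemeasurable).le
  have hc := Real.HolderConjugate.conjExponent hr
  refine lqNorm_le_of_forall_lintegral_mul_le hc hK.lintegral_prod_right' fun h hh => ?_
  calc ∫⁻ x, (∫⁻ y, K x y ∂ν) * h x ∂μ = ∫⁻ x, ∫⁻ y, K x y * h x ∂ν ∂μ := by
        refine lintegral_congr fun x => ?_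
        exact (lintegral_mul_const _ (hK.comp measurable_prodMk_left)).symm
    _ = ∫⁻ y, ∫⁻ x, K x y * h x ∂μ ∂ν := by
        refine lintegral_lintegral_swap (Measurable.aemeasurable ?_)
        exact hK.mul (hh.comp measurable_fst)
    _ ≤ ∫⁻ y, lqNorm r (fun x => K x y) μ * lqNorm _ h μ ∂ν := by
        refine lintegral_mono fun y => ?_
        exact ENNReal.lintegral_mul_le_Lp_mul_Lq μ hc
          (hK.comp measurable_prodMk_right).aemeasurable hh.aemeasurable
    _ = _ := by
        rw [lintegral_mul_const]
        refine Measurable.pow_const ?_ _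
        exact (hK.pow_const r).lintegral_prod_left'

/-- The reverse of Minkowski's integral inequality, for exponents at most one. -/
theorem lintegral_lqNorm_le [SFinite μ] [SigmaFinite ν] {r : ℝ} (hr0 : 0 < r) (hr : r ≤ 1)
    {K : α → β → ℝ≥0∞} (hK : Measurable (Function.uncurry K)) :
    ∫⁻ y, lqNorm r (fun x => K x y) μ ∂ν ≤ lqNorm r (fun x => ∫⁻ y, K x y ∂ν) μ := by
  have hr' : 1 ≤ 1 / r := by rw [le_div_iff₀ hr0]; linarith
  -- The exponent `1 / r` is at least one, so the direct inequality applies to `K ^ r` with the two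
  -- variables exchanged; raising to the power `1 / r` undoes the substitution.
  have h := lqNorm_lintegral_le (μ := ν) (ν := μ) hr' (K := fun y x => K x y ^ r)
    ((hK.comp measurable_swap).pow_const r)
  have h2 := ENNReal.rpow_le_rpow h (zero_le_one.trans hr')
  simp only [lqNorm, ← ENNReal.rpow_mul, one_div_one_div, mul_one_div_cancel hr0.ne',
    ENNReal.rpow_one] at h2
  exact h2

theorem lqNorm_prod [SFinite μ] [SFinite ν] {p : ℝ} (hp : 0 < p) {f : α × β → ℝ≥0∞}
    (hf : Measurable f) :
    lqNorm p f (μ.prod ν) = lqNorm p (fun b => lqNorm p (fun a => f (a, b)) μ) ν := by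
  unfold lqNorm
  rw [lintegral_prod_symm _ (hf.pow_const p).aemeasurable]
  simp_rw [← ENNReal.rpow_mul, one_div_mul_cancel hp.ne', ENNReal.rpow_one]

theorem measurable_lqNorm [SFinite μ] {p : ℝ} {f : α × β → ℝ≥0∞} (hf : Measurable f) :
    Measurable fun b => lqNorm p (fun a => f (a, b)) μ :=
  ((hf.pow_const p).lintegral_prod_left').pow_const _

theorem MeasureTheory.MeasurePreserving.lqNorm_comp {p : ℝ} {φ : α → β}
    (hφ : MeasurePreserving φ μ ν) {f : β → ℝ≥0∞} (hf : Measurable f) :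
    lqNorm p (f ∘ φ) μ = lqNorm p f ν := by
  unfold lqNorm
  rw [← hφ.lintegral_comp (hf.pow_const p)]
  rfl

end Norm

/-! ### Treating an inequality and its reverse simultaneously. -/

section Direction

/-- `x ≤ y` if `b` is true, `y ≤ x` otherwise. -/
def leDir (b : Bool) (x y : ℝ≥0∞) : Prop := if b then x ≤ y else y ≤ x

/-- Positive exponents that are at least one if `b` is true, and at most one otherwise. -/
def ExpDir (b : Bool) (p : ℝ) : Prop := 0 < p ∧ if b then 1 ≤ p else p ≤ 1

variable {b : Bool} {x y z w : ℝ≥0∞}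

theorem leDir_of_eq (h : x = y) : leDir b x y := by cases b <;> simp [leDir, h]

theorem leDir.trans (h : leDir b x y) (h' : leDir b y z) : leDir b x z := by
  cases b
  · exact le_trans (α := ℝ≥0∞) h' h
  · exact le_trans (α := ℝ≥0∞) h h'

theorem leDir.mul (h : leDir b x y) (h' : leDir b z w) : leDir b (x * z) (y * w) := by
  cases b <;> exact mul_le_mul' (α := ℝ≥0∞) h h'

theorem leDir.mul_left (c : ℝ≥0∞) (h : leDir b x y) : leDir b (c * x) (c * y) :=
  (leDir_of_eq rfl).mul h

theorem leDir.rpow (h : leDir b x y) {s : ℝ} (hs : 0 ≤ s) : leDir b (x ^ s) (y ^ s) := by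
  cases b <;> exact ENNReal.rpow_le_rpow (show (_ : ℝ≥0∞) ≤ _ from h) hs

theorem leDir.lintegral {α : Type*} [MeasurableSpace α] {μ : Measure α} {f g : α → ℝ≥0∞}
    (h : ∀ x, leDir b (f x) (g x)) : leDir b (∫⁻ x, f x ∂μ) (∫⁻ x, g x ∂μ) := by
  cases b <;> exact lintegral_mono (fun x => h x)

theorem leDir.lqNorm {α : Type*} [MeasurableSpace α] {μ : Measure α} {f g : α → ℝ≥0∞}
    (h : ∀ x, leDir b (f x) (g x)) {p : ℝ} (hp : 0 < p) :
    leDir b (lqNorm p f μ) (lqNorm p g μ) :=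
  (leDir.lintegral fun x => (h x).rpow hp.le).rpow (by positivity)

/-- Both forms of Minkowski's inequality under one Boolean, so that the forward and the reverse
arguments can be run together. -/
theorem leDir_lqNorm_lintegral {α β : Type*} [MeasurableSpace α] [MeasurableSpace β]
    {μ : Measure α} {ν : Measure β} [SigmaFinite μ] [SigmaFinite ν] {r : ℝ} (hr : ExpDir b r)
    {K : α → β → ℝ≥0∞} (hK : Measurable (Function.uncurry K)) :
    leDir b (lqNorm r (fun x => ∫⁻ y, K x y ∂ν) μ) (∫⁻ y, lqNorm r (fun x => K x y) μ ∂ν) := by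
  cases b
  · exact lintegral_lqNorm_le hr.1 hr.2 hK
  · exact lqNorm_lintegral_le hr.2 hK

end Direction

/-! ### Young's inequality with a constant: transfer and tensorisation. -/

section Young

set_option linter.unusedSectionVars false

variable {E F : Type*} [AddCommGroup E] [MeasurableSpace E] [MeasurableAdd₂ E] [MeasurableNeg E]
  [AddCommGroup F] [MeasurableSpace F] [MeasurableAdd₂ F] [MeasurableNeg F]
  {μ : Measure E} {ν : Measure F} [SigmaFinite μ] [SigmaFinite ν]
  {b : Bool} {p q r : ℝ} {C D : ℝ≥0∞}

/-- Young's convolution inequality with constant `C` (reversed if `b` is false). -/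
def YoungIneq (b : Bool) (μ : Measure E) (p q r : ℝ) (C : ℝ≥0∞) : Prop :=
  ∀ f g : E → ℝ≥0∞, Measurable f → Measurable g →
    leDir b (lqNorm r (lconvolution f g μ) μ) (C * (lqNorm p f μ * lqNorm q g μ))

theorem YoungIneq.of_measurePreserving (h : YoungIneq b μ p q r C) (e : E → F)
    (he : MeasurePreserving e μ ν) (hneg : ∀ x, e (-x) = -e x)
    (hadd : ∀ x y, e (x + y) = e x + e y) : YoungIneq b ν p q r C := by
  intro f g hf hg
  have key : lconvolution f g ν ∘ e = lconvolution (f ∘ e) (g ∘ e) μ := by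
    ext x
    simp only [Function.comp, lconvolution_def]
    rw [← he.lintegral_comp (by fun_prop)]
    simp [hadd, hneg]
  have := h (f ∘ e) (g ∘ e) (hf.comp he.measurable) (hg.comp he.measurable)
  rwa [← key, he.lqNorm_comp (measurable_lconvolution _ hf hg), he.lqNorm_comp hf,
    he.lqNorm_comp hg] at this

theorem YoungIneq.symm [μ.IsAddLeftInvariant] [μ.IsNegInvariant] (h : YoungIneq b μ p q r C) :
    YoungIneq b μ q p r C := by
  intro f g hf hg
  rw [lconvolution_comm, mul_comm (lqNorm q f μ)]
  exact h g f hg hf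

/-- A convolution with `f` is a superposition of translates of `g` with weights `f y`, and
translates have equal norms, so this is Minkowski's inequality. -/
theorem youngIneq_one_left [μ.IsAddLeftInvariant] (hq : ExpDir b q) :
    YoungIneq b μ 1 q q 1 := by
  intro f g hf hg
  refine (leDir_lqNorm_lintegral (ν := μ) hq (K := fun x y => f y * g (-y + x))
    (by fun_prop)).trans (leDir_of_eq ?_)
  rw [one_mul, lqNorm_one, ← lintegral_mul_const _ hf]
  refine lintegral_congr fun y => ?_
  rw [lqNorm_const_mul hq.1 (by fun_prop)]
  congr 1
  unfold lqNorm
  rw [lintegral_add_left_eq_self (fun x => g x ^ q) (-y)]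

/-- For a fixed second coordinate, the convolution on the product is an integral of convolutions on
`E`. Minkowski and Young on `E` bound its norm in the first coordinate by a convolution on `F` of
the partial norms, to which Young on `F` applies. -/
theorem YoungIneq.prod (hp : 0 < p) (hq : 0 < q) (hr : ExpDir b r) (h : YoungIneq b μ p q r C)
    (h' : YoungIneq b ν p q r D) : YoungIneq b (μ.prod ν) p q r (C * D) := by
  have hadd : MeasurableAdd₂ (E × F) := ⟨Measurable.prodMk
    ((measurable_fst.comp measurable_fst).add (measurable_fst.comp measurable_snd))
    ((measurable_snd.comp measurable_fst).add (measurable_snd.comp measurable_snd))⟩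
  have hneg : MeasurableNeg (E × F) := ⟨measurable_fst.neg.prodMk measurable_snd.neg⟩
  have hconst : MeasurableAdd (E × F) := inferInstance
  intro f g hf hg
  set φ : F → ℝ≥0∞ := fun a => lqNorm p (fun x => f (x, a)) μ with hφ
  set γ : F → ℝ≥0∞ := fun a => lqNorm q (fun x => g (x, a)) μ with hγ
  have mφ : Measurable φ := measurable_lqNorm hf
  have mγ : Measurable γ := measurable_lqNorm hg
  have hconv : ∀ x a, lconvolution f g (μ.prod ν) (x, a) =
      ∫⁻ c, lconvolution (fun y => f (y, c)) (fun y => g (y, -c + a)) μ x ∂ν := by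
    intro x a
    have hm : Measurable fun z : E × F => f z * g (-z + (x, a)) :=
      hf.mul (hg.comp (measurable_neg.add_const _))
    exact lintegral_prod_symm _ hm.aemeasurable
  rw [lqNorm_prod hr.1 (measurable_lconvolution _ hf hg), lqNorm_prod hp hf, lqNorm_prod hq hg]
  have step : ∀ a, leDir b (lqNorm r (fun x => lconvolution f g (μ.prod ν) (x, a)) μ)
      (C * lconvolution φ γ ν a) := by
    intro a
    simp_rw [hconv]
    refine (leDir_lqNorm_lintegral hr ?_).trans ?_
    · unfold lconvolution
      refine Measurable.lintegral_prod_right'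
        (f := fun z : (E × F) × E => f (z.2, z.1.2) * g (-z.2 + z.1.1, -z.1.2 + a)) ?_
      fun_prop
    · rw [lconvolution_def, ← lintegral_const_mul _ (by fun_prop)]
      exact leDir.lintegral fun c => h _ _ (by fun_prop) (by fun_prop)
  refine (leDir.lqNorm step hr.1).trans ?_
  rw [lqNorm_const_mul hr.1 (measurable_lconvolution _ mφ mγ), mul_assoc]
  exact (h' φ γ mφ mγ).mul_left C

end Young

/-! ### Monotone transport and Barthe's inequality on the line. -/

section Transport

/-- The cumulative distribution function of a density on the line. -/
noncomputable def cumul (f : ℝ → ℝ) (x : ℝ) : ℝ := (∫ t in Iic 0, f t) + ∫ t in (0 : ℝ)..x, f t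

variable {f F : ℝ → ℝ}

theorem hasDerivAt_cumul (hf : Continuous f) (x : ℝ) : HasDerivAt (cumul f) (f x) x :=
  (intervalIntegral.integral_hasDerivAt_right (hf.intervalIntegrable _ _)
    (hf.stronglyMeasurableAtFilter _ _) hf.continuousAt).const_add _

theorem strictMono_cumul (hf : Continuous f) (hpos : ∀ x, 0 < f x) : StrictMono (cumul f) :=
  strictMono_of_hasDerivAt_pos (hasDerivAt_cumul hf) hpos

theorem tendsto_cumul_atTop (hi : Integrable f) :
    Tendsto (cumul f) atTop (𝓝 (∫ x, f x)) := by
  rw [← intervalIntegral.integral_Iic_add_Ioi (b := 0) hi.integrableOn hi.integrableOn]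
  exact (intervalIntegral_tendsto_integral_Ioi 0 hi.integrableOn tendsto_id).const_add _

theorem tendsto_cumul_atBot (hi : Integrable f) : Tendsto (cumul f) atBot (𝓝 0) := by
  have h := (intervalIntegral_tendsto_integral_Iic 0 hi.integrableOn tendsto_id).const_sub
    (∫ t in Iic 0, f t)
  rw [sub_self] at h
  refine h.congr fun x => ?_
  rw [cumul, intervalIntegral.integral_symm]
  simp [sub_eq_add_neg]

theorem range_cumul (hf : Continuous f) (hpos : ∀ x, 0 < f x) (hi : Integrable f) :
    range (cumul f) = Ioo 0 (∫ x, f x) := by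
  have hm := strictMono_cumul hf hpos
  have hc : Continuous (cumul f) :=
    continuous_iff_continuousAt.2 fun x => (hasDerivAt_cumul hf x).continuousAt
  ext y
  constructor
  · rintro ⟨x, rfl⟩
    constructor
    · exact (hm.monotone.le_of_tendsto (tendsto_cumul_atBot hi) (x - 1)).trans_lt
        (hm (by linarith))
    · exact (hm (by linarith : x < x + 1)).trans_le
        (hm.monotone.ge_of_tendsto (tendsto_cumul_atTop hi) (x + 1))
  · rintro ⟨h0, h1⟩
    refine mem_range_of_exists_le_of_exists_ge hc ?_ ?_
    · exact ((tendsto_cumul_atBot hi).eventually_le_const h0).exists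
    · exact ((tendsto_cumul_atTop hi).eventually_const_le h1).exists

/-- Monotone transport between positive continuous densities of equal mass. -/
theorem exists_transport (hf : Continuous f) (hfp : ∀ x, 0 < f x) (hfi : Integrable f)
    (hF : Continuous F) (hFp : ∀ x, 0 < F x) (hFi : Integrable F)
    (hm : ∫ x, f x = ∫ x, F x) :
    ∃ U : ℝ → ℝ, Continuous U ∧ Function.Bijective U ∧ StrictMono U ∧
      ∀ x, HasDerivAt U (F x / f (U x)) x := by
  have hr := range_cumul hf hfp hfi
  have hR := range_cumul hF hFp hFi
  have sf := strictMono_cumul hf hfp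
  have sF := strictMono_cumul hF hFp
  have hex : ∀ x, ∃ y, cumul f y = cumul F x := fun x => by
    have : cumul F x ∈ range (cumul f) := by rw [hr, hm, ← hR]; exact ⟨x, rfl⟩
    exact this
  choose U hU using hex
  have hUm : StrictMono U := fun x y hxy => by
    rw [← sf.lt_iff_lt, hU, hU]; exact sF hxy
  have hUs : Function.Surjective U := fun y => by
    have : cumul f y ∈ range (cumul F) := by rw [hR, ← hm, ← hr]; exact ⟨y, rfl⟩
    obtain ⟨x, hx⟩ := this
    exact ⟨x, sf.injective (by rw [hU, hx])⟩
  have hUc : Continuous U := hUm.monotone.continuous_of_surjective hUs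
  refine ⟨U, hUc, ⟨hUm.injective, hUs⟩, hUm, fun x => ?_⟩
  -- Since `cumul f ∘ U = cumul F`, the slope of `U` is the slope of `cumul F` divided by that of
  -- `cumul f` between the image points. Continuity of `U` sends the latter to `f (U x)`, which is
  -- positive.
  rw [hasDerivAt_iff_tendsto_slope]
  have h1 := hasDerivAt_iff_tendsto_slope.1 (hasDerivAt_cumul hF x)
  have h2 := hasDerivAt_iff_tendsto_slope.1 (hasDerivAt_cumul hf (U x))
  have h3 : Tendsto U (𝓝[≠] x) (𝓝[≠] (U x)) :=
    tendsto_nhdsWithin_of_tendsto_nhds_of_eventually_within _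
      (hUc.continuousAt.tendsto.mono_left nhdsWithin_le_nhds)
      (eventually_nhdsWithin_of_forall fun y hy => hUm.injective.ne hy)
  refine (h1.div (h2.comp h3) (hfp _).ne').congr' ?_
  filter_upwards [self_mem_nhdsWithin] with y hy
  have hy' : y - x ≠ 0 := sub_ne_zero.2 hy
  have hUy : U y - U x ≠ 0 := sub_ne_zero.2 (hUm.injective.ne hy)
  have hn : cumul f (U y) - cumul f (U x) ≠ 0 :=
    sub_ne_zero.2 (sf.injective.ne (hUm.injective.ne hy))
  rw [hU, hU] at hn
  simp only [Pi.div_apply, Function.comp, slope_def_field, hU]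
  field_simp

/-- Only an inequality, because `w` need not be onto. -/
theorem lintegral_deriv_mul_comp_le {w w' : ℝ → ℝ} (hw : ∀ x, HasDerivAt w (w' x) x)
    (hpos : ∀ x, 0 ≤ w' x) (hinj : Function.Injective w) (k : ℝ → ℝ≥0∞) :
    ∫⁻ x, ENNReal.ofReal (w' x) * k (w x) ≤ ∫⁻ x, k x := by
  have h := lintegral_image_eq_lintegral_abs_deriv_mul MeasurableSet.univ
    (fun x _ => (hw x).hasDerivWithinAt) hinj.injOn k
  simp only [setLIntegral_univ, abs_of_nonneg (hpos _)] at h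
  rw [← h]
  exact setLIntegral_le_lintegral _ _

theorem lintegral_deriv_mul_comp {w w' : ℝ → ℝ} (hw : ∀ x, HasDerivAt w (w' x) x)
    (hpos : ∀ x, 0 ≤ w' x) (hbij : Function.Bijective w) (k : ℝ → ℝ≥0∞) :
    ∫⁻ x, ENNReal.ofReal (w' x) * k (w x) = ∫⁻ x, k x := by
  have h := lintegral_image_eq_lintegral_abs_deriv_mul MeasurableSet.univ
    (fun x _ => (hw x).hasDerivWithinAt) hbij.injective.injOn k
  simp only [setLIntegral_univ, abs_of_nonneg (hpos _), image_univ, hbij.surjective.range_eq] at h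
  exact h.symm

/-- The substitution has Jacobian one, and the two new arguments sum to `t`. A function of `x + y`
thus becomes a function of `t` alone, while `θ` remains free to be adapted to the exponents. -/
theorem lintegral_lintegral_shear {K : ℝ → ℝ → ℝ≥0∞} (hK : Measurable (Function.uncurry K))
    (θ : ℝ) :
    ∫⁻ x, ∫⁻ y, K x y = ∫⁻ x, ∫⁻ t, K (x + θ * t) ((1 - θ) * t - x) := by
  have hK' : ∀ {α : Type} [MeasurableSpace α] {u v : α → ℝ}, Measurable u → Measurable v →
      Measurable fun z => K (u z) (v z) := fun hu hv => hK.comp (hu.prodMk hv)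
  calc ∫⁻ x, ∫⁻ y, K x y = ∫⁻ x, ∫⁻ t, K x (t - x) := by
        refine lintegral_congr fun x => ?_
        rw [lintegral_sub_right_eq_self (fun y => K x y)]
    _ = ∫⁻ t, ∫⁻ x, K x (t - x) :=
        lintegral_lintegral_swap (hK' (by fun_prop) (by fun_prop)).aemeasurable
    _ = ∫⁻ t : ℝ, ∫⁻ x : ℝ, K (x + θ * t) ((1 - θ) * t - x) := by
        refine lintegral_congr fun t => ?_
        rw [← lintegral_add_right_eq_self _ (θ * t)]
        refine lintegral_congr fun x => ?_
        congr 1; ring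
    _ = _ := lintegral_lintegral_swap (hK' (by fun_prop) (by fun_prop)).aemeasurable

end Transport

/-- Barthe's inequality between two mixed norms of products of functions on the line. -/
theorem lintegral_lintegral_rpow_mul_le {f F g G : ℝ → ℝ}
    (hf : Continuous f) (hfp : ∀ x, 0 < f x) (hfi : Integrable f)
    (hF : Continuous F) (hFp : ∀ x, 0 < F x) (hFi : Integrable F)
    (hg : Continuous g) (hgp : ∀ x, 0 < g x) (hgi : Integrable g)
    (hG : Continuous G) (hGp : ∀ x, 0 < G x) (hGi : Integrable G)
    (hfF : ∫ x, f x = ∫ x, F x) (hgG : ∫ x, g x = ∫ x, G x)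
    {p q r r' θ : ℝ} (hp : 0 < p) (hp1 : 1 / p < 1) (hq : 0 < q) (hq1 : 1 / q < 1)
    (hr : r.HolderConjugate r')
    (hθ : θ * (1 / r') = 1 - 1 / p) (hθ' : (1 - θ) * (1 / r') = 1 - 1 / q)
    {h : ℝ → ℝ≥0∞} (hh : Measurable h) :
    ∫⁻ x, ∫⁻ y, ENNReal.ofReal (f x) ^ (1 / p) * ENNReal.ofReal (g y) ^ (1 / q) * h (x + y) ≤
      (∫⁻ x, (∫⁻ t, ENNReal.ofReal (F (x + θ * t)) ^ (r / p) *
        ENNReal.ofReal (G ((1 - θ) * t - x)) ^ (r / q)) ^ (1 / r)) * lqNorm r' h volume := by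
  -- `U` carries the density `F` to `f`, and `V` carries `G` to `g`; their derivatives are called
  -- `u` and `v` below.
  obtain ⟨U, hUc, hUb, hUm, hUd⟩ := exists_transport hf hfp hfi hF hFp hFi hfF
  obtain ⟨V, hVc, hVb, hVm, hVd⟩ := exists_transport hg hgp hgi hG hGp hGi hgG
  have hr' : 0 < 1 / r' := one_div_pos.2 hr.symm.pos
  have hr0 := hr.pos
  have hθ0 : 0 < θ := by
    by_contra hc
    nlinarith [mul_nonneg (sub_nonneg.2 (not_lt.1 hc)) hr'.le]
  have hθ1 : 0 < 1 - θ := by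
    by_contra hc
    nlinarith [mul_nonneg (sub_nonneg.2 (not_lt.1 hc)) hr'.le]
  set u : ℝ → ℝ := fun x => F x / f (U x) with hu
  set v : ℝ → ℝ := fun x => G x / g (V x) with hv
  have up : ∀ x, 0 < u x := fun x => div_pos (hFp _) (hfp _)
  have vp : ∀ x, 0 < v x := fun x => div_pos (hGp _) (hgp _)
  have uc : Continuous u := hF.div (hf.comp hUc) fun x => (hfp _).ne'
  have vc : Continuous v := hG.div (hg.comp hVc) fun x => (hgp _).ne'
  -- With `a = F x` and `b = f (U x)`, so that `a / b = u x`, the factor `u · f(U)^(1/p)` produced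
  -- by the substitution becomes `F^(1/p) · u^(1 - 1/p)`.
  have split : ∀ {a b : ℝ} {s : ℝ}, 0 < a → 0 < b → 0 < s → 1 / s < 1 →
      ENNReal.ofReal (a / b) * ENNReal.ofReal b ^ (1 / s) =
        ENNReal.ofReal a ^ (1 / s) * ENNReal.ofReal (a / b) ^ (1 - 1 / s) := by
    intro a b s ha hb hs hs1
    have hab := div_pos ha hb
    simp only [ENNReal.ofReal_rpow_of_pos, ha, hb, hab, ← ENNReal.ofReal_mul hab.le,
      ← ENNReal.ofReal_mul (Real.rpow_pos_of_pos ha _).le]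
    congr 1
    rw [Real.rpow_sub hab, Real.rpow_one, Real.div_rpow ha.le hb.le]
    have := (Real.rpow_pos_of_pos ha (1 / s)).ne'
    have := (Real.rpow_pos_of_pos hb (1 / s)).ne'
    field_simp
  set K : ℝ → ℝ → ℝ≥0∞ := fun x y =>
    (ENNReal.ofReal (F x) ^ (1 / p) * ENNReal.ofReal (G y) ^ (1 / q)) *
    (ENNReal.ofReal (u x) ^ (1 - 1 / p) * ENNReal.ofReal (v y) ^ (1 - 1 / q) * h (U x + V y))
    with hKdef
  have hKm : Measurable (Function.uncurry K) := by
    have := hF.measurable; have := hG.measurable; have := uc.measurable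
    have := vc.measurable; have := hUc.measurable; have := hVc.measurable
    unfold Function.uncurry
    fun_prop
  have e1 : ∫⁻ x, ∫⁻ y, ENNReal.ofReal (f x) ^ (1 / p) * ENNReal.ofReal (g y) ^ (1 / q) *
      h (x + y) = ∫⁻ x, ∫⁻ y, K x y := by
    rw [← lintegral_deriv_mul_comp hUd (fun x => (up x).le) hUb]
    refine lintegral_congr fun x => ?_
    rw [← lintegral_deriv_mul_comp hVd (fun x => (vp x).le) hVb,
      ← lintegral_const_mul' _ _ ENNReal.ofReal_ne_top]
    refine lintegral_congr fun y => ?_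
    have s1 := split (hFp x) (hfp (U x)) hp hp1
    have s2 := split (hGp y) (hgp (V y)) hq hq1
    calc _ = (ENNReal.ofReal (F x / f (U x)) * ENNReal.ofReal (f (U x)) ^ (1 / p)) *
          (ENNReal.ofReal (G y / g (V y)) * ENNReal.ofReal (g (V y)) ^ (1 / q)) *
          h (U x + V y) := by ring
      _ = _ := by rw [s1, s2, hKdef]; ring
  rw [e1, lintegral_lintegral_shear hKm θ, ← lintegral_mul_const]
  swap
  · have := hF.measurable; have := hG.measurable
    refine Measurable.pow_const (Measurable.lintegral_prod_right' (f := fun z : ℝ × ℝ =>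
      ENNReal.ofReal (F (z.1 + θ * z.2)) ^ (r / p) *
        ENNReal.ofReal (G ((1 - θ) * z.2 - z.1)) ^ (r / q)) ?_) _
    fun_prop
  refine lintegral_mono fun x => ?_
  have hm1 : Measurable fun t => ENNReal.ofReal (F (x + θ * t)) ^ (1 / p) *
      ENNReal.ofReal (G ((1 - θ) * t - x)) ^ (1 / q) := by
    have := hF.measurable; have := hG.measurable
    fun_prop
  have hm2 : Measurable fun t => ENNReal.ofReal (u (x + θ * t)) ^ (1 - 1 / p) *
      ENNReal.ofReal (v ((1 - θ) * t - x)) ^ (1 - 1 / q) *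
      h (U (x + θ * t) + V ((1 - θ) * t - x)) := by
    have := uc.measurable; have := vc.measurable; have := hUc.measurable
    have := hVc.measurable
    fun_prop
  -- Hölder in `t` at fixed `x`. The first factor gives the mixed norm of `F` and `G`; the second
  -- has to be bounded by the norm of `h` uniformly in `x`.
  refine (ENNReal.lintegral_mul_le_Lp_mul_Lq volume hr hm1.aemeasurable hm2.aemeasurable).trans ?_
  refine mul_le_mul' (le_of_eq ?_) (ENNReal.rpow_le_rpow ?_ hr'.le)
  · congr 1
    refine lintegral_congr fun t => ?_
    rw [ENNReal.mul_rpow_of_nonneg _ _ hr0.le, ← ENNReal.rpow_mul, ← ENNReal.rpow_mul]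
    congr 2 <;> ring
  -- The `r'`-th power of the second factor contains `u^θ v^(1-θ)`, by the choice of `θ`. The
  -- weighted arithmetic-geometric mean inequality bounds this by `θ u + (1 - θ) v`, the derivative
  -- of `w`, so `w` serves as the new variable.
  set w : ℝ → ℝ := fun t => U (x + θ * t) + V ((1 - θ) * t - x) with hwdef
  have hw : ∀ t, HasDerivAt w (θ * u (x + θ * t) + (1 - θ) * v ((1 - θ) * t - x)) t := by
    intro t
    have d1 : HasDerivAt (fun t => x + θ * t) θ t := by
      simpa using ((hasDerivAt_id t).const_mul θ).const_add x
    have d2 : HasDerivAt (fun t => (1 - θ) * t - x) (1 - θ) t := by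
      simpa using ((hasDerivAt_id t).const_mul (1 - θ)).sub_const x
    have := ((hUd _).comp t d1).add ((hVd _).comp t d2)
    rw [mul_comm θ, mul_comm (1 - θ)]
    exact this
  have wp : ∀ t, 0 < θ * u (x + θ * t) + (1 - θ) * v ((1 - θ) * t - x) := fun t =>
    add_pos (mul_pos hθ0 (up _)) (mul_pos hθ1 (vp _))
  refine le_trans (lintegral_mono fun t => ?_) (lintegral_deriv_mul_comp_le hw
    (fun t => (wp t).le) (strictMono_of_hasDerivAt_pos hw wp).injective fun y => h y ^ r')
  have hr'0 := hr.symm.pos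
  simp only [ENNReal.mul_rpow_of_nonneg _ _ hr'0.le, ← ENNReal.rpow_mul]
  rw [← hθ, ← hθ', mul_assoc θ, mul_assoc (1 - θ), one_div_mul_cancel hr'0.ne', mul_one, mul_one]
  gcongr
  rw [ENNReal.ofReal_rpow_of_pos (up _), ENNReal.ofReal_rpow_of_pos (vp _),
    ← ENNReal.ofReal_mul (by have := up (x + θ * t); positivity)]
  exact ENNReal.ofReal_le_ofReal (Real.geom_mean_le_arith_mean2_weighted hθ0.le hθ1.le
    (up _).le (vp _).le (by ring))

/-! ### Gaussian integrals and convolutions. -/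

section Gauss

set_option linter.unusedSectionVars false

variable {V : Type*} [NormedAddCommGroup V] [InnerProductSpace ℝ V]

/-- The function `exp (-π ‖x‖² / a)`, with values in `[0, ∞]`. -/
noncomputable def gaussE (a : ℝ) (x : V) : ℝ≥0∞ :=
  ENNReal.ofReal (Real.exp (-(Real.pi / a) * ‖x‖ ^ 2))

theorem gaussE_ne_top (a : ℝ) (x : V) : gaussE a x ≠ ∞ := ENNReal.ofReal_ne_top

theorem gaussE_rpow (a s : ℝ) (x : V) : gaussE a x ^ s = gaussE (a / s) x := by
  rw [gaussE, ENNReal.ofReal_rpow_of_pos (Real.exp_pos _), ← Real.exp_mul, gaussE]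
  congr 2
  rw [div_div_eq_mul_div]; ring

theorem continuous_gaussE (a : ℝ) : Continuous (gaussE a : V → ℝ≥0∞) := by
  refine ENNReal.continuous_ofReal.comp ?_
  fun_prop

/-- Completion of the square in `y`. -/
theorem gaussE_mul_gaussE {a b : ℝ} (ha : 0 < a) (hb : 0 < b) (x y : V) :
    gaussE a y * gaussE b (-y + x) =
      gaussE (a + b) x * gaussE (a * b / (a + b)) (y - (a / (a + b)) • x) := by
  have hab : 0 < a + b := add_pos ha hb
  unfold gaussE
  rw [← ENNReal.ofReal_mul (Real.exp_pos _).le, ← ENNReal.ofReal_mul (Real.exp_pos _).le,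
    ← Real.exp_add, ← Real.exp_add]
  congr 2
  rw [neg_add_eq_sub, norm_sub_sq_real, norm_sub_sq_real, norm_smul, inner_smul_right,
    real_inner_comm x y, Real.norm_of_nonneg (by positivity)]
  field_simp
  ring

variable [MeasurableSpace V] [BorelSpace V]

@[fun_prop]
theorem measurable_gaussE (a : ℝ) : Measurable (gaussE a : V → ℝ≥0∞) :=
  (continuous_gaussE a).measurable

variable [FiniteDimensional ℝ V]

theorem lintegral_gaussE {a : ℝ} (ha : 0 < a) :
    ∫⁻ x : V, gaussE a x = ENNReal.ofReal (a ^ (Module.finrank ℝ V / 2 : ℝ)) := by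
  have hb : 0 < Real.pi / a := div_pos Real.pi_pos ha
  have h := GaussianFourier.integral_rexp_neg_mul_sq_norm (V := V) hb
  have e : Real.pi / (Real.pi / a) = a := by field_simp
  rw [e] at h
  have hi : Integrable fun v : V => Real.exp (-(Real.pi / a) * ‖v‖ ^ 2) := by
    by_contra hc
    rw [integral_undef hc] at h
    exact (Real.rpow_pos_of_pos ha _).ne h
  rw [← h, ofReal_integral_eq_lintegral_ofReal hi (ae_of_all _ fun x => (Real.exp_pos _).le)]
  rfl

theorem lconvolution_gaussE {a b : ℝ} (ha : 0 < a) (hb : 0 < b) (x : V) :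
    lconvolution (gaussE a) (gaussE b) volume x =
      ENNReal.ofReal ((a * b / (a + b)) ^ (Module.finrank ℝ V / 2 : ℝ)) * gaussE (a + b) x := by
  rw [lconvolution_def]
  simp_rw [gaussE_mul_gaussE ha hb]
  rw [lintegral_const_mul _ (by fun_prop), lintegral_sub_right_eq_self (fun y => gaussE _ y),
    lintegral_gaussE (by positivity), mul_comm]

theorem lqNorm_gaussE {a p : ℝ} (ha : 0 < a) (hp : 0 < p) :
    lqNorm p (gaussE a : V → ℝ≥0∞) volume =
      ENNReal.ofReal ((a / p) ^ (Module.finrank ℝ V / 2 * (1 / p) : ℝ)) := by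
  unfold lqNorm
  simp_rw [gaussE_rpow]
  have : 0 < a / p := div_pos ha hp
  rw [lintegral_gaussE this, ENNReal.ofReal_rpow_of_pos (by positivity), Real.rpow_mul this.le]

end Gauss

/-! ### The constants `C_r`. -/

/-- The square of the constant `youngC`. -/
noncomputable def youngSq (p : ℝ) : ℝ := p ^ (1 / p) * |1 - 1 / p| ^ (1 - 1 / p)

theorem youngSq_pos {p : ℝ} (hp : 0 < p) : 0 < youngSq p := by
  unfold youngSq
  rcases eq_or_ne p 1 with rfl | h1
  · norm_num
  · have : 0 < |1 - 1 / p| := by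
      rw [abs_pos, sub_ne_zero]; intro h; field_simp at h; exact h1 h
    positivity

/-- The expression in `1 - 1 / p` needs no separate case at `p = 1`, where its second factor is `0 ^
0 = 1`. -/
theorem youngC_eq {p : ℝ} (hp : 0 < p) : youngC p = youngSq p ^ (1 / 2 : ℝ) := by
  unfold youngC youngSq
  split_ifs with h
  · subst h; norm_num
  · have h1 : p - 1 ≠ 0 := sub_ne_zero.2 h
    have e : 1 / (p / (p - 1)) = 1 - 1 / p := by field_simp
    rw [e]
    congr 1
    rw [div_eq_mul_inv]
    congr 1
    have e2 : p / (p - 1) = (1 - 1 / p)⁻¹ := by field_simp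
    rw [e2, abs_inv, Real.inv_rpow (abs_nonneg _), inv_inv]

theorem youngC_pos {p : ℝ} (hp : 0 < p) : 0 < youngC p := by
  rw [youngC_eq hp]; exact Real.rpow_pos_of_pos (youngSq_pos hp) _

/-- The constant in Young's inequality for two functions on the line. -/
noncomputable def pairC (p q r : ℝ) : ℝ := youngC p * youngC q / youngC r

theorem pairC_pos {p q r : ℝ} (hp : 0 < p) (hq : 0 < q) (hr : 0 < r) : 0 < pairC p q r :=
  div_pos (mul_pos (youngC_pos hp) (youngC_pos hq)) (youngC_pos hr)

theorem pairC_eq {p q r : ℝ} (hp : 0 < p) (hq : 0 < q) (hr : 0 < r) :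
    pairC p q r = (youngSq p * youngSq q / youngSq r) ^ (1 / 2 : ℝ) := by
  have := youngSq_pos hp
  have := youngSq_pos hq
  have := youngSq_pos hr
  rw [pairC, youngC_eq hp, youngC_eq hq, youngC_eq hr, Real.div_rpow (by positivity)
    (by positivity), Real.mul_rpow (by positivity) (by positivity)]

/-! ### Equality for Gaussians in Barthe's inequality. -/

section Line

/-- Positive continuous functions on the line with Gaussian decay. -/
structure IsNice (φ : ℝ → ℝ) : Prop where
  cont : Continuous φ
  pos : ∀ x, 0 < φ x
  bound : ∃ K a : ℝ, 0 < a ∧ ∀ x, φ x ≤ K * Real.exp (-a * x ^ 2)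

theorem IsNice.rpow {φ : ℝ → ℝ} (h : IsNice φ) {s : ℝ} (hs : 0 < s) :
    IsNice fun x => φ x ^ s := by
  obtain ⟨K, a, ha, hK⟩ := h.bound
  have hK0 : 0 ≤ K := by
    have := (h.pos 0).trans_le (hK 0)
    simp at this; exact this.le
  refine ⟨h.cont.rpow_const fun x => Or.inl (h.pos x).ne', fun x => Real.rpow_pos_of_pos (h.pos x) _,
    K ^ s, a * s, by positivity, fun x => ?_⟩
  refine (Real.rpow_le_rpow (h.pos x).le (hK x) hs.le).trans_eq ?_
  rw [Real.mul_rpow hK0 (Real.exp_pos _).le, ← Real.exp_mul]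
  congr 2; ring

theorem IsNice.integrable {φ : ℝ → ℝ} (h : IsNice φ) : Integrable φ := by
  obtain ⟨K, a, ha, hK⟩ := h.bound
  refine ((integrable_exp_neg_mul_sq ha).const_mul K).mono' h.cont.aestronglyMeasurable ?_
  exact ae_of_all _ fun x => by rw [Real.norm_of_nonneg (h.pos x).le]; exact hK x

theorem IsNice.comp_mul {φ : ℝ → ℝ} (h : IsNice φ) {c : ℝ} (hc : c ≠ 0) :
    IsNice fun x => φ (c * x) := by
  obtain ⟨K, a, ha, hK⟩ := h.bound
  refine ⟨h.cont.comp (by fun_prop), fun x => h.pos _, K, a * c ^ 2, by positivity, fun x => ?_⟩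
  refine (hK _).trans_eq ?_
  congr 2; ring

theorem isNice_gauss {c a : ℝ} (hc : 0 < c) (ha : 0 < a) :
    IsNice fun x => c * Real.exp (-(Real.pi / a) * ‖x‖ ^ 2) := by
  refine ⟨by fun_prop, fun x => by positivity, c, Real.pi / a, by positivity, fun x => ?_⟩
  simp

theorem IsNice.lintegral_eq {φ : ℝ → ℝ} (h : IsNice φ) :
    ∫⁻ x, ENNReal.ofReal (φ x) = ENNReal.ofReal (∫ x, φ x) :=
  (ofReal_integral_eq_lintegral_ofReal h.integrable (ae_of_all _ fun x => (h.pos x).le)).symm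

theorem IsNice.integral_pos {φ : ℝ → ℝ} (h : IsNice φ) : 0 < ∫ x, φ x := by
  rw [integral_pos_iff_support_of_nonneg (fun x => (h.pos x).le) h.integrable]
  have : Function.support φ = univ := by ext x; simp [(h.pos x).ne']
  simp [this]

theorem ofReal_gauss {c : ℝ} (hc : 0 < c) (a x : ℝ) :
    ENNReal.ofReal (c * Real.exp (-(Real.pi / a) * ‖x‖ ^ 2)) =
      ENNReal.ofReal c * gaussE a x := by
  rw [ENNReal.ofReal_mul hc.le, gaussE]

theorem integral_gauss (m : ℝ) {a : ℝ} (ha : 0 < a) :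
    ∫ x : ℝ, m * a ^ (-(1 / 2) : ℝ) * Real.exp (-(Real.pi / a) * ‖x‖ ^ 2) = m := by
  have hb : 0 < Real.pi / a := div_pos Real.pi_pos ha
  rw [integral_const_mul, GaussianFourier.integral_rexp_neg_mul_sq_norm hb]
  have e : Real.pi / (Real.pi / a) = a := by field_simp
  rw [e, mul_assoc, ← Real.rpow_add ha]
  simp

/-- The mixed norm on the right-hand side of Barthe's inequality. -/
noncomputable def mixedNorm (p q r θ : ℝ) (F G : ℝ → ℝ) : ℝ≥0∞ :=
  ∫⁻ x, (∫⁻ t, ENNReal.ofReal (F (x + θ * t)) ^ (r / p) *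
        ENNReal.ofReal (G ((1 - θ) * t - x)) ^ (r / q)) ^ (1 / r)

/-- Barthe's inequality is bilinear in the powers of `f` and `g`, tested against an arbitrary `h`;
duality removes `h`. -/
theorem lqNorm_lconvolution_le_mixedNorm {f F g G : ℝ → ℝ} (hf : IsNice f) (hF : IsNice F)
    (hg : IsNice g) (hG : IsNice G) (hfF : ∫ x, f x = ∫ x, F x) (hgG : ∫ x, g x = ∫ x, G x)
    {p q r r' θ : ℝ} (hp : 0 < p) (hp1 : 1 / p < 1) (hq : 0 < q) (hq1 : 1 / q < 1)
    (hr : r.HolderConjugate r')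
    (hθ : θ * (1 / r') = 1 - 1 / p) (hθ' : (1 - θ) * (1 / r') = 1 - 1 / q) :
    lqNorm r (lconvolution (fun x => ENNReal.ofReal (f x) ^ (1 / p))
      (fun x => ENNReal.ofReal (g x) ^ (1 / q)) volume) volume ≤ mixedNorm p q r θ F G := by
  have hfm := hf.cont.measurable
  have hgm := hg.cont.measurable
  refine lqNorm_le_of_forall_lintegral_mul_le hr (measurable_lconvolution _ (by fun_prop)
    (by fun_prop)) fun h hh => ?_
  refine le_trans (le_of_eq ?_) (lintegral_lintegral_rpow_mul_le hf.cont hf.pos hf.integrable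
    hF.cont hF.pos hF.integrable hg.cont hg.pos hg.integrable hG.cont hG.pos hG.integrable
    hfF hgG hp hp1 hq hq1 hr hθ hθ' hh)
  simp_rw [lconvolution_def]
  calc _ = ∫⁻ x, ∫⁻ y, ENNReal.ofReal (f y) ^ (1 / p) * ENNReal.ofReal (g (-y + x)) ^ (1 / q) *
        h x := by
        refine lintegral_congr fun x => ?_
        rw [lintegral_mul_const _ (by fun_prop)]
    _ = ∫⁻ y, ∫⁻ x, ENNReal.ofReal (f y) ^ (1 / p) * ENNReal.ofReal (g (-y + x)) ^ (1 / q) *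
        h x := lintegral_lintegral_swap (Measurable.aemeasurable (by fun_prop))
    _ = _ := by
        refine lintegral_congr fun y => ?_
        rw [← lintegral_add_left_eq_self _ y]
        simp

section Log

variable {x y : ℝ}

theorem log_mul_of_pos (hx : 0 < x) (hy : 0 < y) : Real.log (x * y) = Real.log x + Real.log y :=
  Real.log_mul hx.ne' hy.ne'

theorem log_div_of_pos (hx : 0 < x) (hy : 0 < y) : Real.log (x / y) = Real.log x - Real.log y :=
  Real.log_div hx.ne' hy.ne'

end Log

/-- The form in which the constant comes out of the Gaussian integrals below. Taking logarithms
reduces the identity to algebra. -/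
theorem pairC_eq_gauss {p q r : ℝ} (hp : 0 < p) (hp1 : 1 / p < 1) (hq : 0 < q) (hq1 : 1 / q < 1)
    (hr : 0 < r) (hr1 : 1 / r < 1) :
    pairC p q r = (((1 - 1 / p) / p) ^ (-(1 / 2) : ℝ)) ^ (1 / p) *
      (((1 - 1 / q) / q) ^ (-(1 / 2) : ℝ)) ^ (1 / q) *
      (((1 - 1 / p) * (1 - 1 / q) / (1 - 1 / r)) ^ (1 / 2 : ℝ) *
      ((1 - 1 / r) / r) ^ (1 / 2 * (1 / r))) := by
  have hA : 0 < 1 - 1 / p := by linarith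
  have hB : 0 < 1 - 1 / q := by linarith
  have hR : 0 < 1 - 1 / r := by linarith
  rw [pairC_eq hp hq hr, youngSq, youngSq, youngSq, abs_of_pos hA, abs_of_pos hB, abs_of_pos hR]
  refine Real.log_injOn_pos (by simp only [mem_Ioi]; positivity)
    (by simp only [mem_Ioi]; positivity) ?_
  simp (disch := positivity) only [log_mul_of_pos, log_div_of_pos, Real.log_rpow]
  ring

variable {p q r : ℝ}

/-- The variances are chosen so that the `1/p`-th and `1/q`-th powers have widths `1 - 1/p` and `1 -
1/q`, which add up to `1 - 1/r`. The prefactors make `m` and `n` the masses. -/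
theorem lqNorm_lconvolution_gauss (hp : 0 < p) (hp1 : 1 / p < 1) (hq : 0 < q) (hq1 : 1 / q < 1)
    (hr : 0 < r) (hr1 : 1 / r < 1) (h : 1 / p + 1 / q = 1 + 1 / r)
    {m n : ℝ} (hm : 0 < m) (hn : 0 < n) :
    lqNorm r (lconvolution
      (fun x : ℝ => ENNReal.ofReal (m * ((1 - 1 / p) / p) ^ (-(1 / 2) : ℝ) *
        Real.exp (-(Real.pi / ((1 - 1 / p) / p)) * ‖x‖ ^ 2)) ^ (1 / p))
      (fun x => ENNReal.ofReal (n * ((1 - 1 / q) / q) ^ (-(1 / 2) : ℝ) *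
        Real.exp (-(Real.pi / ((1 - 1 / q) / q)) * ‖x‖ ^ 2)) ^ (1 / q)) volume) volume =
      ENNReal.ofReal (m ^ (1 / p) * n ^ (1 / q) * pairC p q r) := by
  have hA : 0 < 1 - 1 / p := by linarith
  have hB : 0 < 1 - 1 / q := by linarith
  have hR : 0 < 1 - 1 / r := by linarith
  have hAB : (1 - 1 / p) + (1 - 1 / q) = 1 - 1 / r := by linarith
  have e : ∀ {s c x : ℝ}, 0 < s → 0 < c → 0 < 1 - 1 / s →
      ENNReal.ofReal (c * ((1 - 1 / s) / s) ^ (-(1 / 2) : ℝ) *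
        Real.exp (-(Real.pi / ((1 - 1 / s) / s)) * ‖x‖ ^ 2)) ^ (1 / s) =
      ENNReal.ofReal ((c * ((1 - 1 / s) / s) ^ (-(1 / 2) : ℝ)) ^ (1 / s)) *
        gaussE (1 - 1 / s) x := by
    intro s c x hs hc hs1
    rw [ofReal_gauss (by positivity), ENNReal.mul_rpow_of_nonneg _ _ (by positivity),
      gaussE_rpow, ENNReal.ofReal_rpow_of_pos (by positivity)]
    congr 2
    field_simp
  simp_rw [fun x => e (x := x) hp hm hA, fun x => e (x := x) hq hn hB]
  have e2 : ∀ c d : ℝ≥0∞, lconvolution (fun x : ℝ => c * gaussE (1 - 1 / p) x)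
      (fun x => d * gaussE (1 - 1 / q) x) volume = fun x => (c * d) *
        (ENNReal.ofReal (((1 - 1 / p) * (1 - 1 / q) / (1 - 1 / r)) ^ (1 / 2 : ℝ)) *
          gaussE (1 - 1 / r) x) := by
    intro c d
    ext x
    have := lconvolution_gaussE hA hB x
    rw [hAB] at this
    simp only [Module.finrank_self, Nat.cast_one] at this
    rw [← this, lconvolution_def, lconvolution_def, ← lintegral_const_mul _ (by fun_prop)]
    refine lintegral_congr fun y => ?_
    ring
  rw [e2, lqNorm_const_mul hr (by fun_prop), lqNorm_const_mul hr (by fun_prop),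
    lqNorm_gaussE hR hr, ← ENNReal.ofReal_mul (by positivity), ← ENNReal.ofReal_mul (by positivity),
    ← ENNReal.ofReal_mul (by positivity), pairC_eq_gauss hp hp1 hq hq1 hr hr1]
  congr 1
  rw [Real.mul_rpow hm.le (by positivity), Real.mul_rpow hn.le (by positivity)]
  simp only [Module.finrank_self, Nat.cast_one]
  ring

/-- The value agrees with `lqNorm_lconvolution_gauss`: these Gaussians give equality in Barthe's
inequality, which is why it yields sharp constants in both directions. -/
theorem mixedNorm_gauss (hp : 0 < p) (hp1 : 1 / p < 1) (hq : 0 < q) (hq1 : 1 / q < 1)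
    (hr : 0 < r) (hr1 : 1 / r < 1) (h : 1 / p + 1 / q = 1 + 1 / r)
    {m n θ : ℝ} (hm : 0 < m) (hn : 0 < n) (hθ : θ * (1 - 1 / r) = 1 - 1 / p) :
    mixedNorm p q r θ
      (fun x : ℝ => m * ((1 - 1 / p) / p) ^ (-(1 / 2) : ℝ) *
        Real.exp (-(Real.pi / ((1 - 1 / p) / p)) * ‖x‖ ^ 2))
      (fun x => n * ((1 - 1 / q) / q) ^ (-(1 / 2) : ℝ) *
        Real.exp (-(Real.pi / ((1 - 1 / q) / q)) * ‖x‖ ^ 2)) =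
      ENNReal.ofReal (m ^ (1 / p) * n ^ (1 / q) * pairC p q r) := by
  have hA : 0 < 1 - 1 / p := by linarith
  have hB : 0 < 1 - 1 / q := by linarith
  have hR : 0 < 1 - 1 / r := by linarith
  have hAB : (1 - 1 / p) + (1 - 1 / q) = 1 - 1 / r := by linarith
  have e : ∀ {s c x : ℝ}, 0 < s → 0 < c → 0 < 1 - 1 / s →
      ENNReal.ofReal (c * ((1 - 1 / s) / s) ^ (-(1 / 2) : ℝ) *
        Real.exp (-(Real.pi / ((1 - 1 / s) / s)) * ‖x‖ ^ 2)) ^ (r / s) =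
      ENNReal.ofReal ((c * ((1 - 1 / s) / s) ^ (-(1 / 2) : ℝ)) ^ (1 / s)) ^ r *
        gaussE ((1 - 1 / s) / r) x := by
    intro s c x hs hc hs1
    rw [ofReal_gauss (by positivity), ENNReal.mul_rpow_of_nonneg _ _ (by positivity),
      gaussE_rpow, ← ENNReal.ofReal_rpow_of_pos (by positivity), ← ENNReal.rpow_mul]
    congr 2
    · ring
    · field_simp
  -- For `θ = (1 - 1/p) / (1 - 1/r)` the cross terms in `x` and `t` cancel, so the inner integral
  -- separates.
  have e3 : ∀ x t : ℝ, gaussE ((1 - 1 / p) / r) (x + θ * t) *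
      gaussE ((1 - 1 / q) / r) ((1 - θ) * t - x) =
      gaussE ((1 - 1 / p) * (1 - 1 / q) / (1 - 1 / r) / r) x * gaussE ((1 - 1 / r) / r) t := by
    intro x t
    unfold gaussE
    rw [← ENNReal.ofReal_mul (Real.exp_pos _).le, ← ENNReal.ofReal_mul (Real.exp_pos _).le,
      ← Real.exp_add, ← Real.exp_add]
    congr 2
    simp only [Real.norm_eq_abs, sq_abs]
    have hθ1 : θ = (1 - 1 / p) / (1 - 1 / r) := by
      rw [eq_div_iff hR.ne']; exact hθ
    rw [hθ1, ← hAB]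
    have hAB' : 0 < (1 - 1 / p) + (1 - 1 / q) := by linarith
    generalize 1 - 1 / p = A at *
    generalize 1 - 1 / q = B at *
    field_simp
    ring
  unfold mixedNorm
  simp_rw [fun x => e (x := x) hp hm hA, fun x => e (x := x) hq hn hB]
  generalize hc : ENNReal.ofReal ((m * ((1 - 1 / p) / p) ^ (-(1 / 2) : ℝ)) ^ (1 / p)) = c
  generalize hd : ENNReal.ofReal ((n * ((1 - 1 / q) / q) ^ (-(1 / 2) : ℝ)) ^ (1 / q)) = d
  have e4 : ∀ x t : ℝ, c ^ r * gaussE ((1 - 1 / p) / r) (x + θ * t) *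
      (d ^ r * gaussE ((1 - 1 / q) / r) ((1 - θ) * t - x)) = (c ^ r * d ^ r *
      gaussE ((1 - 1 / p) * (1 - 1 / q) / (1 - 1 / r) / r) x) * gaussE ((1 - 1 / r) / r) t := by
    intro x t
    rw [mul_assoc (c ^ r * d ^ r), ← e3]; ring
  have e5 : ∀ x : ℝ, (∫⁻ t : ℝ, c ^ r * gaussE ((1 - 1 / p) / r) (x + θ * t) *
      (d ^ r * gaussE ((1 - 1 / q) / r) ((1 - θ) * t - x))) ^ (1 / r) =
      (c * d * ENNReal.ofReal (((1 - 1 / r) / r) ^ (1 / 2 * (1 / r)))) *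
      gaussE ((1 - 1 / p) * (1 - 1 / q) / (1 - 1 / r)) x := by
    intro x
    simp_rw [e4]
    have hr0 : 0 ≤ 1 / r := by positivity
    rw [lintegral_const_mul _ (by fun_prop), lintegral_gaussE (by positivity),
      ENNReal.mul_rpow_of_nonneg _ _ hr0, ENNReal.mul_rpow_of_nonneg _ _ hr0,
      ENNReal.mul_rpow_of_nonneg _ _ hr0, gaussE_rpow, ← ENNReal.rpow_mul, ← ENNReal.rpow_mul,
      mul_one_div_cancel hr.ne', ENNReal.rpow_one, ENNReal.rpow_one,
      ENNReal.ofReal_rpow_of_pos (by positivity), ← Real.rpow_mul (by positivity)]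
    have : (1 - 1 / p) * (1 - 1 / q) / (1 - 1 / r) / r / (1 / r) =
        (1 - 1 / p) * (1 - 1 / q) / (1 - 1 / r) := by field_simp
    rw [this]
    simp only [Module.finrank_self, Nat.cast_one]
    ring
  simp_rw [e5]
  rw [lintegral_const_mul _ (by fun_prop), lintegral_gaussE (by positivity), ← hc, ← hd,
    ← ENNReal.ofReal_mul (by positivity), ← ENNReal.ofReal_mul (by positivity),
    ← ENNReal.ofReal_mul (by positivity), pairC_eq_gauss hp hp1 hq hq1 hr hr1]
  congr 1
  rw [Real.mul_rpow hm.le (by positivity), Real.mul_rpow hn.le (by positivity)]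
  simp only [Module.finrank_self, Nat.cast_one]
  ring

end Line

/-! ### Sharp Young and reverse Young for nice functions on the line. -/

section Line

variable {p q r : ℝ}

theorem holderConjugate_of_one_div (hr : 0 < r) (hr1 : 1 / r < 1) :
    r.HolderConjugate (1 / (1 - 1 / r)) := by
  rw [Real.holderConjugate_iff]
  have : 0 < 1 - 1 / r := by linarith
  refine ⟨by rwa [div_lt_one hr] at hr1, ?_⟩
  simp

/-- Barthe's inequality with `f = φ^p` and `g = γ^q`, compared with extremal Gaussians `F` and `G`
of the same masses. -/
theorem IsNice.young {φ γ : ℝ → ℝ} (hφ : IsNice φ) (hγ : IsNice γ)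
    (hp : 0 < p) (hp1 : 1 / p < 1) (hq : 0 < q) (hq1 : 1 / q < 1)
    (hr : 0 < r) (hr1 : 1 / r < 1) (h : 1 / p + 1 / q = 1 + 1 / r) :
    lqNorm r (lconvolution (fun x => ENNReal.ofReal (φ x)) (fun x => ENNReal.ofReal (γ x)) volume)
      volume ≤ ENNReal.ofReal (pairC p q r) *
        (lqNorm p (fun x => ENNReal.ofReal (φ x)) volume *
          lqNorm q (fun x => ENNReal.ofReal (γ x)) volume) := by
  have hA : 0 < 1 - 1 / p := by linarith
  have hB : 0 < 1 - 1 / q := by linarith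
  have hR : 0 < 1 - 1 / r := by linarith
  have hf := hφ.rpow hp
  have hg := hγ.rpow hq
  have mf := hf.integral_pos
  have mg := hg.integral_pos
  have key := lqNorm_lconvolution_le_mixedNorm hf (isNice_gauss (c := (∫ x, φ x ^ p) *
    ((1 - 1 / p) / p) ^ (-(1 / 2) : ℝ)) (a := (1 - 1 / p) / p) (by positivity) (by positivity)) hg
    (isNice_gauss (c := (∫ x, γ x ^ q) * ((1 - 1 / q) / q) ^ (-(1 / 2) : ℝ))
      (a := (1 - 1 / q) / q) (by positivity) (by positivity))
    (integral_gauss _ (by positivity)).symm (integral_gauss _ (by positivity)).symm hp hp1 hq hq1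
    (holderConjugate_of_one_div hr hr1) (θ := (1 - 1 / p) / (1 - 1 / r))
    (by rw [one_div_one_div, div_mul_cancel₀ _ hR.ne'])
    (by rw [one_div_one_div, sub_mul, div_mul_cancel₀ _ hR.ne']; linarith)
  rw [mixedNorm_gauss hp hp1 hq hq1 hr hr1 h mf mg (div_mul_cancel₀ _ hR.ne')] at key
  have e : ∀ {f : ℝ → ℝ} {s : ℝ}, IsNice f → 0 < s →
      (fun x => ENNReal.ofReal (f x ^ s) ^ (1 / s)) = fun x => ENNReal.ofReal (f x) := by
    intro f s hf hs
    ext x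
    rw [← ENNReal.ofReal_rpow_of_pos (hf.pos x), ← ENNReal.rpow_mul, mul_one_div_cancel hs.ne',
      ENNReal.rpow_one]
  have e2 : ∀ {f : ℝ → ℝ} {s : ℝ}, IsNice f → 0 < s →
      lqNorm s (fun x => ENNReal.ofReal (f x)) volume =
        ENNReal.ofReal ((∫ x, f x ^ s) ^ (1 / s)) := by
    intro f s hf hs
    rw [← ENNReal.ofReal_rpow_of_pos (hf.rpow hs).integral_pos, ← (hf.rpow hs).lintegral_eq]
    simp only [lqNorm, ENNReal.ofReal_rpow_of_pos (hf.pos _)]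
  rw [e hφ hp, e hγ hq] at key
  rw [e2 hφ hp, e2 hγ hq, ← ENNReal.ofReal_mul (by positivity), ← ENNReal.ofReal_mul
    (pairC_pos hp hq hr).le]
  refine key.trans_eq ?_
  congr 1; ring

theorem lintegral_comp_const_mul {c : ℝ} (hc : c ≠ 0) {f : ℝ → ℝ≥0∞} (hf : Measurable f) :
    ∫⁻ x, f (c * x) = ENNReal.ofReal |c⁻¹| * ∫⁻ x, f x := by
  rw [← smul_eq_mul, ← lintegral_smul_measure, ← Real.map_volume_mul_left hc,
    lintegral_map hf (by fun_prop)]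

/-- The scaling relation gives `1 - r/p = -r (1 - 1/q)` and its analogue for `q`, so passing to the
reverse exponents interchanges the roles of `p` and `q`. The powers of `θ` and `1 - θ` are the
Jacobians arising in `IsNice.young_reverse`. -/
theorem pairC_reverse_eq {θ : ℝ} (hp : 0 < p) (hp1 : 1 / p < 1) (hq : 0 < q) (hq1 : 1 / q < 1)
    (hr : 0 < r) (hr1 : 1 / r < 1) (h : 1 / p + 1 / q = 1 + 1 / r)
    (hθ : θ = (1 - 1 / p) / (1 - 1 / r)) :
    pairC (p / r) (q / r) (1 / r) =
      θ * (1 - θ) ^ (-r) * ((1 - θ) / θ) ^ (r / q) * pairC p q r ^ r := by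
  have hA : 0 < 1 - 1 / p := by linarith
  have hB : 0 < 1 - 1 / q := by linarith
  have hR : 0 < 1 - 1 / r := by linarith
  have hθ' : 1 - θ = (1 - 1 / q) / (1 - 1 / r) := by
    rw [hθ, eq_div_iff hR.ne', sub_mul, div_mul_cancel₀ _ hR.ne']; linarith
  have a1 : |1 - 1 / (p / r)| = r * (1 - 1 / q) := by
    have : 1 - 1 / (p / r) = - (r * (1 - 1 / q)) := by
      have : 1 / q = 1 + 1 / r - 1 / p := by linarith
      rw [this]; field_simp; ring
    rw [this, abs_neg, abs_of_pos (by positivity)]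
  have a2 : |1 - 1 / (q / r)| = r * (1 - 1 / p) := by
    have : 1 - 1 / (q / r) = - (r * (1 - 1 / p)) := by
      have : 1 / p = 1 + 1 / r - 1 / q := by linarith
      rw [this]; field_simp; ring
    rw [this, abs_neg, abs_of_pos (by positivity)]
  have a3 : |1 - 1 / (1 / r)| = r * (1 - 1 / r) := by
    have : 1 - 1 / (1 / r) = - (r * (1 - 1 / r)) := by field_simp; ring
    rw [this, abs_neg, abs_of_pos (by positivity)]
  rw [pairC_eq hp hq hr, pairC_eq (by positivity) (by positivity) (by positivity), youngSq,
    youngSq, youngSq, youngSq, youngSq, youngSq, a1, a2, a3, abs_of_pos hA, abs_of_pos hB,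
    abs_of_pos hR, hθ', hθ]
  refine Real.log_injOn_pos (by simp only [mem_Ioi]; positivity)
    (by simp only [mem_Ioi]; positivity) ?_
  simp (disch := positivity) only [log_mul_of_pos, log_div_of_pos, Real.log_rpow, Real.log_one]
  have hq' : 1 / q = 1 + 1 / r - 1 / p := by linarith
  have i1 : 1 / (p / r) = r * (1 / p) := by field_simp
  have i2 : 1 / (q / r) = r * (1 / q) := by field_simp
  have i3 : r / q = r * (1 / q) := by field_simp
  rw [i1, i2, i3, hq', one_div_one_div]
  generalize Real.log (1 - 1 / p) = lA
  generalize Real.log (1 - (1 + 1 / r - 1 / p)) = lB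
  generalize Real.log (1 - 1 / r) = lR
  generalize Real.log p = lp
  generalize Real.log q = lq
  generalize Real.log r = lr
  field_simp
  ring

/-- Here the Gaussians are `f` and `g`, while `F` and `G` are powers of `φ` and of a dilate of `γ`.
The inner integral of the mixed norm is then a multiple of `φ * γ` at a dilated point, and the outer
integral is its `L^(1/r)` quasi-norm up to powers. -/
theorem IsNice.young_reverse {φ γ : ℝ → ℝ} (hφ : IsNice φ) (hγ : IsNice γ)
    (hp : 0 < p) (hp1 : 1 / p < 1) (hq : 0 < q) (hq1 : 1 / q < 1)
    (hr : 0 < r) (hr1 : 1 / r < 1) (h : 1 / p + 1 / q = 1 + 1 / r) :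
    ENNReal.ofReal (pairC (p / r) (q / r) (1 / r)) *
        (lqNorm (p / r) (fun x => ENNReal.ofReal (φ x)) volume *
          lqNorm (q / r) (fun x => ENNReal.ofReal (γ x)) volume) ≤
    lqNorm (1 / r) (lconvolution (fun x => ENNReal.ofReal (φ x)) (fun x => ENNReal.ofReal (γ x))
      volume) volume := by
  have hA : 0 < 1 - 1 / p := by linarith
  have hB : 0 < 1 - 1 / q := by linarith
  have hR : 0 < 1 - 1 / r := by linarith
  set θ := (1 - 1 / p) / (1 - 1 / r) with hθ
  have hθ' : 1 - θ = (1 - 1 / q) / (1 - 1 / r) := by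
    rw [hθ, eq_div_iff hR.ne', sub_mul, div_mul_cancel₀ _ hR.ne']; linarith
  have θ0 : 0 < θ := by positivity
  have θ1 : 0 < 1 - θ := by rw [hθ']; positivity
  have hP : 0 < p / r := by positivity
  have hQ : 0 < q / r := by positivity
  have hF := hφ.rpow hP
  -- With this factor the arguments of `φ` and `γ` in the mixed norm sum to `(1 - θ)⁻¹ * x`,
  -- independently of `t`; hence the inner integral is a convolution.
  have hG := (hγ.rpow hQ).comp_mul (c := -(θ / (1 - θ))) (by
    rw [neg_ne_zero]; positivity)
  have mF := hF.integral_pos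
  have mG := hG.integral_pos
  have key := lqNorm_lconvolution_le_mixedNorm (isNice_gauss (c := (∫ x, φ x ^ (p / r)) *
    ((1 - 1 / p) / p) ^ (-(1 / 2) : ℝ)) (a := (1 - 1 / p) / p) (by positivity) (by positivity)) hF
    (isNice_gauss (c := (∫ x, γ (-(θ / (1 - θ)) * x) ^ (q / r)) *
      ((1 - 1 / q) / q) ^ (-(1 / 2) : ℝ)) (a := (1 - 1 / q) / q) (by positivity) (by positivity)) hG
    (integral_gauss _ (by positivity)) (integral_gauss _ (by positivity)) hp hp1 hq hq1
    (holderConjugate_of_one_div hr hr1) (θ := θ) (by rw [one_div_one_div, hθ, div_mul_cancel₀ _ hR.ne'])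
    (by rw [one_div_one_div, hθ', div_mul_cancel₀ _ hR.ne'])
  rw [lqNorm_lconvolution_gauss hp hp1 hq hq1 hr hr1 h mF mG] at key
  have hφm := hφ.cont.measurable
  have hγm := hγ.cont.measurable
  set cv := lconvolution (fun x => ENNReal.ofReal (φ x)) (fun x => ENNReal.ofReal (γ x)) volume
    with hcv
  have hcm : Measurable cv := measurable_lconvolution _ (by fun_prop) (by fun_prop)
  have hpow : ∀ {f : ℝ → ℝ} {s : ℝ} (x : ℝ), IsNice f → 0 < s →
      ENNReal.ofReal (f x ^ (s / r)) ^ (r / s) = ENNReal.ofReal (f x) := by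
    intro f s x hf hs
    rw [← ENNReal.ofReal_rpow_of_pos (hf.pos x), ← ENNReal.rpow_mul,
      div_mul_div_cancel₀ hr.ne', div_self hs.ne', ENNReal.rpow_one]
  have inner : ∀ x : ℝ, ∫⁻ t, ENNReal.ofReal (φ (x + θ * t) ^ (p / r)) ^ (r / p) *
      ENNReal.ofReal (γ (-(θ / (1 - θ)) * ((1 - θ) * t - x)) ^ (q / r)) ^ (r / q) =
      ENNReal.ofReal θ⁻¹ * cv ((1 - θ)⁻¹ * x) := by
    intro x
    simp_rw [fun y => hpow y hφ hp, fun y => hpow y hγ hq]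
    let H : ℝ → ℝ≥0∞ := fun w => ENNReal.ofReal (φ w) * ENNReal.ofReal (γ (-w + (1 - θ)⁻¹ * x))
    have hH : Measurable fun w => H (x + w) := by
      simp only [H]; fun_prop
    calc _ = ∫⁻ t, (fun w => H (x + w)) (θ * t) := by
          refine lintegral_congr fun t => ?_
          simp only [H]
          congr 3
          field_simp
          ring
      _ = ENNReal.ofReal |θ⁻¹| * ∫⁻ w, H (x + w) := lintegral_comp_const_mul θ0.ne' hH
      _ = _ := by
          rw [lintegral_add_left_eq_self H x, abs_of_pos (by positivity), hcv, lconvolution_def]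
  have hmix : mixedNorm p q r θ (fun x => φ x ^ (p / r))
      (fun x => γ (-(θ / (1 - θ)) * x) ^ (q / r)) =
      ENNReal.ofReal (θ ^ (-(1 / r)) * (1 - θ)) * ∫⁻ x, cv x ^ (1 / r) := by
    unfold mixedNorm
    simp_rw [inner]
    have hr0 : 0 ≤ 1 / r := by positivity
    simp_rw [ENNReal.mul_rpow_of_nonneg _ _ hr0]
    rw [lintegral_const_mul _ (by fun_prop),
      lintegral_comp_const_mul (inv_ne_zero θ1.ne') (f := fun x => cv x ^ (1 / r)) (by fun_prop),
      inv_inv, abs_of_pos θ1, ← mul_assoc, ENNReal.ofReal_rpow_of_pos (by positivity),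
      ← ENNReal.ofReal_mul (by positivity), Real.inv_rpow θ0.le, Real.rpow_neg θ0.le]
  rw [hmix] at key
  have e2 : ∀ {f : ℝ → ℝ} {s : ℝ}, IsNice f → 0 < s →
      lqNorm s (fun x => ENNReal.ofReal (f x)) volume =
        ENNReal.ofReal ((∫ x, f x ^ s) ^ (1 / s)) := by
    intro f s hf hs
    rw [← ENNReal.ofReal_rpow_of_pos (hf.rpow hs).integral_pos, ← (hf.rpow hs).lintegral_eq]
    simp only [lqNorm, ENNReal.ofReal_rpow_of_pos (hf.pos _)]
  have hGint : ∫ x, γ (-(θ / (1 - θ)) * x) ^ (q / r) = ((1 - θ) / θ) * ∫ x, γ x ^ (q / r) := by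
    rw [Measure.integral_comp_mul_left (fun x => γ x ^ (q / r)), abs_inv, abs_neg,
      abs_of_pos (by positivity), inv_div, smul_eq_mul]
  have key2 := ENNReal.rpow_le_rpow key hr.le
  have hI := (hγ.rpow hQ).integral_pos
  have hC := pairC_pos hp hq hr
  rw [hGint, ENNReal.mul_rpow_of_nonneg _ _ hr.le, ENNReal.ofReal_rpow_of_pos (by positivity),
    ENNReal.ofReal_rpow_of_pos (by positivity)] at key2
  have key3 := mul_le_mul_right key2 (ENNReal.ofReal (θ * (1 - θ) ^ (-r)))
  rw [← ENNReal.ofReal_mul (by positivity), ← mul_assoc, ← ENNReal.ofReal_mul (by positivity)]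
    at key3
  have one : θ * (1 - θ) ^ (-r) * (θ ^ (-(1 / r)) * (1 - θ)) ^ r = 1 := by
    rw [Real.mul_rpow (by positivity) θ1.le, ← Real.rpow_mul θ0.le, neg_mul,
      one_div_mul_cancel hr.ne', Real.rpow_neg θ1.le, Real.rpow_neg θ0.le, Real.rpow_one]
    have := (Real.rpow_pos_of_pos θ1 r).ne'
    field_simp
  rw [one, ENNReal.ofReal_one, one_mul] at key3
  rw [e2 hφ hP, e2 hγ hQ, ← ENNReal.ofReal_mul (by positivity), ← ENNReal.ofReal_mul
    (pairC_pos hP hQ (by positivity)).le, lqNorm, one_div_one_div]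
  refine le_trans (le_of_eq ?_) key3
  congr 1
  rw [pairC_reverse_eq hp hp1 hq hq1 hr hr1 h hθ, Real.mul_rpow (by positivity) hC.le,
    Real.mul_rpow (by positivity) (by positivity), Real.mul_rpow (by positivity) hI.le,
    ← Real.rpow_mul mF.le, Real.mul_rpow (by positivity) (by positivity), ← Real.rpow_mul hI.le,
    ← Real.rpow_mul (by positivity)]
  have i1 : 1 / (p / r) = 1 / p * r := by field_simp
  have i2 : 1 / (q / r) = 1 / q * r := by field_simp
  have i3 : r / q = 1 / q * r := by field_simp
  rw [i1, i2, i3]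
  ring

end Line

/-! ### From nice functions to all measurable functions on the line. -/

section Line

variable {b : Bool} {p q r : ℝ}

theorem ExpDir.one_div_lt (hp : ExpDir true p) (h : p ≠ 1) : 1 / p < 1 := by
  rw [div_lt_one hp.1]
  exact lt_of_le_of_ne hp.2 h.symm

theorem ExpDir.one_lt_one_div (hp : ExpDir false p) (h : p ≠ 1) : 1 < 1 / p := by
  rw [lt_div_iff₀ hp.1, one_mul]
  exact lt_of_le_of_ne hp.2 h

/-- The involution sending `(p, q, r)` to `(p/r, q/r, 1/r)` preserves the scaling relation and
exchanges the ranges below and above one. -/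
theorem IsNice.young_dir {φ γ : ℝ → ℝ} (hφ : IsNice φ) (hγ : IsNice γ) (hp : ExpDir b p)
    (hq : ExpDir b q) (hr : ExpDir b r) (hp1 : p ≠ 1) (hq1 : q ≠ 1) (hr1 : r ≠ 1)
    (h : 1 / p + 1 / q = 1 + 1 / r) :
    leDir b (lqNorm r (lconvolution (fun x => ENNReal.ofReal (φ x))
      (fun x => ENNReal.ofReal (γ x)) volume) volume)
      (ENNReal.ofReal (pairC p q r) * (lqNorm p (fun x => ENNReal.ofReal (φ x)) volume *
          lqNorm q (fun x => ENNReal.ofReal (γ x)) volume)) := by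
  cases b
  · have h1 := hp.one_lt_one_div hp1
    have h2 := hq.one_lt_one_div hq1
    have h3 := hr.one_lt_one_div hr1
    have p0 := hp.1
    have q0 := hq.1
    have r0 := hr.1
    have key := IsNice.young_reverse hφ hγ (p := p / r) (q := q / r) (r := 1 / r) (by positivity)
      (by rw [one_div_div, div_lt_one p0]; rw [one_div, one_div, one_div] at h
          rw [← inv_lt_inv₀ p0 r0]; rw [one_div] at h2; linarith)
      (by positivity)
      (by rw [one_div_div, div_lt_one q0]; rw [one_div, one_div, one_div] at h
          rw [← inv_lt_inv₀ q0 r0]; rw [one_div] at h1; linarith)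
      (by positivity) (by rw [one_div_one_div]; exact lt_of_le_of_ne hr.2 hr1)
      (by rw [one_div_div, one_div_div, one_div_one_div]
          have : r / p + r / q = r * (1 / p + 1 / q) := by ring
          rw [this, h]; field_simp; ring)
    have e1 : p / r / (1 / r) = p := by field_simp
    have e2 : q / r / (1 / r) = q := by field_simp
    rw [e1, e2, one_div_one_div] at key
    exact key
  · exact hφ.young hγ hp.1 (hp.one_div_lt hp1) hq.1 (hq.one_div_lt hq1) hr.1 (hr.one_div_lt hr1) h

/-- The common Gaussian majorant allows dominated convergence, which passes to the limit in the
inequality and in its reverse alike. -/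
theorem exists_isNice_tendsto {f : ℝ → ℝ≥0∞} (hf : Measurable f) {K : ℝ} (hK : 1 ≤ K)
    (hfK : ∀ x, f x ≤ ENNReal.ofReal K * gaussE 1 x) :
    ∃ φ : ℕ → ℝ → ℝ, (∀ n, IsNice (φ n)) ∧
      (∀ n x, ENNReal.ofReal (φ n x) ≤ ENNReal.ofReal K * gaussE 1 x) ∧
      ∀ᵐ x, Tendsto (fun n => ENNReal.ofReal (φ n x)) atTop (𝓝 (f x)) := by
  set e : ℝ → ℝ := fun x => Real.exp (-(Real.pi / 1) * ‖x‖ ^ 2) with he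
  have hK0 : 0 < K := by linarith
  have hKe : ∀ x, ENNReal.ofReal K * gaussE 1 x = ENNReal.ofReal (K * e x) := fun x =>
    (ENNReal.ofReal_mul hK0.le).symm
  have hft : ∀ x, f x ≠ ∞ := fun x => ne_top_of_le_ne_top (by rw [hKe]; exact ENNReal.ofReal_ne_top)
    (hfK x)
  have hfr : ∀ x, (f x).toReal ≤ K * e x := fun x => by
    have := ENNReal.toReal_mono (by rw [hKe]; exact ENNReal.ofReal_ne_top) (hfK x)
    rwa [hKe, ENNReal.toReal_ofReal (by positivity)] at this
  have hen : IsNice fun x => K * e x := isNice_gauss hK0 one_pos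
  have hfi : Integrable fun x => (f x).toReal := by
    refine hen.integrable.mono' hf.ennreal_toReal.aestronglyMeasurable (ae_of_all _ fun x => ?_)
    rw [Real.norm_of_nonneg ENNReal.toReal_nonneg]
    exact hfr x
  have hex : ∀ n : ℕ, ∃ g : ℝ → ℝ, (∫ x, ‖(f x).toReal - g x‖) ≤ 1 / ((n : ℝ) + 1) ∧
      Continuous g ∧ Integrable g := fun n => by
    obtain ⟨g, -, h⟩ := hfi.exists_hasCompactSupport_integral_sub_le
      (ε := 1 / ((n : ℝ) + 1)) (by positivity)
    exact ⟨g, h⟩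
  choose g hg hgc hgi using hex
  have hmeas : TendstoInMeasure volume g atTop fun x => (f x).toReal := by
    refine tendstoInMeasure_of_tendsto_eLpNorm one_ne_zero
      (fun n => (hgc n).aestronglyMeasurable) hfi.aestronglyMeasurable ?_
    have hb : ∀ n : ℕ, eLpNorm (g n - fun x => (f x).toReal) 1 volume ≤
        ENNReal.ofReal (1 / ((n : ℝ) + 1)) := fun n => by
      rw [eLpNorm_sub_comm, eLpNorm_one_eq_lintegral_enorm,
        ← ofReal_integral_norm_eq_lintegral_enorm (hfi.sub (hgi n))]
      exact ENNReal.ofReal_le_ofReal (hg n)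
    refine tendsto_of_tendsto_of_tendsto_of_le_of_le tendsto_const_nhds ?_ (fun n => zero_le) hb
    have := ENNReal.tendsto_ofReal (tendsto_one_div_add_atTop_nhds_zero_nat (𝕜 := ℝ))
    simpa using this
  obtain ⟨ns, -, hns⟩ := hmeas.exists_seq_tendsto_ae
  -- Continuous `L¹` approximants are clamped between `e / (n + 1)` and `K e`: the lower barrier
  -- gives positivity and tends to zero, the upper one gives decay. Since `K ≥ 1`, the barriers are
  -- in order.
  refine ⟨fun n x => max (min (g (ns n) x) (K * e x)) (1 / ((n : ℝ) + 1) * e x), fun n => ?_,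
    fun n x => ?_, ?_⟩
  · have hec : Continuous e := by fun_prop
    refine ⟨by have := hgc (ns n); fun_prop, fun x => lt_max_of_lt_right (by positivity), ?_⟩
    obtain ⟨L, a, ha, hL⟩ := hen.bound
    refine ⟨L, a, ha, fun x => le_trans (max_le (min_le_right _ _) ?_) (hL x)⟩
    gcongr
    refine le_trans ?_ hK
    rw [div_le_one (by positivity)]
    linarith [(n.cast_nonneg : (0 : ℝ) ≤ n)]
  · rw [hKe]
    refine ENNReal.ofReal_le_ofReal (max_le (min_le_right _ _) ?_)
    gcongr
    refine le_trans ?_ hK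
    rw [div_le_one (by positivity)]
    linarith [(n.cast_nonneg : (0 : ℝ) ≤ n)]
  · filter_upwards [hns] with x hx
    have h1 : Tendsto (fun n : ℕ => 1 / ((n : ℝ) + 1) * e x) atTop (𝓝 (0 * e x)) :=
      tendsto_one_div_add_atTop_nhds_zero_nat.mul_const _
    have h2 := ENNReal.tendsto_ofReal ((hx.min (tendsto_const_nhds (x := K * e x))).max h1)
    rw [zero_mul, min_eq_left (hfr x), max_eq_left ENNReal.toReal_nonneg,
      ENNReal.ofReal_toReal (hft x)] at h2
    exact h2

/-- Multiplication on `[0, ∞]` is discontinuous at `0 · ∞`; monotonicity lets a supremum replace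
continuity. -/
theorem tendsto_const_mul_of_monotone {u : ℕ → ℝ≥0∞} {x : ℝ≥0∞} (hm : Monotone u)
    (h : Tendsto u atTop (𝓝 x)) (a : ℝ≥0∞) : Tendsto (fun n => a * u n) atTop (𝓝 (a * x)) := by
  rw [← iSup_eq_of_tendsto hm h, ENNReal.mul_iSup]
  exact tendsto_atTop_iSup fun m n hmn => mul_le_mul_right (hm hmn) a

theorem leDir_of_tendsto {u v : ℕ → ℝ≥0∞} {x y : ℝ≥0∞} (hu : Tendsto u atTop (𝓝 x))
    (hv : Tendsto v atTop (𝓝 y)) (h : ∀ n, leDir b (u n) (v n)) : leDir b x y := by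
  cases b
  · exact le_of_tendsto_of_tendsto' hv hu h
  · exact le_of_tendsto_of_tendsto' hu hv h

theorem young_dir_of_le_gauss {f g : ℝ → ℝ≥0∞} (hf : Measurable f) (hg : Measurable g) {K L : ℝ}
    (hK : 1 ≤ K) (hL : 1 ≤ L) (hfK : ∀ x, f x ≤ ENNReal.ofReal K * gaussE 1 x)
    (hgL : ∀ x, g x ≤ ENNReal.ofReal L * gaussE 1 x) (hp : ExpDir b p)
    (hq : ExpDir b q) (hr : ExpDir b r) (hp1 : p ≠ 1) (hq1 : q ≠ 1) (hr1 : r ≠ 1)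
    (h : 1 / p + 1 / q = 1 + 1 / r) :
    leDir b (lqNorm r (lconvolution f g volume) volume)
      (ENNReal.ofReal (pairC p q r) * (lqNorm p f volume * lqNorm q g volume)) := by
  obtain ⟨φ, hφ, hφK, hφf⟩ := exists_isNice_tendsto hf hK hfK
  obtain ⟨γ, hγ, hγL, hγg⟩ := exists_isNice_tendsto hg hL hgL
  have mφ : ∀ n, Measurable fun x => ENNReal.ofReal (φ n x) := fun n =>
    (hφ n).cont.measurable.ennreal_ofReal
  have mγ : ∀ n, Measurable fun x => ENNReal.ofReal (γ n x) := fun n =>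
    (hγ n).cont.measurable.ennreal_ofReal
  have hgint : ∀ {c s : ℝ}, 0 < s → ∫⁻ x : ℝ, (ENNReal.ofReal c * gaussE 1 x) ^ s ≠ ∞ := by
    intro c s hs
    simp_rw [ENNReal.mul_rpow_of_nonneg _ _ hs.le, gaussE_rpow]
    rw [lintegral_const_mul _ (by fun_prop), lintegral_gaussE (by positivity)]
    exact ENNReal.mul_ne_top (ENNReal.rpow_ne_top_of_nonneg hs.le ENNReal.ofReal_ne_top)
      ENNReal.ofReal_ne_top
  have lim : ∀ {ψ : ℕ → ℝ → ℝ} {k : ℝ → ℝ≥0∞} {c s : ℝ}, 0 < s →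
      (∀ n, Measurable fun x => ENNReal.ofReal (ψ n x)) →
      (∀ n x, ENNReal.ofReal (ψ n x) ≤ ENNReal.ofReal c * gaussE 1 x) →
      (∀ᵐ x, Tendsto (fun n => ENNReal.ofReal (ψ n x)) atTop (𝓝 (k x))) →
      Tendsto (fun n => lqNorm s (fun x => ENNReal.ofReal (ψ n x)) volume) atTop
        (𝓝 (lqNorm s k volume)) := by
    intro ψ k c s hs hm hb ht
    refine (ENNReal.continuous_rpow_const.tendsto _).comp ?_
    refine tendsto_lintegral_of_dominated_convergence _ (fun n => (hm n).pow_const s)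
      (fun n => ae_of_all _ fun x => ENNReal.rpow_le_rpow (hb n x) hs.le) (hgint hs) ?_
    filter_upwards [ht] with x hx
    exact (ENNReal.continuous_rpow_const.tendsto _).comp hx
  have hprod : ∀ x : ℝ, ∫⁻ y, (ENNReal.ofReal K * gaussE 1 y) *
      (ENNReal.ofReal L * gaussE 1 (-y + x)) = ENNReal.ofReal K * ENNReal.ofReal L *
      (ENNReal.ofReal ((1 * 1 / (1 + 1)) ^ (Module.finrank ℝ ℝ / 2 : ℝ)) * gaussE (1 + 1) x) := by
    intro x
    rw [← lconvolution_gaussE one_pos one_pos, lconvolution_def,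
      ← lintegral_const_mul _ (by fun_prop)]
    refine lintegral_congr fun y => ?_
    ring
  have hconv : ∀ x, Tendsto (fun n => lconvolution (fun x => ENNReal.ofReal (φ n x))
      (fun x => ENNReal.ofReal (γ n x)) volume x) atTop (𝓝 (lconvolution f g volume x)) := by
    intro x
    refine tendsto_lintegral_of_dominated_convergence
      (fun y => (ENNReal.ofReal K * gaussE 1 y) * (ENNReal.ofReal L * gaussE 1 (-y + x)))
      (fun n => ?_) (fun n => ae_of_all _ fun y => mul_le_mul' (hφK n y) (hγL n _)) ?_ ?_
    · exact (mφ n).mul ((mγ n).comp (measurable_neg.add_const x))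
    · rw [hprod]
      exact ENNReal.mul_ne_top (ENNReal.mul_ne_top ENNReal.ofReal_ne_top ENNReal.ofReal_ne_top)
        (ENNReal.mul_ne_top ENNReal.ofReal_ne_top (gaussE_ne_top _ _))
    · have hq := (quasiMeasurePreserving_sub_left_of_right_invariant volume x).ae hγg
      filter_upwards [hφf, hq] with y h1 h2
      rw [neg_add_eq_sub]
      have fin : ∀ {k : ℝ → ℝ≥0∞} {c : ℝ}, (∀ x, k x ≤ ENNReal.ofReal c * gaussE 1 x) →
          ∀ x, k x ≠ ∞ := fun hk x => ne_top_of_le_ne_top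
            (ENNReal.mul_ne_top ENNReal.ofReal_ne_top (gaussE_ne_top _ _)) (hk x)
      exact ENNReal.Tendsto.mul h1 (Or.inr (fin hgL _)) h2 (Or.inr (fin hfK _))
  refine leDir_of_tendsto (u := fun n => lqNorm r (lconvolution (fun x => ENNReal.ofReal (φ n x))
      (fun x => ENNReal.ofReal (γ n x)) volume) volume)
    (v := fun n => ENNReal.ofReal (pairC p q r) *
      (lqNorm p (fun x => ENNReal.ofReal (φ n x)) volume *
        lqNorm q (fun x => ENNReal.ofReal (γ n x)) volume)) ?_ ?_
    fun n => (hφ n).young_dir (hγ n) hp hq hr hp1 hq1 hr1 h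
  · refine (ENNReal.continuous_rpow_const.tendsto _).comp ?_
    refine tendsto_lintegral_of_dominated_convergence (fun x => (∫⁻ y, (ENNReal.ofReal K *
      gaussE 1 y) * (ENNReal.ofReal L * gaussE 1 (-y + x))) ^ r)
      (fun n => (measurable_lconvolution _ (mφ n) (mγ n)).pow_const r)
      (fun n => ae_of_all _ fun x => ENNReal.rpow_le_rpow
        (lintegral_mono fun y => mul_le_mul' (hφK n y) (hγL n _)) hr.1.le) ?_
      (ae_of_all _ fun x => (ENNReal.continuous_rpow_const.tendsto _).comp (hconv x))
    simp_rw [hprod, ENNReal.mul_rpow_of_nonneg _ _ hr.1.le, gaussE_rpow]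
    rw [lintegral_const_mul _ (by fun_prop), lintegral_const_mul _ (by fun_prop),
      lintegral_gaussE (by have := hr.1; positivity)]
    have : ∀ c : ℝ, ENNReal.ofReal c ^ r ≠ ∞ := fun c =>
      ENNReal.rpow_ne_top_of_nonneg hr.1.le ENNReal.ofReal_ne_top
    exact ENNReal.mul_ne_top (ENNReal.mul_ne_top (this _) (this _))
      (ENNReal.mul_ne_top (this _) ENNReal.ofReal_ne_top)
  · have fin : ∀ {k : ℝ → ℝ≥0∞} {c s : ℝ}, 0 < s → (∀ x, k x ≤ ENNReal.ofReal c * gaussE 1 x) →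
        lqNorm s k volume ≠ ∞ := fun hs hk => ENNReal.rpow_ne_top_of_nonneg (by positivity)
          (ne_top_of_le_ne_top (hgint hs) (lintegral_mono fun x => ENNReal.rpow_le_rpow (hk x) hs.le))
    refine ENNReal.Tendsto.const_mul ?_ (Or.inr ENNReal.ofReal_ne_top)
    exact ENNReal.Tendsto.mul (lim hp.1 mφ hφK hφf) (Or.inr (fin hq.1 hgL))
      (lim hq.1 mγ hγL hγg) (Or.inr (fin hp.1 hfK))

theorem truncOn_le_gauss (f : ℝ → ℝ≥0∞) (n : ℕ) (x : ℝ) :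
    truncOn (fun n : ℕ => Icc (-(n : ℝ)) n) f n x ≤
      ENNReal.ofReal (1 + n * Real.exp (Real.pi * n ^ 2)) * gaussE 1 x := by
  unfold truncOn
  by_cases hx : x ∈ Icc (-(n : ℝ)) n
  · rw [indicator_of_mem hx, gaussE, ← ENNReal.ofReal_mul (by positivity)]
    refine (min_le_right _ _).trans ?_
    rw [← ENNReal.ofReal_natCast]
    refine ENNReal.ofReal_le_ofReal ?_
    have hx2 : ‖x‖ ^ 2 ≤ (n : ℝ) ^ 2 := by
      rw [Real.norm_eq_abs]
      exact pow_le_pow_left₀ (abs_nonneg _) (abs_le.2 hx) 2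
    calc (n : ℝ) = n * Real.exp (Real.pi * n ^ 2) * Real.exp (-(Real.pi / 1) * n ^ 2) := by
          rw [mul_assoc, ← Real.exp_add]; simp
      _ ≤ (1 + n * Real.exp (Real.pi * n ^ 2)) * Real.exp (-(Real.pi / 1) * ‖x‖ ^ 2) := by
          refine mul_le_mul (by linarith) (Real.exp_le_exp.2 ?_) (by positivity) (by positivity)
          have := mul_le_mul_of_nonneg_left hx2 Real.pi_pos.le
          simp only [div_one]; linarith
  · rw [indicator_of_notMem hx]; exact zero_le

/-- The sharp Young inequality and its reverse on the line. -/
theorem youngIneq_real (hp : ExpDir b p) (hq : ExpDir b q) (hr : ExpDir b r) (hp1 : p ≠ 1)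
    (hq1 : q ≠ 1) (hr1 : r ≠ 1) (h : 1 / p + 1 / q = 1 + 1 / r) :
    YoungIneq b (volume : Measure ℝ) p q r (ENNReal.ofReal (pairC p q r)) := by
  intro f g hf hg
  set S : ℕ → Set ℝ := fun n => Icc (-(n : ℝ)) n with hS
  have hmono : Monotone S := fun m n hmn => Icc_subset_Icc (by simpa using hmn) (by simpa using hmn)
  have hU : ⋃ n, S n = univ := by
    ext x
    simp only [mem_iUnion, mem_univ, iff_true]
    obtain ⟨n, hn⟩ := exists_nat_ge |x|
    exact ⟨n, abs_le.1 hn⟩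
  have hm : ∀ n, MeasurableSet (S n) := fun n => measurableSet_Icc
  have hb : ∀ n : ℕ, (1 : ℝ) ≤ 1 + n * Real.exp (Real.pi * n ^ 2) := fun n => by
    have : (0 : ℝ) ≤ n * Real.exp (Real.pi * n ^ 2) := by positivity
    linarith
  -- The two truncation levels are independent. Removing them one at a time requires only monotone
  -- limits multiplied by a constant.
  have key : ∀ m n, leDir b (lqNorm r (lconvolution (truncOn S f m) (truncOn S g n) volume) volume)
      (ENNReal.ofReal (pairC p q r) *
        (lqNorm p (truncOn S f m) volume * lqNorm q (truncOn S g n) volume)) := fun m n =>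
    young_dir_of_le_gauss (measurable_truncOn hm hf m) (measurable_truncOn hm hg n) (hb m) (hb n)
      (truncOn_le_gauss f m) (truncOn_le_gauss g n) hp hq hr hp1 hq1 hr1 h
  have limR : ∀ {k : ℕ → ℝ → ℝ≥0∞} {l : ℝ → ℝ≥0∞}, (∀ n, Measurable (k n)) → Monotone k →
      (∀ x, Tendsto (fun n => k n x) atTop (𝓝 (l x))) →
      Tendsto (fun n => lqNorm r (k n) volume) atTop (𝓝 (lqNorm r l volume)) := by
    intro k l hk hmon hl
    refine (ENNReal.continuous_rpow_const.tendsto _).comp ?_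
    exact lintegral_tendsto_of_tendsto_of_monotone (fun n => ((hk n).pow_const r).aemeasurable)
      (ae_of_all _ fun x m n hmn => ENNReal.rpow_le_rpow (hmon hmn x) hr.1.le)
      (ae_of_all _ fun x => (ENNReal.continuous_rpow_const.tendsto _).comp (hl x))
  have limN : ∀ {k : ℝ → ℝ≥0∞} {s : ℝ}, Measurable k → 0 < s → ∀ a : ℝ≥0∞,
      Tendsto (fun n => a * lqNorm s (truncOn S k n) volume) atTop
        (𝓝 (a * lqNorm s k volume)) := by
    intro k s hk hs a
    exact tendsto_const_mul_of_monotone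
      (fun m n hmn => lqNorm_mono hs (truncOn_mono hmono k hmn))
      (tendsto_lqNorm_truncOn hs hmono hU hm hk) a
  have limC : ∀ {k l : ℝ → ℝ≥0∞}, Measurable k → Measurable l →
      Tendsto (fun n => lqNorm r (lconvolution k (truncOn S l n) volume) volume) atTop
        (𝓝 (lqNorm r (lconvolution k l volume) volume)) := by
    intro k l hk hl
    refine limR (fun n => measurable_lconvolution _ hk (measurable_truncOn hm hl n))
      (fun m n hmn x => lintegral_mono fun y => mul_le_mul_right (truncOn_mono hmono l hmn _) _)
      fun x => ?_
    exact lintegral_tendsto_of_tendsto_of_monotone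
      (fun n => (hk.mul ((measurable_truncOn hm hl n).comp
        (measurable_neg.add_const x))).aemeasurable)
      (ae_of_all _ fun y m n hmn => mul_le_mul_right (truncOn_mono hmono l hmn _) _)
      (ae_of_all _ fun y => tendsto_const_mul_of_monotone
        (fun m n hmn => truncOn_mono hmono l hmn _) (tendsto_truncOn hmono hU l _) _)
  have key2 : ∀ m, leDir b (lqNorm r (lconvolution g (truncOn S f m) volume) volume)
      (ENNReal.ofReal (pairC p q r) * lqNorm q g volume * lqNorm p (truncOn S f m) volume) := by
    intro m
    rw [mul_assoc, mul_comm (lqNorm q g volume), ← mul_assoc, lconvolution_comm]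
    refine leDir_of_tendsto (limC (measurable_truncOn hm hf m) hg) (limN hg hq.1 _) fun n => ?_
    rw [mul_assoc]
    exact key m n
  rw [lconvolution_comm, mul_comm (lqNorm p f volume), ← mul_assoc]
  exact leDir_of_tendsto (limC hg hf) (limN hf hp.1 _) key2

end Line

/-! ### Sharp Young inequalities on Euclidean space. -/

section Euclidean

variable {b : Bool} {p q r : ℝ}

theorem youngIneq_pi (hp : 0 < p) (hq : 0 < q) (hr : ExpDir b r) {C : ℝ≥0∞}
    (h : YoungIneq b (volume : Measure ℝ) p q r C) (d : ℕ) :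
    YoungIneq b (volume : Measure (Fin d → ℝ)) p q r (C ^ d) := by
  induction d with
  | zero =>
    intro f g _ _
    have hr0 := hr.1
    refine leDir_of_eq ?_
    have hn : ∀ (s : ℝ), 0 < s → ∀ k : (Fin 0 → ℝ) → ℝ≥0∞, lqNorm s k volume = k 0 := by
      intro s hs k
      rw [lqNorm, volume_pi, Measure.pi_of_empty _ 0, lintegral_dirac, ← ENNReal.rpow_mul,
        mul_one_div_cancel hs.ne', ENNReal.rpow_one]
    rw [hn _ hr0, hn _ hp, hn _ hq, lconvolution_def, volume_pi, Measure.pi_of_empty _ 0,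
      lintegral_dirac]
    simp
  | succ d ih =>
    have he := (volume_preserving_piFinSuccAbove (fun _ : Fin (d + 1) => ℝ) 0).symm
    rw [pow_succ']
    refine YoungIneq.of_measurePreserving (YoungIneq.prod hp hq hr h ih) _ he ?_ ?_
    · rintro ⟨x, y⟩
      ext i
      refine Fin.cases ?_ (fun j => ?_) i <;> simp [MeasurableEquiv.piFinSuccAbove]
    · rintro ⟨x, y⟩ ⟨x', y'⟩
      ext i
      refine Fin.cases ?_ (fun j => ?_) i <;> simp [MeasurableEquiv.piFinSuccAbove]

theorem one_div_eq_of_eq_one_left (h : 1 / (1 : ℝ) + 1 / q = 1 + 1 / r) :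
    q = r := by
  have : 1 / q = 1 / r := by linarith
  rw [one_div, one_div] at this
  exact inv_injective this

theorem ne_one_of_ne_one (hp : ExpDir b p) (hq : ExpDir b q) (hp1 : p ≠ 1) (hq1 : q ≠ 1)
    (h : 1 / p + 1 / q = 1 + 1 / r) : r ≠ 1 := by
  rintro rfl
  cases b
  · have := hp.one_lt_one_div hp1
    have := hq.one_lt_one_div hq1
    norm_num at h; norm_num at *; linarith
  · have := hp.one_div_lt hp1
    have := hq.one_div_lt hq1
    norm_num at h; norm_num at *; linarith

/-- The sharp Young inequality and its reverse for two functions on Euclidean space. -/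
theorem youngIneq_euclidean (hp : ExpDir b p) (hq : ExpDir b q) (hr : ExpDir b r)
    (h : 1 / p + 1 / q = 1 + 1 / r) (d : ℕ) :
    YoungIneq b (volume : Measure (EuclideanSpace ℝ (Fin d))) p q r
      (ENNReal.ofReal (pairC p q r ^ d)) := by
  have one : ∀ {s : ℝ}, 0 < s → pairC 1 s s = 1 ∧ pairC s 1 s = 1 := fun {s} hs => by
    have := (youngC_pos hs).ne'
    have e : youngC 1 = 1 := by simp [youngC]
    constructor <;> simp [pairC, e, this]
  -- An exponent equal to one makes a width `1 - 1/p` or `1 - 1/q` vanish, so the Gaussian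
  -- comparison degenerates. The constant is then one and Minkowski's inequality suffices.
  by_cases hp1 : p = 1
  · subst hp1
    obtain rfl := one_div_eq_of_eq_one_left h
    rw [(one hq.1).1, one_pow, ENNReal.ofReal_one]
    exact youngIneq_one_left hq
  by_cases hq1 : q = 1
  · subst hq1
    obtain rfl := one_div_eq_of_eq_one_left ((add_comm _ _).trans h)
    rw [(one hp.1).2, one_pow, ENNReal.ofReal_one]
    exact (youngIneq_one_left hp).symm
  have hr1 := ne_one_of_ne_one hp hq hp1 hq1 h
  rw [ENNReal.ofReal_pow (pairC_pos hp.1 hq.1 hr.1).le]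
  refine YoungIneq.of_measurePreserving (youngIneq_pi hp.1 hq.1 hr
    (youngIneq_real hp hq hr hp1 hq1 hr1 h) d) _ (PiLp.volume_preserving_toLp (Fin d)) ?_ ?_
  · intro x; rfl
  · intro x y; rfl

end Euclidean

/-! ### The heat kernel. -/

section Heat

variable {d : ℕ}

/-- The heat kernel `s ^ (-d / 2) exp (-π ‖x‖² / s)` on `ℝᵈ`, with values in `[0, ∞]`. -/
noncomputable def heatE (s : ℝ) (x : EuclideanSpace ℝ (Fin d)) : ℝ≥0∞ :=
  ENNReal.ofReal (s ^ (-(d / 2) : ℝ)) * gaussE s x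

@[fun_prop]
theorem measurable_heatE (s : ℝ) : Measurable (heatE (d := d) s) := by
  unfold heatE; fun_prop

theorem lintegral_heatE {s : ℝ} (hs : 0 < s) :
    ∫⁻ x : EuclideanSpace ℝ (Fin d), heatE s x = 1 := by
  unfold heatE
  rw [lintegral_const_mul _ (by fun_prop), lintegral_gaussE hs, ← ENNReal.ofReal_mul (by positivity),
    ← Real.rpow_add hs, finrank_euclideanSpace_fin]
  simp

theorem heatE_rpow {s p : ℝ} (hs : 0 < s) (hp : 0 < p) (x : EuclideanSpace ℝ (Fin d)) :
    heatE s x ^ (1 / p) = ENNReal.ofReal (s ^ (-(d / 2) * (1 / p) : ℝ)) * gaussE (s * p) x := by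
  rw [heatE, ENNReal.mul_rpow_of_nonneg _ _ (by positivity), gaussE_rpow,
    ENNReal.ofReal_rpow_of_pos (by positivity), ← Real.rpow_mul hs.le, div_div_eq_mul_div, div_one]

theorem lconvolution_const_mul {a c : ℝ≥0∞} {f g : EuclideanSpace ℝ (Fin d) → ℝ≥0∞}
    (hf : Measurable f) (hg : Measurable g) (x : EuclideanSpace ℝ (Fin d)) :
    lconvolution (fun y => a * f y) (fun y => c * g y) volume x =
      a * c * lconvolution f g volume x := by
  rw [lconvolution_def, lconvolution_def, ← lintegral_const_mul _ (by fun_prop)]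
  exact lintegral_congr fun y => by ring

theorem lintegral_lconvolution {f g : EuclideanSpace ℝ (Fin d) → ℝ≥0∞} (hf : Measurable f)
    (hg : Measurable g) :
    ∫⁻ x, lconvolution f g volume x = (∫⁻ x, f x) * ∫⁻ x, g x := by
  simp_rw [lconvolution_def]
  rw [lintegral_lintegral_swap (Measurable.aemeasurable (by fun_prop)), ← lintegral_mul_const _ hf]
  refine lintegral_congr fun y => ?_
  rw [lintegral_const_mul _ (by fun_prop), lintegral_add_left_eq_self g]

end Heat

/-! ### Closure of heat flows under convolution. -/

section Flow

variable {d : ℕ} {b : Bool} {p q r lam : ℝ}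

/-- The time needed for exponent `p`. -/
noncomputable def flowTime (lam p : ℝ) : ℝ := lam * (|1 - 1 / p| / p)

theorem abs_one_sub_pos (hp : 0 < p) (hp1 : p ≠ 1) : 0 < |1 - 1 / p| := by
  rw [abs_pos, sub_ne_zero]; intro h; field_simp at h; exact hp1 h

theorem flowTime_pos (hlam : 0 < lam) (hp : 0 < p) (hp1 : p ≠ 1) : 0 < flowTime lam p :=
  mul_pos hlam (div_pos (abs_one_sub_pos hp hp1) hp)

/-- The heat flow acting on the `p`-th power of a function. -/
noncomputable def flowT (lam p : ℝ) (f : EuclideanSpace ℝ (Fin d) → ℝ≥0∞) :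
    EuclideanSpace ℝ (Fin d) → ℝ≥0∞ :=
  if p = 1 then f
  else fun z => (lconvolution (fun x => f x ^ p) (heatE (flowTime lam p)) volume z) ^ (1 / p)

theorem flowT_one (f : EuclideanSpace ℝ (Fin d) → ℝ≥0∞) : flowT lam 1 f = f := if_pos rfl

theorem measurable_flowT {f : EuclideanSpace ℝ (Fin d) → ℝ≥0∞} (hf : Measurable f) :
    Measurable (flowT lam p f) := by
  unfold flowT
  split_ifs
  · exact hf
  · exact (measurable_lconvolution _ (hf.pow_const p) (by fun_prop)).pow_const _

/-- The flow at a single point is an `L^p` norm; this lets norm inequalities yield pointwise ones.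
-/
theorem flowT_eq_lqNorm (hp : 0 < p) (hp1 : p ≠ 1) (f : EuclideanSpace ℝ (Fin d) → ℝ≥0∞)
    (z : EuclideanSpace ℝ (Fin d)) :
    flowT lam p f z =
      lqNorm p (fun x => f x * heatE (flowTime lam p) (-x + z) ^ (1 / p)) volume := by
  rw [flowT, if_neg hp1, lqNorm, lconvolution_def]
  congr 1
  refine lintegral_congr fun x => ?_
  rw [ENNReal.mul_rpow_of_nonneg _ _ hp.le, ← ENNReal.rpow_mul, one_div_mul_cancel hp.ne',
    ENNReal.rpow_one]

theorem lqNorm_flowT (hlam : 0 < lam) (hp : 0 < p) {f : EuclideanSpace ℝ (Fin d) → ℝ≥0∞}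
    (hf : Measurable f) : lqNorm p (flowT lam p f) volume = lqNorm p f volume := by
  by_cases hp1 : p = 1
  · rw [hp1, flowT_one]
  rw [flowT, if_neg hp1, lqNorm, lqNorm]
  simp_rw [← ENNReal.rpow_mul, one_div_mul_cancel hp.ne', ENNReal.rpow_one]
  rw [lintegral_lconvolution (by fun_prop) (by fun_prop),
    lintegral_heatE (flowTime_pos hlam hp hp1), mul_one]

/-- All three numbers `1 - 1/p`, `1 - 1/q`, `1 - 1/r` have the same weak sign, so absolute values
respect the scaling relation. It makes the Gaussian widths add up. -/
theorem ExpDir.abs_add (hp : ExpDir b p) (hq : ExpDir b q) (hr : ExpDir b r)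
    (h : 1 / p + 1 / q = 1 + 1 / r) : |1 - 1 / p| + |1 - 1 / q| = |1 - 1 / r| := by
  cases b
  · have le : ∀ {s : ℝ}, ExpDir false s → 1 - 1 / s ≤ 0 := fun hs => by
      have := (one_le_div hs.1).2 hs.2
      linarith
    rw [abs_of_nonpos (le hp), abs_of_nonpos (le hq), abs_of_nonpos (le hr)]; linarith
  · have le : ∀ {s : ℝ}, ExpDir true s → 0 ≤ 1 - 1 / s := fun hs => by
      have := (div_le_one hs.1).2 hs.2
      linarith
    rw [abs_of_nonneg (le hp), abs_of_nonneg (le hq), abs_of_nonneg (le hr)]; linarith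

/-- The `1/p`-th power of the kernel is a Gaussian of width `lam * |1 - 1/p|`. These widths add, and
they are extremal for Young's inequality, so exactly the sharp constant appears. -/
theorem lconvolution_heatE_rpow (hlam : 0 < lam) (hp : ExpDir b p) (hq : ExpDir b q)
    (hr : ExpDir b r) (hp1 : p ≠ 1) (hq1 : q ≠ 1) (h : 1 / p + 1 / q = 1 + 1 / r)
    (x : EuclideanSpace ℝ (Fin d)) :
    lconvolution (fun x => heatE (flowTime lam p) x ^ (1 / p))
      (fun x => heatE (flowTime lam q) x ^ (1 / q)) volume x =
      ENNReal.ofReal (pairC p q r ^ d) * heatE (flowTime lam r) x ^ (1 / r) := by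
  have hr1 := ne_one_of_ne_one hp hq hp1 hq1 h
  have p0 := hp.1
  have q0 := hq.1
  have r0 := hr.1
  have hP := abs_one_sub_pos p0 hp1
  have hQ := abs_one_sub_pos q0 hq1
  have hR := abs_one_sub_pos r0 hr1
  have e : ∀ {s : ℝ}, 0 < s → flowTime lam s * s = lam * |1 - 1 / s| := fun hs => by
    rw [flowTime]; field_simp
  have hs : lam * |1 - 1 / p| + lam * |1 - 1 / q| = lam * |1 - 1 / r| := by
    rw [← mul_add, hp.abs_add hq hr h]
  simp_rw [heatE_rpow (flowTime_pos hlam p0 hp1) p0, heatE_rpow (flowTime_pos hlam q0 hq1) q0,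
    heatE_rpow (flowTime_pos hlam r0 hr1) r0, e p0, e q0, e r0]
  have t1 := flowTime_pos hlam p0 hp1
  have t2 := flowTime_pos hlam q0 hq1
  have t3 := flowTime_pos hlam r0 hr1
  have hC := pairC_pos p0 q0 r0
  rw [lconvolution_const_mul (by fun_prop) (by fun_prop), lconvolution_gaussE (by positivity)
    (by positivity), hs, ← mul_assoc, ← mul_assoc (ENNReal.ofReal (pairC p q r ^ d)),
    finrank_euclideanSpace_fin,
    ← ENNReal.ofReal_mul (by positivity), ← ENNReal.ofReal_mul (by positivity),
    ← ENNReal.ofReal_mul (by positivity)]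
  congr 2
  rw [pairC_eq p0 q0 r0, youngSq, youngSq, youngSq]
  unfold flowTime
  refine Real.log_injOn_pos (by simp only [mem_Ioi]; positivity)
    (by simp only [mem_Ioi]; positivity) ?_
  simp (disch := positivity) only [log_mul_of_pos, log_div_of_pos, Real.log_rpow, Real.log_pow]
  have hq' : 1 / q = 1 + 1 / r - 1 / p := by linarith
  rw [hq']
  ring

theorem leDir_of_mul_left {c x y : ℝ≥0∞} (hc : c ≠ 0) (hc' : c ≠ ∞)
    (h : leDir b (c * x) (c * y)) : leDir b x y := by
  cases b
  · exact (ENNReal.mul_le_mul_iff_right hc hc').1 h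
  · exact (ENNReal.mul_le_mul_iff_right hc hc').1 h

/-- The factor with exponent one does not evolve. The other evolves under a translation-invariant
flow, and Minkowski's inequality compares the flow of a superposition of translates with the
superposition of the flows. -/
theorem flowT_lconvolution_one_left (hq : ExpDir b q) (hq1 : q ≠ 1)
    {f g : EuclideanSpace ℝ (Fin d) → ℝ≥0∞} (hf : Measurable f) (hg : Measurable g)
    (z : EuclideanSpace ℝ (Fin d)) :
    leDir b (flowT lam q (lconvolution f g volume) z)
      (lconvolution f (flowT lam q g) volume z) := by
  rw [flowT_eq_lqNorm hq.1 hq1]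
  set k : EuclideanSpace ℝ (Fin d) → ℝ≥0∞ := fun x => heatE (flowTime lam q) x ^ (1 / q) with hk
  have hkm : Measurable k := by fun_prop
  have e : (fun x => lconvolution f g volume x * k (-x + z)) =
      fun x => ∫⁻ y, f y * g (-y + x) * k (-x + z) := by
    ext x
    rw [lconvolution_def, lintegral_mul_const _ (by fun_prop)]
  change leDir b (lqNorm q (fun x => lconvolution f g volume x * k (-x + z)) volume) _
  rw [e]
  refine (leDir_lqNorm_lintegral hq
    (K := fun x y => f y * g (-y + x) * k (-x + z)) (by unfold Function.uncurry; fun_prop)).trans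
    (leDir_of_eq ?_)
  rw [lconvolution_def]
  refine lintegral_congr fun y => ?_
  rw [flowT_eq_lqNorm hq.1 hq1, ← lqNorm_const_mul hq.1 (by fun_prop)]
  unfold lqNorm
  congr 1
  rw [← lintegral_add_left_eq_self _ y]
  refine lintegral_congr fun x => ?_
  have : -(y + x) + z = -x + (-y + z) := by abel
  simp only [hk, this, neg_add_cancel_left, mul_assoc]

/-- The pointwise closure property of heat flows under convolution of powers. -/
theorem flowT_lconvolution (hlam : 0 < lam) (hp : ExpDir b p) (hq : ExpDir b q)
    (hr : ExpDir b r) (h : 1 / p + 1 / q = 1 + 1 / r)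
    {f g : EuclideanSpace ℝ (Fin d) → ℝ≥0∞} (hf : Measurable f) (hg : Measurable g)
    (z : EuclideanSpace ℝ (Fin d)) :
    leDir b (flowT lam r (lconvolution f g volume) z)
      (lconvolution (flowT lam p f) (flowT lam q g) volume z) := by
  by_cases hp1 : p = 1
  · subst hp1
    obtain rfl := one_div_eq_of_eq_one_left h
    rw [flowT_one]
    by_cases hq1 : q = 1
    · subst hq1
      rw [flowT_one, flowT_one]
      exact leDir_of_eq rfl
    · exact flowT_lconvolution_one_left hq hq1 hf hg z
  by_cases hq1 : q = 1
  · subst hq1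
    obtain rfl := one_div_eq_of_eq_one_left ((add_comm _ _).trans h)
    rw [flowT_one, lconvolution_comm, lconvolution_comm (f := flowT lam p f)]
    exact flowT_lconvolution_one_left hp hp1 hg hf z
  have hr1 := ne_one_of_ne_one hp hq hp1 hq1 h
  have hC := pow_pos (pairC_pos hp.1 hq.1 hr.1) d
  -- The factor is inserted in order to be absorbed into the kernel as `C R = P * Q`; Young's
  -- inequality returns it on the other side.
  refine leDir_of_mul_left (c := ENNReal.ofReal (pairC p q r ^ d)) (by simpa using hC)
    ENNReal.ofReal_ne_top ?_
  have hcm : Measurable (lconvolution f g volume) := measurable_lconvolution _ hf hg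
  set P : EuclideanSpace ℝ (Fin d) → ℝ≥0∞ := fun x => heatE (flowTime lam p) x ^ (1 / p) with hP
  set Q : EuclideanSpace ℝ (Fin d) → ℝ≥0∞ := fun x => heatE (flowTime lam q) x ^ (1 / q) with hQ
  have hPm : Measurable P := by fun_prop
  have hQm : Measurable Q := by fun_prop
  rw [flowT_eq_lqNorm hr.1 hr1, ← lqNorm_const_mul hr.1 (by fun_prop)]
  -- The convolution variable of `P * Q` is shifted by `y`, so that `P` is attached to `f` and `Q`
  -- to `g`, with an outer parameter `u` independent of `x` and `y`.
  have e : (fun x => ENNReal.ofReal (pairC p q r ^ d) *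
      (lconvolution f g volume x * heatE (flowTime lam r) (-x + z) ^ (1 / r))) =
      fun x => ∫⁻ u, lconvolution (fun y => f y * P (-y + u))
        (fun y => g y * Q (-y + (-u + z))) volume x := by
    ext x
    rw [mul_left_comm, ← lconvolution_heatE_rpow hlam hp hq hr hp1 hq1 h, ← hP, ← hQ]
    simp_rw [lconvolution_def]
    rw [lintegral_lintegral_swap (Measurable.aemeasurable (by fun_prop)),
      ← lintegral_mul_const _ (by fun_prop)]
    refine lintegral_congr fun y => ?_
    rw [← lintegral_add_left_eq_self _ (-y), ← lintegral_const_mul _ (by fun_prop)]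
    refine lintegral_congr fun u => ?_
    have : -(-y + u) + (-x + z) = -(-y + x) + (-u + z) := by abel
    rw [this]; ring
  rw [e]
  refine (leDir_lqNorm_lintegral hr ?_).trans ?_
  · unfold Function.uncurry lconvolution
    refine Measurable.lintegral_prod_right' (f := fun w : (EuclideanSpace ℝ (Fin d) ×
      EuclideanSpace ℝ (Fin d)) × EuclideanSpace ℝ (Fin d) => f w.2 * P (-w.2 + w.1.2) *
      (g (-w.2 + w.1.1) * Q (-(-w.2 + w.1.1) + (-w.1.2 + z)))) ?_
    fun_prop
  rw [lconvolution_def, ← lintegral_const_mul _ (by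
    exact (measurable_flowT hf).mul ((measurable_flowT hg).comp (measurable_neg.add_const z)))]
  refine leDir.lintegral fun u => ?_
  rw [flowT_eq_lqNorm hp.1 hp1, flowT_eq_lqNorm hq.1 hq1]
  exact youngIneq_euclidean hp hq hr h d _ _ (by fun_prop) (by fun_prop)

end Flow

/-! ### Several functions, and Gaussian quotients. -/

section Iterated

variable {d : ℕ} {b : Bool}

theorem measurable_iteratedConv (n : ℕ) {f : Fin (n + 1) → EuclideanSpace ℝ (Fin d) → ℝ≥0∞}
    (hf : ∀ j, Measurable (f j)) : Measurable (iteratedConv n f) := by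
  induction n with
  | zero => exact hf 0
  | succ n ih => exact measurable_lconvolution _ (hf 0) (ih fun j => hf j.succ)

theorem lconvolution_congr_ae {f g f' g' : EuclideanSpace ℝ (Fin d) → ℝ≥0∞} (hf : f =ᵐ[volume] f')
    (hg : g =ᵐ[volume] g') : lconvolution f g volume = lconvolution f' g' volume := by
  ext x
  rw [lconvolution_def, lconvolution_def]
  have h := (quasiMeasurePreserving_sub_left_of_right_invariant volume x).ae hg
  refine lintegral_congr_ae ?_
  filter_upwards [hf, h] with y h1 h2
  rw [h1, neg_add_eq_sub, h2]

theorem iteratedConv_congr_ae (n : ℕ) {f g : Fin (n + 1) → EuclideanSpace ℝ (Fin d) → ℝ≥0∞}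
    (h : ∀ j, f j =ᵐ[volume] g j) : iteratedConv n f =ᵐ[volume] iteratedConv n g := by
  induction n with
  | zero => exact h 0
  | succ n ih =>
    simp only [iteratedConv]
    rw [lconvolution_congr_ae (h 0) (ih fun j => h j.succ)]

/-- Supplies the exponent of the convolution of all functions but the first, for inductions.
Positivity comes from `1/p_j ≥ 1` for the remaining exponents in the reverse case, and from `1/r ≥
1/q` in the other. -/
theorem exists_rest_exponent (n : ℕ) {p : Fin (n + 2) → ℝ} {q : ℝ} (hp : ∀ j, ExpDir b (p j))
    (hq : 0 < q) (h : ∑ j, 1 / p j = (n + 1 : ℕ) + 1 / q) :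
    ∃ r, 0 < r ∧ ∑ j : Fin (n + 1), 1 / p j.succ = n + 1 / r ∧ 1 / p 0 + 1 / r = 1 + 1 / q := by
  rw [Fin.sum_univ_succ] at h
  push_cast at h
  have pos : 0 < ∑ j : Fin (n + 1), 1 / p j.succ - n := by
    cases b
    · have : ∑ _j : Fin (n + 1), (1 : ℝ) ≤ ∑ j : Fin (n + 1), 1 / p j.succ :=
        Finset.sum_le_sum fun j _ => (one_le_div (hp _).1).2 (hp _).2
      simp at this
      simp only [one_div]
      linarith
    · have h0 := (div_le_one (hp 0).1).2 (hp 0).2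
      have : 0 < 1 / q := by positivity
      linarith
  refine ⟨1 / (∑ j : Fin (n + 1), 1 / p j.succ - n), by positivity, ?_, ?_⟩
  · rw [one_div_one_div]; ring
  · rw [one_div_one_div]; linarith

theorem expDir_of_sum (n : ℕ) {p : Fin (n + 1) → ℝ} {q : ℝ} (hp : ∀ j, ExpDir b (p j))
    (hq : 0 < q) (h : ∑ j, 1 / p j = n + 1 / q) : ExpDir b q := by
  refine ⟨hq, ?_⟩
  cases b
  · have : ∑ _j : Fin (n + 1), (1 : ℝ) ≤ ∑ j : Fin (n + 1), 1 / p j :=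
      Finset.sum_le_sum fun j _ => (one_le_div (hp _).1).2 (hp _).2
    rw [h] at this
    simp only [Finset.sum_const, Finset.card_univ, Fintype.card_fin, nsmul_eq_mul, mul_one,
      Nat.cast_add, Nat.cast_one] at this
    exact (one_le_div hq).1 (by linarith)
  · have : ∑ j : Fin (n + 1), 1 / p j ≤ ∑ _j : Fin (n + 1), (1 : ℝ) :=
      Finset.sum_le_sum fun j _ => (div_le_one (hp _).1).2 (hp _).2
    rw [h] at this
    simp only [Finset.sum_const, Finset.card_univ, Fintype.card_fin, nsmul_eq_mul, mul_one,
      Nat.cast_add, Nat.cast_one] at this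
    exact (div_le_one hq).1 (by linarith)

theorem eq_of_sum_zero {p : Fin (0 + 1) → ℝ} {q : ℝ} (h : ∑ j, 1 / p j = (0 : ℕ) + 1 / q) :
    p 0 = q := by
  simpa using h

theorem flowT_iteratedConv {lam : ℝ} (hlam : 0 < lam) (n : ℕ) {p : Fin (n + 1) → ℝ} {q : ℝ}
    (hp : ∀ j, ExpDir b (p j)) (hq : 0 < q) (h : ∑ j, 1 / p j = n + 1 / q)
    {f : Fin (n + 1) → EuclideanSpace ℝ (Fin d) → ℝ≥0∞} (hf : ∀ j, Measurable (f j))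
    (z : EuclideanSpace ℝ (Fin d)) :
    leDir b (flowT lam q (iteratedConv n f) z)
      (iteratedConv n (fun j => flowT lam (p j) (f j)) z) := by
  induction n generalizing q z with
  | zero =>
    rw [← eq_of_sum_zero h]
    exact leDir_of_eq rfl
  | succ n ih =>
    obtain ⟨r, hr, h1, h2⟩ := exists_rest_exponent n hp hq h
    refine (flowT_lconvolution hlam (hp 0) (expDir_of_sum n (fun j => hp j.succ) hr h1)
      (expDir_of_sum _ hp hq h) h2 (hf 0) (measurable_iteratedConv n fun j => hf j.succ) z).trans ?_
    exact leDir.lintegral fun y => (ih (fun j => hp j.succ) hr h1 (fun j => hf j.succ) _).mul_left _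

/-- The pointwise comparison is integrated; the left side loses its flow because the flow with
exponent `q` preserves the `L^q` quasi-norm. -/
theorem lqNorm_iteratedConv_flowT {lam : ℝ} (hlam : 0 < lam) (n : ℕ) {p : Fin (n + 1) → ℝ} {q : ℝ}
    (hp : ∀ j, ExpDir b (p j)) (hq : 0 < q) (h : ∑ j, 1 / p j = n + 1 / q)
    {f : Fin (n + 1) → EuclideanSpace ℝ (Fin d) → ℝ≥0∞} (hf : ∀ j, Measurable (f j)) :
    leDir b (lqNorm q (iteratedConv n f) volume)
      (lqNorm q (iteratedConv n fun j => flowT lam (p j) (f j)) volume) := by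
  rw [← lqNorm_flowT hlam hq (measurable_iteratedConv n hf)]
  exact leDir.lqNorm (flowT_iteratedConv hlam n hp hq h hf) hq

/-- The sharp Young inequality and its reverse for several functions. -/
theorem young_iteratedConv (n : ℕ) {p : Fin (n + 1) → ℝ} {q : ℝ}
    (hp : ∀ j, ExpDir b (p j)) (hq : 0 < q) (h : ∑ j, 1 / p j = n + 1 / q)
    {f : Fin (n + 1) → EuclideanSpace ℝ (Fin d) → ℝ≥0∞} (hf : ∀ j, Measurable (f j)) :
    leDir b (lqNorm q (iteratedConv n f) volume)
      (youngConst d n p q * ∏ j, lqNorm (p j) (f j) volume) := by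
  induction n generalizing q with
  | zero =>
    obtain rfl := eq_of_sum_zero h
    have : youngConst d 0 p (p 0) = 1 := by
      simp [youngConst, (youngC_pos (hp 0).1).ne']
    rw [this]
    exact leDir_of_eq (by simp [iteratedConv])
  | succ n ih =>
    obtain ⟨r, hr, h1, h2⟩ := exists_rest_exponent n hp hq h
    have hfm := measurable_iteratedConv n fun j => hf j.succ
    refine (youngIneq_euclidean (hp 0) (expDir_of_sum n (fun j => hp j.succ) hr h1)
      (expDir_of_sum _ hp hq h) h2 d _ _ (hf 0) hfm).trans ?_
    refine (((ih (fun j => hp j.succ) hr h1 fun j => hf j.succ).mul_left _).mul_left _).trans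
      (leDir_of_eq ?_)
    -- The constant `C_r` of the intermediate exponent cancels.
    have hc : youngConst d (n + 1) p q = ENNReal.ofReal (pairC (p 0) r q ^ d) *
        youngConst d n (fun j => p j.succ) r := by
      have hpc := pairC_pos (hp 0).1 hr hq
      rw [youngConst, youngConst, ← ENNReal.ofReal_mul (by positivity), ← mul_pow,
        Fin.prod_univ_succ, pairC]
      congr 2
      have := (youngC_pos hr).ne'
      field_simp
    rw [hc, Fin.prod_univ_succ fun j => lqNorm (p j) (f j) volume]
    ring

theorem sum_pos_of_pos (n : ℕ) {v : Fin (n + 1) → ℝ} (hv : ∀ j, 0 < v j) : 0 < ∑ j, v j :=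
  Finset.sum_pos (fun j _ => hv j) Finset.univ_nonempty

theorem iteratedConv_gaussE (n : ℕ) {v : Fin (n + 1) → ℝ} (hv : ∀ j, 0 < v j)
    (x : EuclideanSpace ℝ (Fin d)) :
    iteratedConv n (fun j => gaussE (v j)) x =
      ENNReal.ofReal (((∏ j, v j) / ∑ j, v j) ^ (d / 2 : ℝ)) * gaussE (∑ j, v j) x := by
  induction n generalizing x with
  | zero => simp [iteratedConv, (hv 0).ne']
  | succ n ih =>
    have hS := sum_pos_of_pos n fun j => hv j.succ
    have hv0 := hv 0
    have hP : 0 < ∏ j : Fin (n + 1), v j.succ := Finset.prod_pos fun j _ => hv _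
    have e : iteratedConv n (fun j : Fin (n + 1) => (gaussE (v j.succ) :
        EuclideanSpace ℝ (Fin d) → ℝ≥0∞)) = fun x => ENNReal.ofReal (((∏ j : Fin (n + 1),
        v j.succ) / ∑ j : Fin (n + 1), v j.succ) ^ (d / 2 : ℝ)) *
          gaussE (∑ j : Fin (n + 1), v j.succ) x :=
      funext fun x => ih (fun j => hv j.succ) x
    have e1 : (gaussE (v 0) : EuclideanSpace ℝ (Fin d) → ℝ≥0∞) = fun x => 1 * gaussE (v 0) x := by
      simp
    rw [iteratedConv, e, e1, lconvolution_const_mul (by fun_prop) (by fun_prop),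
      lconvolution_gaussE hv0 hS, one_mul, ← mul_assoc, ← ENNReal.ofReal_mul (by positivity),
      Fin.sum_univ_succ v, Fin.prod_univ_succ v, finrank_euclideanSpace_fin,
      ← Real.mul_rpow (by positivity) (by positivity)]
    congr 3
    field_simp

theorem youngConst_eq (n : ℕ) {p : Fin (n + 1) → ℝ} {q : ℝ} (hp : ∀ j, 0 < p j) (hq : 0 < q) :
    youngConst d n p q =
      ENNReal.ofReal (((∏ j, youngSq (p j)) / youngSq q) ^ (d / 2 : ℝ)) := by
  have h1 : 0 ≤ ∏ j, youngSq (p j) := Finset.prod_nonneg fun j _ => (youngSq_pos (hp j)).le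
  have h2 := (youngSq_pos hq).le
  rw [youngConst, youngC_eq hq, Finset.prod_congr rfl fun j _ => youngC_eq (hp j),
    Real.finsetProd_rpow _ _ fun j _ => (youngSq_pos (hp j)).le, ← Real.div_rpow h1 h2,
    ← Real.rpow_natCast, ← Real.rpow_mul (by positivity)]
  congr 2
  ring

theorem ExpDir.sum_abs (n : ℕ) {p : Fin (n + 1) → ℝ} {q : ℝ} (hp : ∀ j, ExpDir b (p j))
    (hq : 0 < q) (h : ∑ j, 1 / p j = n + 1 / q) : ∑ j, |1 - 1 / p j| = |1 - 1 / q| := by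
  have hq' := expDir_of_sum n hp hq h
  have hs : ∑ j, (1 - 1 / p j) = 1 - 1 / q := by
    rw [Finset.sum_sub_distrib, h]; simp
  cases b
  · have le : ∀ {s : ℝ}, ExpDir false s → 1 - 1 / s ≤ 0 := fun hs => by
      have := (one_le_div hs.1).2 hs.2
      linarith
    rw [abs_of_nonpos (le hq'), ← hs, ← Finset.sum_neg_distrib]
    exact Finset.sum_congr rfl fun j _ => abs_of_nonpos (le (hp j))
  · have le : ∀ {s : ℝ}, ExpDir true s → 0 ≤ 1 - 1 / s := fun hs => by
      have := (div_le_one hs.1).2 hs.2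
      linarith
    rw [abs_of_nonneg (le hq'), ← hs]
    exact Finset.sum_congr rfl fun j _ => abs_of_nonneg (le (hp j))

/-- The shift by `ε` keeps widths positive when `p = 1`; in that case the exponent `1 - 1/p` is zero
and the vanishing base does no harm. -/
theorem tendsto_add_rpow {p : ℝ} (hp : 0 < p) (c : ℝ) :
    Tendsto (fun ε : ℝ => (|1 - 1 / p| + c * ε) ^ (1 - 1 / p) * p ^ (1 / p)) (𝓝[>] 0)
      (𝓝 (youngSq p)) := by
  rw [youngSq, mul_comm]
  refine Tendsto.mul_const _ ?_
  by_cases hp1 : p = 1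
  · subst hp1; simp
  have h0 := abs_one_sub_pos hp hp1
  have h : Tendsto (fun ε : ℝ => |1 - 1 / p| + c * ε) (𝓝[>] 0) (𝓝 (|1 - 1 / p| + c * 0)) :=
    ((continuous_const.add (continuous_const.mul continuous_id)).tendsto 0).mono_left
      nhdsWithin_le_nhds
  rw [mul_zero, add_zero] at h
  exact h.rpow_const (Or.inl h0.ne')

/-- The quotient of the two sides of Young's inequality for Gaussians. -/
theorem lqNorm_iteratedConv_gaussE (n : ℕ) {p : Fin (n + 1) → ℝ} {q : ℝ} (hp : ∀ j, 0 < p j)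
    (hq : 0 < q) {v : Fin (n + 1) → ℝ} (hv : ∀ j, 0 < v j) :
    lqNorm q (iteratedConv n fun j => (gaussE (v j) : EuclideanSpace ℝ (Fin d) → ℝ≥0∞)) volume =
      ENNReal.ofReal (((∏ j, v j ^ (1 - 1 / p j) * p j ^ (1 / p j)) /
        ((∑ j, v j) ^ (1 - 1 / q) * q ^ (1 / q))) ^ (d / 2 : ℝ)) *
      ∏ j, lqNorm (p j) (gaussE (v j) : EuclideanSpace ℝ (Fin d) → ℝ≥0∞) volume := by
  have hS := sum_pos_of_pos n hv
  have hP : 0 < ∏ j, v j := Finset.prod_pos fun j _ => hv j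
  have e : iteratedConv n (fun j => (gaussE (v j) : EuclideanSpace ℝ (Fin d) → ℝ≥0∞)) = _ :=
    funext fun x => iteratedConv_gaussE n hv x
  have h1 : ∀ j, 0 < v j ^ (1 - 1 / p j) * p j ^ (1 / p j) := fun j => by
    have := hv j; have := hp j; positivity
  have hP1 : 0 < ∏ j, v j ^ (1 - 1 / p j) * p j ^ (1 / p j) := Finset.prod_pos fun j _ => h1 j
  rw [e, lqNorm_const_mul hq (by fun_prop), lqNorm_gaussE hS hq, ← ENNReal.ofReal_mul (by positivity)]
  simp_rw [fun j => lqNorm_gaussE (V := EuclideanSpace ℝ (Fin d)) (hv j) (hp j)]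
  have h2 : ∀ j, 0 < v j / p j := fun j => div_pos (hv j) (hp j)
  rw [← ENNReal.ofReal_prod_of_nonneg fun j _ => (Real.rpow_pos_of_pos (h2 j) _).le,
    ← ENNReal.ofReal_mul (by positivity)]
  congr 1
  simp only [finrank_euclideanSpace_fin]
  have e3 : ∏ j, (v j / p j) ^ (d / 2 * (1 / p j) : ℝ) =
      (∏ j, (v j / p j) ^ (1 / p j)) ^ (d / 2 : ℝ) := by
    rw [← Real.finsetProd_rpow _ _ fun j _ => (Real.rpow_pos_of_pos (h2 j) _).le]
    refine Finset.prod_congr rfl fun j _ => ?_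
    rw [← Real.rpow_mul (h2 j).le, mul_comm]
  have h4 : 0 < ∏ j, (v j / p j) ^ (1 / p j) :=
    Finset.prod_pos fun j _ => Real.rpow_pos_of_pos (h2 j) _
  rw [e3, mul_comm (d / 2 : ℝ) (1 / q), Real.rpow_mul (by positivity),
    ← Real.mul_rpow (by positivity) (by positivity),
    ← Real.mul_rpow (by positivity) h4.le]
  congr 1
  have e5 : (∏ j, v j ^ (1 - 1 / p j) * p j ^ (1 / p j)) * ∏ j, (v j / p j) ^ (1 / p j) =
      ∏ j, v j := by
    rw [← Finset.prod_mul_distrib]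
    refine Finset.prod_congr rfl fun j _ => ?_
    rw [Real.div_rpow (hv j).le (hp j).le, Real.rpow_sub (hv j), Real.rpow_one]
    have := (Real.rpow_pos_of_pos (hv j) (1 / p j)).ne'
    have := (Real.rpow_pos_of_pos (hp j) (1 / p j)).ne'
    field_simp
  rw [div_mul_eq_mul_div (∏ j, v j ^ (1 - 1 / p j) * p j ^ (1 / p j)), e5,
    Real.div_rpow hS.le hq.le, Real.rpow_sub hS, Real.rpow_one]
  have := (Real.rpow_pos_of_pos hS (1 / q)).ne'
  have := (Real.rpow_pos_of_pos hq (1 / q)).ne'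
  field_simp

/-- Gaussians nearly attain the constant `youngConst`. -/
theorem tendsto_gauss_quotient (n : ℕ) {p : Fin (n + 1) → ℝ} {q : ℝ} (hp : ∀ j, ExpDir b (p j))
    (hq : 0 < q) (h : ∑ j, 1 / p j = n + 1 / q) :
    Tendsto (fun ε : ℝ => ENNReal.ofReal
      (((∏ j, (|1 - 1 / p j| + ε) ^ (1 - 1 / p j) * p j ^ (1 / p j)) /
        ((∑ j, (|1 - 1 / p j| + ε)) ^ (1 - 1 / q) * q ^ (1 / q))) ^ (d / 2 : ℝ))) (𝓝[>] 0)
      (𝓝 (youngConst d n p q)) := by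
  rw [youngConst_eq n (fun j => (hp j).1) hq]
  refine ENNReal.tendsto_ofReal (Tendsto.rpow_const ?_ (Or.inr (by positivity)))
  refine Tendsto.div (tendsto_finsetProd _ fun j _ => ?_) ?_ (youngSq_pos hq).ne'
  · simpa using tendsto_add_rpow (hp j).1 1
  · simp_rw [Finset.sum_add_distrib, ExpDir.sum_abs n hp hq h]
    simpa using tendsto_add_rpow hq (n + 1)

end Iterated

/-! ### Optimality of the constant. -/

section Best

variable {d : ℕ} {b : Bool}

theorem convNorm_eq_lqNorm (n : ℕ) {q : ℝ} (hq : 0 < q)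
    (f : Fin (n + 1) → EuclideanSpace ℝ (Fin d) → ℝ) :
    convNorm n q f = lqNorm q (iteratedConv n fun j x => ENNReal.ofReal (f j x)) volume :=
  (lqNorm_eq_eLpNorm hq _).symm

theorem eLpNorm_ofReal_eq_lqNorm {p : ℝ} (hp : 0 < p) {f : EuclideanSpace ℝ (Fin d) → ℝ}
    (hf : ∀ x, 0 ≤ f x) :
    eLpNorm f (ENNReal.ofReal p) volume = lqNorm p (fun x => ENNReal.ofReal (f x)) volume := by
  rw [lqNorm_eq_eLpNorm hp]
  refine eLpNorm_congr_enorm_ae (ae_of_all _ fun x => ?_)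
  rw [Real.enorm_of_nonneg (hf x), enorm_eq_self]

theorem lqNorm_congr_ae {α : Type*} [MeasurableSpace α] {μ : Measure α} {p : ℝ} {f g : α → ℝ≥0∞}
    (h : f =ᵐ[μ] g) : lqNorm p f μ = lqNorm p g μ := by
  unfold lqNorm
  congr 1
  exact lintegral_congr_ae (h.mono fun x hx => by simp only [hx])

theorem leDir_convNorm (n : ℕ) {p : Fin (n + 1) → ℝ} {q : ℝ}
    (hp : ∀ j, ExpDir b (p j)) (hq : 0 < q) (h : ∑ j, 1 / p j = n + 1 / q)
    {f : Fin (n + 1) → EuclideanSpace ℝ (Fin d) → ℝ} (hf : ∀ j x, 0 ≤ f j x)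
    (hm : ∀ j, AEStronglyMeasurable (f j) volume) :
    leDir b (convNorm n q f)
      (youngConst d n p q * ∏ j, eLpNorm (f j) (ENNReal.ofReal (p j)) volume) := by
  have ham : ∀ j, AEMeasurable (fun x => ENNReal.ofReal (f j x)) volume := fun j =>
    (hm j).aemeasurable.ennreal_ofReal
  have key := young_iteratedConv n hp hq h fun j => (ham j).measurable_mk
  rw [convNorm_eq_lqNorm n hq,
    lqNorm_congr_ae (iteratedConv_congr_ae n fun j => (ham j).ae_eq_mk)]
  simp_rw [fun j => eLpNorm_ofReal_eq_lqNorm (hp j).1 (hf j),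
    fun j => lqNorm_congr_ae (p := p j) (ham j).ae_eq_mk]
  exact key

/-- Test with Gaussians of widths `|1 - 1/p_j| + ε`, cancel their finite nonzero norms, and let `ε`
tend to zero. Extremal widths themselves would not do, being zero when `p_j = 1`. -/
theorem leDir_youngConst (n : ℕ) {p : Fin (n + 1) → ℝ} {q : ℝ}
    (hp : ∀ j, ExpDir b (p j)) (hq : 0 < q) (h : ∑ j, 1 / p j = n + 1 / q) {K : ℝ≥0∞}
    (hK : ∀ f : Fin (n + 1) → EuclideanSpace ℝ (Fin d) → ℝ,
      (∀ j x, 0 ≤ f j x) → (∀ j, MemLp (f j) (ENNReal.ofReal (p j)) volume) →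
      leDir b (convNorm n q f) (K * ∏ j, eLpNorm (f j) (ENNReal.ofReal (p j)) volume)) :
    leDir b (youngConst d n p q) K := by
  have key : ∀ ε : ℝ, 0 < ε → leDir b (ENNReal.ofReal
      (((∏ j, (|1 - 1 / p j| + ε) ^ (1 - 1 / p j) * p j ^ (1 / p j)) /
        ((∑ j, (|1 - 1 / p j| + ε)) ^ (1 - 1 / q) * q ^ (1 / q))) ^ (d / 2 : ℝ))) K := by
    intro ε hε
    have hv : ∀ j, 0 < |1 - 1 / p j| + ε := fun j => by positivity
    have hfin : ∀ j, lqNorm (p j) (gaussE (|1 - 1 / p j| + ε) : EuclideanSpace ℝ (Fin d) → ℝ≥0∞)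
        volume ≠ ∞ := fun j => by
      rw [lqNorm_gaussE (hv j) (hp j).1]; exact ENNReal.ofReal_ne_top
    have hne : ∀ j, lqNorm (p j) (gaussE (|1 - 1 / p j| + ε) : EuclideanSpace ℝ (Fin d) → ℝ≥0∞)
        volume ≠ 0 := fun j => by
      rw [lqNorm_gaussE (hv j) (hp j).1, ne_eq, ENNReal.ofReal_eq_zero, not_le]
      have := (hp j).1
      have := hv j
      positivity
    set f : Fin (n + 1) → EuclideanSpace ℝ (Fin d) → ℝ := fun j x =>
      Real.exp (-(Real.pi / (|1 - 1 / p j| + ε)) * ‖x‖ ^ 2) with hf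
    have h0 : ∀ j x, 0 ≤ f j x := fun j x => (Real.exp_pos _).le
    have he : ∀ j, eLpNorm (f j) (ENNReal.ofReal (p j)) volume =
        lqNorm (p j) (gaussE (|1 - 1 / p j| + ε)) volume := fun j =>
      eLpNorm_ofReal_eq_lqNorm (hp j).1 (h0 j)
    have h1 := hK f h0 fun j => ⟨by
      refine Continuous.aestronglyMeasurable ?_
      simp only [hf]; fun_prop, by rw [he]; exact (hfin j).lt_top⟩
    simp_rw [he] at h1
    have h2 : convNorm n q f = lqNorm q (iteratedConv n fun j =>
        (gaussE (|1 - 1 / p j| + ε) : EuclideanSpace ℝ (Fin d) → ℝ≥0∞)) volume :=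
      convNorm_eq_lqNorm n hq f
    rw [h2, lqNorm_iteratedConv_gaussE n (fun j => (hp j).1) hq hv, mul_comm, mul_comm K] at h1
    refine leDir_of_mul_left ?_ ?_ h1
    · exact Finset.prod_ne_zero_iff.2 fun j _ => hne j
    · exact ENNReal.prod_ne_top fun j _ => hfin j
  have ht := tendsto_gauss_quotient (d := d) n hp hq h
  cases b
  · exact ge_of_tendsto ht (eventually_nhdsWithin_of_forall fun ε hε => key ε hε)
  · exact le_of_tendsto ht (eventually_nhdsWithin_of_forall fun ε hε => key ε hε)

end Best

/-! ### Green's identity and cut-off plane waves. -/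

section Green

variable {d : ℕ}

theorem fderiv_fderiv_apply {f : EuclideanSpace ℝ (Fin d) → ℝ} (hf : ContDiff ℝ 2 f)
    (v w x : EuclideanSpace ℝ (Fin d)) :
    fderiv ℝ (fun y => fderiv ℝ f y v) x w = fderiv ℝ (fderiv ℝ f) x w v := by
  have h1 : DifferentiableAt ℝ (fderiv ℝ f) x :=
    (hf.fderiv_right (m := 1) (by norm_num)).differentiable (by norm_num) x
  have := h1.hasFDerivAt.clm_apply (hasFDerivAt_const v x)
  rw [this.fderiv]
  simp

theorem laplacian_eq_sum_fderiv {f : EuclideanSpace ℝ (Fin d) → ℝ} (hf : ContDiff ℝ 2 f)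
    (x : EuclideanSpace ℝ (Fin d)) :
    Laplacian.laplacian f x = ∑ i, fderiv ℝ (fun y => fderiv ℝ f y
      (EuclideanSpace.basisFun (Fin d) ℝ i)) x (EuclideanSpace.basisFun (Fin d) ℝ i) := by
  have := congrFun (InnerProductSpace.laplacian_eq_iteratedFDeriv_orthonormalBasis f
    (EuclideanSpace.basisFun (Fin d) ℝ)) x
  rw [this]
  refine Finset.sum_congr rfl fun i _ => ?_
  rw [iteratedFDeriv_two_apply, fderiv_fderiv_apply hf]
  rfl

theorem contDiff_fderiv_apply_const {f : EuclideanSpace ℝ (Fin d) → ℝ} (hf : ContDiff ℝ 2 f)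
    (v : EuclideanSpace ℝ (Fin d)) : ContDiff ℝ 1 fun y => fderiv ℝ f y v :=
  (hf.fderiv_right (m := 1) (by norm_num)).clm_apply contDiff_const

theorem continuous_fderiv_fderiv {f : EuclideanSpace ℝ (Fin d) → ℝ} (hf : ContDiff ℝ 2 f)
    (v : EuclideanSpace ℝ (Fin d)) :
    Continuous fun x => fderiv ℝ (fun y => fderiv ℝ f y v) x v :=
  ((contDiff_fderiv_apply_const hf v).continuous_fderiv (by norm_num)).clm_apply continuous_const

theorem integral_mul_fderiv_fderiv {ψ u : EuclideanSpace ℝ (Fin d) → ℝ} (hψ : ContDiff ℝ 2 ψ)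
    (hc : HasCompactSupport ψ) (hu : ContDiff ℝ 2 u) (v : EuclideanSpace ℝ (Fin d)) :
    ∫ x, ψ x * fderiv ℝ (fun y => fderiv ℝ u y v) x v =
      ∫ x, fderiv ℝ (fun y => fderiv ℝ ψ y v) x v * u x := by
  have cψ := hψ.continuous
  have cu := hu.continuous
  have dψ := (contDiff_fderiv_apply_const hψ v).continuous
  have du := (contDiff_fderiv_apply_const hu v).continuous
  have ddψ := continuous_fderiv_fderiv hψ v
  have ddu := continuous_fderiv_fderiv hu v
  have hc1 : HasCompactSupport fun y => fderiv ℝ ψ y v := hc.fderiv_apply ℝ v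
  have hc2 : HasCompactSupport fun x => fderiv ℝ (fun y => fderiv ℝ ψ y v) x v :=
    hc1.fderiv_apply ℝ v
  have int : ∀ {f g : EuclideanSpace ℝ (Fin d) → ℝ}, Continuous f → Continuous g →
      HasCompactSupport f → Integrable (fun x => f x * g x) volume := fun hf hg hc =>
    (hf.mul hg).integrable_of_hasCompactSupport hc.mul_right
  have one : ∀ {f : EuclideanSpace ℝ (Fin d) → ℝ}, ContDiff ℝ 2 f → Differentiable ℝ f :=
    fun h => h.differentiable (by norm_num)
  have two : ∀ {f : EuclideanSpace ℝ (Fin d) → ℝ}, ContDiff ℝ 2 f →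
      Differentiable ℝ fun y => fderiv ℝ f y v :=
    fun h => (contDiff_fderiv_apply_const h v).differentiable (by norm_num)
  rw [integral_mul_fderiv_eq_neg_fderiv_mul_of_integrable (int dψ du hc1) (int cψ ddu hc)
    (int cψ du hc) (fun x _ => one hψ x) (fun x _ => two hu x),
    integral_mul_fderiv_eq_neg_fderiv_mul_of_integrable (int ddψ cu hc2) (int dψ du hc1)
    (int dψ cu hc1) (fun x _ => two hψ x) (fun x _ => one hu x), neg_neg]

/-- Green's second identity against a compactly supported function. -/
theorem integral_mul_laplacian {ψ u : EuclideanSpace ℝ (Fin d) → ℝ} (hψ : ContDiff ℝ 2 ψ)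
    (hc : HasCompactSupport ψ) (hu : ContDiff ℝ 2 u) :
    ∫ x, ψ x * Laplacian.laplacian u x = ∫ x, Laplacian.laplacian ψ x * u x := by
  simp_rw [laplacian_eq_sum_fderiv hψ, laplacian_eq_sum_fderiv hu, Finset.mul_sum, Finset.sum_mul]
  rw [integral_finsetSum, integral_finsetSum]
  · exact Finset.sum_congr rfl fun i _ => integral_mul_fderiv_fderiv hψ hc hu _
  · intro i _
    exact ((continuous_fderiv_fderiv hψ _).mul hu.continuous).integrable_of_hasCompactSupport
      ((hc.fderiv_apply ℝ _).fderiv_apply ℝ _).mul_right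
  · intro i _
    exact (hψ.continuous.mul (continuous_fderiv_fderiv hu _)).integrable_of_hasCompactSupport
      hc.mul_right

/-- Writing `-sin` as a shifted cosine keeps both terms in the original form, so the formula can be
iterated. Two shifts add up to `π` and change the sign. -/
theorem fderiv_cos_mul_comp_smul {g : EuclideanSpace ℝ (Fin d) → ℝ} (hg : Differentiable ℝ g)
    (ξ v : EuclideanSpace ℝ (Fin d)) (b ε : ℝ) (y : EuclideanSpace ℝ (Fin d)) :
    fderiv ℝ (fun y => Real.cos (inner ℝ ξ y + b) * g (ε • y)) y v =
      ε * (Real.cos (inner ℝ ξ y + b) * fderiv ℝ g (ε • y) v) +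
        inner ℝ ξ v * (Real.cos (inner ℝ ξ y + (b + Real.pi / 2)) * g (ε • y)) := by
  have h1 : HasFDerivAt (fun y : EuclideanSpace ℝ (Fin d) => inner ℝ ξ y + b) (innerSL ℝ ξ) y :=
    ((innerSL ℝ ξ).hasFDerivAt).add_const b
  have h2 : HasFDerivAt (fun y => g (ε • y)) (ε • fderiv ℝ g (ε • y)) y := by
    have := (hg (ε • y)).hasFDerivAt.comp y ((hasFDerivAt_id y).const_smul ε)
    exact this.congr_fderiv (by ext w; simp)
  have h3 := (h1.cos.mul h2).fderiv
  change fderiv ℝ (fun y => Real.cos (inner ℝ ξ y + b) * g (ε • y)) y = _ at h3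
  rw [h3, ← add_assoc, Real.cos_add_pi_div_two]
  simp
  ring

/-- A plane wave, cut off at distance `1 / ε`. -/
noncomputable def cutWave (χ : EuclideanSpace ℝ (Fin d) → ℝ) (ξ : EuclideanSpace ℝ (Fin d))
    (b ε : ℝ) (y : EuclideanSpace ℝ (Fin d)) : ℝ :=
  Real.cos (inner ℝ ξ y + b) * χ (ε • y)

theorem contDiff_cutWave {χ : EuclideanSpace ℝ (Fin d) → ℝ} (hχ : ContDiff ℝ 2 χ)
    (ξ : EuclideanSpace ℝ (Fin d)) (b ε : ℝ) : ContDiff ℝ 2 (cutWave χ ξ b ε) := by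
  unfold cutWave
  exact (Real.contDiff_cos.comp ((contDiff_const.inner ℝ contDiff_id).add contDiff_const)).mul
    (hχ.comp (contDiff_const_smul ε))

/-- Each derivative that falls on the cutoff costs a factor `ε`, and its derivatives are bounded. Up
to `O(ε)` the cut-off wave is an eigenfunction with eigenvalue `-‖ξ‖ ^ 2`. -/
theorem laplacian_cutWave {χ : EuclideanSpace ℝ (Fin d) → ℝ} (hχ : ContDiff ℝ 2 χ)
    (hc : HasCompactSupport χ) (ξ : EuclideanSpace ℝ (Fin d)) (b : ℝ) :
    ∃ C : ℝ, 0 ≤ C ∧ ∀ ε, 0 < ε → ε ≤ 1 → ∀ y,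
      |Laplacian.laplacian (cutWave χ ξ b ε) y + ‖ξ‖ ^ 2 * cutWave χ ξ b ε y| ≤ C * ε := by
  set e := EuclideanSpace.basisFun (Fin d) ℝ with he
  have hA : ∀ i, ∃ A, ∀ x, ‖fderiv ℝ χ x (e i)‖ ≤ A := fun i =>
    (hc.fderiv_apply ℝ (e i)).exists_bound_of_continuous
      (contDiff_fderiv_apply_const hχ _).continuous
  have hB : ∀ i, ∃ B, ∀ x, ‖fderiv ℝ (fun y => fderiv ℝ χ y (e i)) x (e i)‖ ≤ B := fun i =>
    ((hc.fderiv_apply ℝ (e i)).fderiv_apply ℝ (e i)).exists_bound_of_continuous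
      (continuous_fderiv_fderiv hχ _)
  choose A hA using hA
  choose B hB using hB
  have A0 : ∀ i, 0 ≤ A i := fun i => (norm_nonneg _).trans (hA i 0)
  have B0 : ∀ i, 0 ≤ B i := fun i => (norm_nonneg _).trans (hB i 0)
  refine ⟨∑ i, (B i + 2 * |inner ℝ ξ (e i)| * A i), Finset.sum_nonneg fun i _ => by
    have := A0 i; have := B0 i; positivity, fun ε hε hε1 y => ?_⟩
  have d1 : Differentiable ℝ χ := hχ.differentiable (by norm_num)
  have key : ∀ i, fderiv ℝ (fun y => fderiv ℝ (cutWave χ ξ b ε) y (e i)) y (e i) =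
      ε ^ 2 * (Real.cos (inner ℝ ξ y + b) *
        fderiv ℝ (fun y => fderiv ℝ χ y (e i)) (ε • y) (e i)) +
      2 * ε * inner ℝ ξ (e i) * (Real.cos (inner ℝ ξ y + (b + Real.pi / 2)) *
        fderiv ℝ χ (ε • y) (e i)) - (inner ℝ ξ (e i)) ^ 2 * cutWave χ ξ b ε y := by
    intro i
    have d2 : Differentiable ℝ fun y => fderiv ℝ χ y (e i) :=
      (contDiff_fderiv_apply_const hχ _).differentiable (by norm_num)
    have e1 : (fun y => fderiv ℝ (cutWave χ ξ b ε) y (e i)) = fun y =>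
        ε * (Real.cos (inner ℝ ξ y + b) * fderiv ℝ χ (ε • y) (e i)) +
        inner ℝ ξ (e i) * (Real.cos (inner ℝ ξ y + (b + Real.pi / 2)) * χ (ε • y)) :=
      funext fun y => fderiv_cos_mul_comp_smul d1 ξ (e i) b ε y
    have dd : ∀ {g : EuclideanSpace ℝ (Fin d) → ℝ} (c : ℝ), Differentiable ℝ g →
        DifferentiableAt ℝ (fun y => Real.cos (inner ℝ ξ y + c) * g (ε • y)) y := by
      intro g c hg
      have h1 : Differentiable ℝ fun y : EuclideanSpace ℝ (Fin d) => inner ℝ ξ y :=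
        (innerSL ℝ ξ).differentiable
      exact (((h1 y).add_const c).cos).mul (hg.comp (differentiable_id.const_smul ε) y)
    rw [e1, fderiv_fun_add ((dd _ d2).const_mul _) ((dd _ d1).const_mul _),
      fderiv_const_mul (dd _ d2), fderiv_const_mul (dd _ d1)]
    simp only [add_apply, smul_apply, smul_eq_mul]
    rw [fderiv_cos_mul_comp_smul d2, fderiv_cos_mul_comp_smul d1]
    have : inner ℝ ξ y + (b + Real.pi / 2 + Real.pi / 2) = (inner ℝ ξ y + b) + Real.pi := by ring
    rw [this, Real.cos_add_pi, cutWave]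
    ring
  have hpar : ∑ i, inner ℝ ξ (e i) ^ 2 = ‖ξ‖ ^ 2 := by
    have := e.sum_sq_norm_inner_left ξ
    simpa using this
  rw [laplacian_eq_sum_fderiv (contDiff_cutWave hχ ξ b ε)]
  simp_rw [← he, key]
  rw [Finset.sum_sub_distrib, ← Finset.sum_mul, hpar, sub_add_cancel, Finset.sum_mul]
  refine (Finset.abs_sum_le_sum_abs _ _).trans (Finset.sum_le_sum fun i _ => ?_)
  have c1 := Real.abs_cos_le_one (inner ℝ ξ y + b)
  have c2 := Real.abs_cos_le_one (inner ℝ ξ y + (b + Real.pi / 2))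
  have a1 := hA i (ε • y)
  have b1 := hB i (ε • y)
  rw [Real.norm_eq_abs] at a1 b1
  refine (abs_add_le _ _).trans ?_
  rw [abs_mul, abs_mul, abs_mul, abs_mul, abs_mul, abs_mul, abs_of_pos hε, abs_pow, abs_of_pos hε,
    abs_two]
  calc _ ≤ ε ^ 2 * (1 * B i) + 2 * ε * |inner ℝ ξ (e i)| * (1 * A i) := by gcongr
    _ ≤ ε * B i + 2 * ε * |inner ℝ ξ (e i)| * A i := by
        have : ε ^ 2 ≤ ε := by nlinarith
        have := mul_le_mul_of_nonneg_right this (B0 i)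
        linarith
    _ = _ := by ring

end Green

/-! ### Plane waves tested against a solution. -/

section Solution

variable {d : ℕ} {σ : ℝ} {μ : Measure (EuclideanSpace ℝ (Fin d))}
  {u : ℝ → EuclideanSpace ℝ (Fin d) → ℝ}

theorem IsHeatSolution.integrable (h : IsHeatSolution σ μ u) {t : ℝ} (ht : 0 < t) :
    Integrable (u t) volume := by
  obtain ⟨M, hM, hb⟩ := h.mass_bounded t ht
  refine ⟨h.aestronglyMeasurable t ht, ?_⟩
  rw [hasFiniteIntegral_iff_ofReal (ae_of_all _ (h.nonneg t ht))]
  exact (hb t ht le_rfl).trans_lt hM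

theorem IsHeatSolution.integral_le (h : IsHeatSolution σ μ u) {T : ℝ} (hT : 0 < T) :
    ∃ M : ℝ, 0 ≤ M ∧ ∀ t, 0 < t → t ≤ T → ∫ x, u t x ≤ M := by
  obtain ⟨M, hM, hb⟩ := h.mass_bounded T hT
  refine ⟨M.toReal, ENNReal.toReal_nonneg, fun t ht htT => ?_⟩
  rw [integral_eq_lintegral_of_nonneg_ae (ae_of_all _ (h.nonneg t ht))
    (h.aestronglyMeasurable t ht)]
  exact ENNReal.toReal_mono hM.ne (hb t ht htT)

/-- The weak form of the heat equation. -/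
theorem IsHeatSolution.hasDerivAt_integral (h : IsHeatSolution σ μ u) (hσ : 0 < σ)
    {ψ : EuclideanSpace ℝ (Fin d) → ℝ} (hψ : ContDiff ℝ 2 ψ) (hc : HasCompactSupport ψ)
    {t : ℝ} (ht : 0 < t) :
    HasDerivAt (fun s => ∫ x, ψ x * u s x)
      (σ / (4 * Real.pi) * ∫ x, Laplacian.laplacian ψ x * u t x) t := by
  have hK : IsCompact (Icc (t / 2) (2 * t) ×ˢ tsupport ψ) := isCompact_Icc.prod hc
  have hsub : Icc (t / 2) (2 * t) ×ˢ tsupport ψ ⊆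
      (Ioi (0 : ℝ)) ×ˢ (univ : Set (EuclideanSpace ℝ (Fin d))) := by
    rintro ⟨s, x⟩ ⟨hs, -⟩
    exact ⟨lt_of_lt_of_le (by positivity) hs.1, mem_univ _⟩
  -- Joint continuity of the Laplacian on a compact space-time set gives the uniform bound for
  -- differentiation under the integral.
  obtain ⟨B, hB⟩ := hK.exists_bound_of_continuousOn ((h.continuousOn_laplacian hσ).mono hsub)
  have hcu : ∀ s, 0 < s → Continuous (u s) := fun s hs => (h.contDiff hσ s hs).continuous
  have hcl : ∀ s, 0 < s → Continuous (Laplacian.laplacian (u s)) := fun s hs => by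
    have := h.continuousOn_laplacian hσ
    rw [← continuousOn_univ]
    exact this.comp (f := fun x => (s, x)) (by fun_prop) fun x _ => ⟨hs, mem_univ _⟩
  have key := (hasDerivAt_integral_of_dominated_loc_of_deriv_le (μ := volume)
    (F := fun s x => ψ x * u s x)
    (F' := fun s x => ψ x * (σ / (4 * Real.pi) * Laplacian.laplacian (u s) x)) (x₀ := t)
    (s := Icc (t / 2) (2 * t)) (bound := fun x => ‖ψ x‖ * (σ / (4 * Real.pi) * B))
    (Icc_mem_nhds (by linarith) (by linarith)) ?_ ?_ ?_ ?_ ?_ ?_).2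
  · have e : ∫ x, ψ x * (σ / (4 * Real.pi) * Laplacian.laplacian (u t) x) =
        σ / (4 * Real.pi) * ∫ x, Laplacian.laplacian ψ x * u t x := by
      rw [← integral_mul_laplacian hψ hc (h.contDiff hσ t ht), ← integral_const_mul]
      refine integral_congr_ae (ae_of_all _ fun x => ?_)
      simp only; ring
    rw [← e]
    exact key
  · filter_upwards [Ioi_mem_nhds ht] with s hs
    exact (hψ.continuous.mul (hcu s hs)).aestronglyMeasurable
  · exact (hψ.continuous.mul (hcu t ht)).integrable_of_hasCompactSupport hc.mul_right
  · exact (hψ.continuous.mul (continuous_const.mul (hcl t ht))).aestronglyMeasurable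
  · refine ae_of_all _ fun x s hs => ?_
    by_cases hx : x ∈ tsupport ψ
    · have := hB (s, x) ⟨hs, hx⟩
      rw [norm_mul, norm_mul, Real.norm_of_nonneg (by positivity : 0 ≤ σ / (4 * Real.pi))]
      gcongr
    · simp [image_eq_zero_of_notMem_tsupport hx]
  · exact (hψ.continuous.norm.mul continuous_const).integrable_of_hasCompactSupport
      hc.norm.mul_right
  · refine ae_of_all _ fun x s hs => ?_
    exact (h.heat_equation s (lt_of_lt_of_le (by positivity) hs.1) x).const_mul _

/-- Plane waves are eigenfunctions for the heat flow. -/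
theorem IsHeatSolution.integral_cos (h : IsHeatSolution σ μ u) (hσ : 0 < σ)
    (ξ : EuclideanSpace ℝ (Fin d)) (b : ℝ) {s t : ℝ} (hs : 0 < s) (hst : s ≤ t) :
    Real.exp (σ / (4 * Real.pi) * ‖ξ‖ ^ 2 * t) * ∫ x, Real.cos (inner ℝ ξ x + b) * u t x =
      Real.exp (σ / (4 * Real.pi) * ‖ξ‖ ^ 2 * s) * ∫ x, Real.cos (inner ℝ ξ x + b) * u s x := by
  have ht : 0 < t := hs.trans_le hst
  set κ := σ / (4 * Real.pi) with hκ
  have κ0 : 0 ≤ κ := by positivity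
  set c := κ * ‖ξ‖ ^ 2 with hc
  have c0 : 0 ≤ c := by positivity
  obtain ⟨M, M0, hM⟩ := h.integral_le ht
  let χ : ContDiffBump (0 : EuclideanSpace ℝ (Fin d)) := ⟨1, 2, one_pos, one_lt_two⟩
  have χd : ContDiff ℝ 2 (χ : EuclideanSpace ℝ (Fin d) → ℝ) := χ.contDiff
  obtain ⟨C, C0, hC⟩ := laplacian_cutWave χd χ.hasCompactSupport ξ b
  set ψ := cutWave (χ : EuclideanSpace ℝ (Fin d) → ℝ) ξ b with hψ
  have ψd : ∀ ε, ContDiff ℝ 2 (ψ ε) := fun ε => contDiff_cutWave χd ξ b ε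
  have ψc : ∀ ε, 0 < ε → HasCompactSupport (ψ ε) := fun ε hε =>
    (χ.hasCompactSupport.comp_smul hε.ne').mul_left
  -- The derivative of `exp (c τ) ∫ ψ_ε u_τ` contains only the eigenfunction error of the cut-off
  -- wave, so the mass bound `M` and the mean value inequality make the increment `O(ε)`.
  have bound : ∀ ε, 0 < ε → ε ≤ 1 →
      ‖Real.exp (c * t) * (∫ x, ψ ε x * u t x) - Real.exp (c * s) * (∫ x, ψ ε x * u s x)‖ ≤
        Real.exp (c * t) * κ * C * M * ε * (t - s) := by
    intro ε hε hε1
    refine norm_image_sub_le_of_norm_deriv_le_segment' (a := s) (b := t)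
      (f := fun τ => Real.exp (c * τ) * ∫ x, ψ ε x * u τ x)
      (f' := fun τ => Real.exp (c * τ) * (κ * ∫ x,
        (Laplacian.laplacian (ψ ε) x + ‖ξ‖ ^ 2 * ψ ε x) * u τ x)) ?_ ?_ t ⟨hst, le_rfl⟩
    · intro τ hτ
      have τ0 : 0 < τ := hs.trans_le hτ.1
      have d1 := h.hasDerivAt_integral hσ (ψd ε) (ψc ε hε) τ0
      have d2 : HasDerivAt (fun τ => Real.exp (c * τ)) (Real.exp (c * τ) * c) τ := by
        simpa using ((hasDerivAt_id τ).const_mul c).exp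
      refine ((d2.mul d1).congr_deriv ?_).hasDerivWithinAt
      have cu := (h.contDiff hσ τ τ0).continuous
      have i1 : Integrable (fun x => Laplacian.laplacian (ψ ε) x * u τ x) := by
        have e : (fun x => Laplacian.laplacian (ψ ε) x) = fun x => ∑ i, fderiv ℝ (fun y =>
          fderiv ℝ (ψ ε) y (EuclideanSpace.basisFun (Fin d) ℝ i)) x
          (EuclideanSpace.basisFun (Fin d) ℝ i) := funext (laplacian_eq_sum_fderiv (ψd ε))
        have := fun x => congrFun e x
        simp_rw [this, Finset.sum_mul]
        exact integrable_finsetSum _ fun i _ =>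
          ((continuous_fderiv_fderiv (ψd ε) _).mul cu).integrable_of_hasCompactSupport
          (((ψc ε hε).fderiv_apply ℝ _).fderiv_apply ℝ _).mul_right
      have i2 : Integrable (fun x => ‖ξ‖ ^ 2 * (ψ ε x * u τ x)) :=
        (((ψd ε).continuous.mul cu).integrable_of_hasCompactSupport
          (ψc ε hε).mul_right).const_mul _
      have e : ∫ x, (Laplacian.laplacian (ψ ε) x + ‖ξ‖ ^ 2 * ψ ε x) * u τ x =
          (∫ x, Laplacian.laplacian (ψ ε) x * u τ x) + ‖ξ‖ ^ 2 * ∫ x, ψ ε x * u τ x := by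
        rw [← integral_const_mul, ← integral_add i1 i2]
        refine integral_congr_ae (ae_of_all _ fun x => ?_)
        simp only; ring
      rw [e, ← hκ, hc]; ring
    · intro τ hτ
      have τ0 : 0 < τ := hs.trans_le hτ.1
      have hle : ‖∫ x, (Laplacian.laplacian (ψ ε) x + ‖ξ‖ ^ 2 * ψ ε x) * u τ x‖ ≤ C * ε * M := by
        refine (norm_integral_le_integral_norm _).trans ?_
        calc _ ≤ ∫ x, C * ε * u τ x := by
              refine integral_mono_of_nonneg (ae_of_all _ fun x => norm_nonneg _)
                ((h.integrable τ0).const_mul _) (ae_of_all _ fun x => ?_)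
              simp only [norm_mul]
              rw [Real.norm_of_nonneg (h.nonneg τ τ0 x)]
              exact mul_le_mul_of_nonneg_right (hC ε hε hε1 x) (h.nonneg τ τ0 x)
          _ ≤ C * ε * M := by
              rw [integral_const_mul]
              exact mul_le_mul_of_nonneg_left (hM τ τ0 hτ.2.le) (by positivity)
      rw [norm_mul, norm_mul, Real.norm_of_nonneg (Real.exp_pos _).le, Real.norm_of_nonneg κ0]
      calc _ ≤ Real.exp (c * t) * (κ * (C * ε * M)) := by
            gcongr
            exact hτ.2.le
        _ = _ := by ring
  have lim : ∀ τ, 0 < τ → Tendsto (fun n : ℕ => ∫ x, ψ (1 / ((n : ℝ) + 1)) x * u τ x) atTop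
      (𝓝 (∫ x, Real.cos (inner ℝ ξ x + b) * u τ x)) := by
    intro τ τ0
    refine tendsto_integral_of_dominated_convergence (u τ)
      (fun n => ((ψd _).continuous.aestronglyMeasurable).mul (h.aestronglyMeasurable τ τ0))
      (h.integrable τ0) (fun n => ae_of_all _ fun x => ?_) (ae_of_all _ fun x => ?_)
    · rw [norm_mul, Real.norm_of_nonneg (h.nonneg τ τ0 x)]
      refine mul_le_of_le_one_left (h.nonneg τ τ0 x) ?_
      rw [hψ, cutWave, norm_mul]
      refine mul_le_one₀ (Real.abs_cos_le_one _) (norm_nonneg _) ?_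
      rw [Real.norm_of_nonneg χ.nonneg]
      exact χ.le_one
    · refine Tendsto.mul_const _ ?_
      have h1 : Tendsto (fun n : ℕ => (1 / ((n : ℝ) + 1)) • x) atTop (𝓝 ((0 : ℝ) • x)) :=
        (tendsto_one_div_add_atTop_nhds_zero_nat).smul_const x
      rw [zero_smul] at h1
      have h2 := (χ.continuous.tendsto 0).comp h1
      have h3 : χ (0 : EuclideanSpace ℝ (Fin d)) = 1 :=
        χ.one_of_mem_closedBall (by simp [χ.rIn_pos.le])
      rw [h3] at h2
      have := h2.const_mul (Real.cos (inner ℝ ξ x + b))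
      rw [mul_one] at this
      exact this
  have lim0 : Tendsto (fun n : ℕ => Real.exp (c * t) * κ * C * M * (1 / ((n : ℝ) + 1)) * (t - s))
      atTop (𝓝 0) := by
    have := (tendsto_one_div_add_atTop_nhds_zero_nat (𝕜 := ℝ)).const_mul
      (Real.exp (c * t) * κ * C * M)
    simpa using this.mul_const (t - s)
  have l1 := (((lim t ht).const_mul (Real.exp (c * t))).sub
    ((lim s hs).const_mul (Real.exp (c * s)))).norm
  have h0 := le_of_tendsto_of_tendsto' l1 lim0 fun n => bound _ (by positivity) (by
    rw [div_le_one (by positivity)]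
    linarith [(n.cast_nonneg : (0 : ℝ) ≤ n)])
  exact sub_eq_zero.1 (norm_le_zero_iff.1 h0)

end Solution

/-! ### Identification with the heat semigroup. -/

section Semigroup

variable {d : ℕ} {σ : ℝ} {μ : Measure (EuclideanSpace ℝ (Fin d))}
  {u : ℝ → EuclideanSpace ℝ (Fin d) → ℝ}

theorem isFiniteMeasure_heatE {s : ℝ} (hs : 0 < s) :
    IsFiniteMeasure ((volume : Measure (EuclideanSpace ℝ (Fin d))).withDensity (heatE s)) :=
  isFiniteMeasure_withDensity (by rw [lintegral_heatE hs]; exact ENNReal.one_ne_top)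

/-- The exponent matches the decay rate `σ / (4π) * ‖ξ‖ ^ 2` of plane waves under the equation:
elapsed time `t - s` corresponds to the kernel `heatE (σ * (t - s))`. -/
theorem charFun_heatE {s : ℝ} (hs : 0 < s) (ξ : EuclideanSpace ℝ (Fin d)) :
    charFun ((volume : Measure (EuclideanSpace ℝ (Fin d))).withDensity (heatE s)) ξ =
      Complex.exp (-(s * ‖ξ‖ ^ 2 / (4 * Real.pi) : ℝ)) := by
  rw [charFun_apply, integral_withDensity_eq_integral_toReal_smul (measurable_heatE s)
    (ae_of_all _ fun x => ENNReal.mul_lt_top ENNReal.ofReal_lt_top (gaussE_ne_top _ _).lt_top)]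
  have hb : 0 < ((Real.pi / s : ℝ) : ℂ).re := by
    rw [Complex.ofReal_re]; exact div_pos Real.pi_pos hs
  have key := GaussianFourier.integral_cexp_neg_mul_sq_norm_add hb Complex.I ξ
  rw [finrank_euclideanSpace_fin] at key
  have e : ∀ x : EuclideanSpace ℝ (Fin d), (heatE s x).toReal • Complex.exp (inner ℝ x ξ * Complex.I)
      = ((s ^ (-(d / 2) : ℝ) : ℝ) : ℂ) *
        Complex.exp (-((Real.pi / s : ℝ) : ℂ) * ‖x‖ ^ 2 + Complex.I * inner ℝ ξ x) := by
    intro x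
    rw [heatE, gaussE, ENNReal.toReal_mul, ENNReal.toReal_ofReal (by positivity),
      ENNReal.toReal_ofReal (Real.exp_pos _).le, Complex.real_smul, Complex.exp_add,
      real_inner_comm]
    push_cast
    rw [mul_assoc, mul_comm Complex.I]
  simp_rw [e]
  rw [integral_const_mul, key, ← mul_assoc]
  have e2 : ((s ^ (-(d / 2) : ℝ) : ℝ) : ℂ) *
      (Real.pi / ((Real.pi / s : ℝ) : ℂ)) ^ ((d : ℂ) / 2) = 1 := by
    have : (Real.pi : ℂ) / ((Real.pi / s : ℝ) : ℂ) = ((s : ℝ) : ℂ) := by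
      rw [← Complex.ofReal_div]
      congr 1
      have := Real.pi_pos.ne'
      field_simp
    rw [this]
    have h2 : ((s : ℝ) : ℂ) ^ ((d : ℂ) / 2) = ((s ^ ((d : ℝ) / 2) : ℝ) : ℂ) := by
      rw [Complex.ofReal_cpow hs.le]; push_cast; rfl
    rw [h2, ← Complex.ofReal_mul, ← Real.rpow_add hs]
    simp
  rw [e2, one_mul, Complex.I_sq]
  congr 1
  have := Real.pi_pos.ne'
  push_cast
  have : (Real.pi : ℂ) ≠ 0 := by exact_mod_cast Real.pi_pos.ne'
  have : (s : ℂ) ≠ 0 := by exact_mod_cast hs.ne'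
  field_simp

theorem IsHeatSolution.lintegral_ne_top (h : IsHeatSolution σ μ u) {t : ℝ} (ht : 0 < t) :
    ∫⁻ x, ENNReal.ofReal (u t x) ≠ ∞ := by
  obtain ⟨M, hM, hb⟩ := h.mass_bounded t ht
  exact ((hb t ht le_rfl).trans_lt hM).ne

theorem IsHeatSolution.aemeasurable_ofReal (h : IsHeatSolution σ μ u) {t : ℝ} (ht : 0 < t) :
    AEMeasurable (fun x => ENNReal.ofReal (u t x)) volume :=
  (h.aestronglyMeasurable t ht).aemeasurable.ennreal_ofReal

/-- The phases `0` and `-π/2` give the real and imaginary parts, so `integral_cos` covers both. -/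
theorem IsHeatSolution.charFun_eq (h : IsHeatSolution σ μ u) {t : ℝ} (ht : 0 < t)
    (ξ : EuclideanSpace ℝ (Fin d)) :
    charFun (volume.withDensity fun x => ENNReal.ofReal (u t x)) ξ =
      (∫ x, Real.cos (inner ℝ ξ x + 0) * u t x : ℝ) +
        (∫ x, Real.cos (inner ℝ ξ x + -(Real.pi / 2)) * u t x : ℝ) * Complex.I := by
  have hi := h.integrable ht
  have int : ∀ c : ℝ, Integrable (fun x => Real.cos (inner ℝ ξ x + c) * u t x) volume := fun c =>
    hi.bdd_mul (c := 1) (Continuous.aestronglyMeasurable (by fun_prop))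
      (ae_of_all _ fun x => Real.abs_cos_le_one _)
  rw [charFun_apply, integral_withDensity_eq_integral_toReal_smul₀ (h.aemeasurable_ofReal ht)
    (ae_of_all _ fun x => ENNReal.ofReal_lt_top), ← integral_complex_ofReal,
    ← integral_complex_ofReal, ← integral_mul_const, ← integral_add (int 0).ofReal
    ((int _).ofReal.mul_const _)]
  refine integral_congr_ae (ae_of_all _ fun x => ?_)
  simp only
  rw [ENNReal.toReal_ofReal (h.nonneg t ht x), Complex.real_smul, Complex.exp_mul_I, add_zero,
    ← sub_eq_add_neg, Real.cos_sub_pi_div_two, real_inner_comm]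
  push_cast
  ring

theorem IsHeatSolution.charFun_semigroup (h : IsHeatSolution σ μ u) (hσ : 0 < σ) {s t : ℝ}
    (hs : 0 < s) (hst : s < t) (ξ : EuclideanSpace ℝ (Fin d)) :
    charFun (volume.withDensity fun x => ENNReal.ofReal (u t x)) ξ =
      charFun (volume.withDensity fun x => ENNReal.ofReal (u s x)) ξ *
        charFun (volume.withDensity (heatE (σ * (t - s)))) ξ := by
  have key : ∀ b, ∫ x, Real.cos (inner ℝ ξ x + b) * u t x =
      (∫ x, Real.cos (inner ℝ ξ x + b) * u s x) *
        Real.exp (-(σ * (t - s) * ‖ξ‖ ^ 2 / (4 * Real.pi))) := by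
    intro b
    have := h.integral_cos hσ ξ b hs hst.le
    apply mul_left_cancel₀ (Real.exp_pos (σ / (4 * Real.pi) * ‖ξ‖ ^ 2 * t)).ne'
    rw [this, mul_comm (∫ x, _), ← mul_assoc, ← Real.exp_add]
    congr 2
    ring
  rw [h.charFun_eq (hs.trans hst), h.charFun_eq hs, charFun_heatE (mul_pos hσ (sub_pos.2 hst)),
    key, key]
  push_cast
  ring

/-- Two finite measures with the same characteristic function coincide, hence so do their densities
almost everywhere. Starting at a positive time avoids the initial measure. -/
theorem IsHeatSolution.ae_eq_lconvolution (h : IsHeatSolution σ μ u) (hσ : 0 < σ) {s t : ℝ}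
    (hs : 0 < s) (hst : s < t) :
    (fun x => ENNReal.ofReal (u t x)) =ᵐ[volume]
      lconvolution (fun x => ENNReal.ofReal (u s x)) (heatE (σ * (t - s))) volume := by
  have ht := hs.trans hst
  have m1 := h.aemeasurable_ofReal hs
  have := isFiniteMeasure_withDensity (h.lintegral_ne_top hs)
  have := isFiniteMeasure_withDensity (h.lintegral_ne_top ht)
  have := isFiniteMeasure_heatE (d := d) (mul_pos hσ (sub_pos.2 hst))
  have e : volume.withDensity (fun x => ENNReal.ofReal (u t x)) =
      volume.withDensity (lconvolution (fun x => ENNReal.ofReal (u s x))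
        (heatE (σ * (t - s))) volume) := by
    rw [← conv_withDensity_eq_mlconvolution₀ m1 (by fun_prop)]
    apply Measure.ext_of_charFun
    ext ξ
    rw [charFun_conv, h.charFun_semigroup hσ hs hst]
  refine (withDensity_eq_iff (h.aemeasurable_ofReal ht) ?_ (h.lintegral_ne_top ht)).1 e
  have hc : lconvolution (fun x => ENNReal.ofReal (u s x)) (heatE (σ * (t - s))) volume =
      lconvolution m1.mk (heatE (σ * (t - s))) volume :=
    lconvolution_congr_ae m1.ae_eq_mk (ae_eq_refl _)
  rw [hc]
  exact (measurable_lconvolution _ m1.measurable_mk (by fun_prop)).aemeasurable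

theorem IsHeatSolution.eq_of_zero (h : IsHeatSolution 0 μ u) {s t : ℝ} (hs : 0 < s) (ht : 0 < t) :
    u s = u t := by
  ext x
  have hd : ∀ r ∈ Ioi (0 : ℝ), HasDerivAt (fun r => u r x) 0 r := fun r hr => by
    simpa using h.heat_equation r hr x
  exact isOpen_Ioi.is_const_of_deriv_eq_zero isPreconnected_Ioi
    (fun r hr => (hd r hr).differentiableAt.differentiableWithinAt)
    (fun r hr => (hd r hr).deriv) hs ht

/-- Conservation of mass. -/
theorem IsHeatSolution.lintegral_eq (h : IsHeatSolution σ μ u) (hσ : 0 ≤ σ) {s t : ℝ}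
    (hs : 0 < s) (ht : 0 < t) :
    ∫⁻ x, ENNReal.ofReal (u s x) = ∫⁻ x, ENNReal.ofReal (u t x) := by
  rcases hσ.eq_or_lt with rfl | hσ
  · rw [h.eq_of_zero hs ht]
  have lt : ∀ {s t : ℝ}, 0 < s → s < t →
      ∫⁻ x, ENNReal.ofReal (u s x) = ∫⁻ x, ENNReal.ofReal (u t x) := by
    intro s t hs hst
    have m1 := h.aemeasurable_ofReal hs
    have hc : lconvolution (fun x => ENNReal.ofReal (u s x)) (heatE (σ * (t - s))) volume =
        lconvolution m1.mk (heatE (σ * (t - s))) volume :=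
      lconvolution_congr_ae m1.ae_eq_mk (ae_eq_refl _)
    rw [lintegral_congr_ae (h.ae_eq_lconvolution hσ hs hst), hc,
      lintegral_lconvolution m1.measurable_mk (by fun_prop),
      lintegral_heatE (mul_pos hσ (sub_pos.2 hst)), mul_one, lintegral_congr_ae m1.ae_eq_mk]
  rcases lt_trichotomy s t with hst | rfl | hst
  · exact lt hs hst
  · rfl
  · exact (lt ht hst).symm

end Semigroup

/-! ### Monotonicity along heat flows. -/

section Monotone

variable {d : ℕ} {b : Bool}

theorem lintegral_iteratedConv (n : ℕ) {f : Fin (n + 1) → EuclideanSpace ℝ (Fin d) → ℝ≥0∞}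
    (hf : ∀ j, AEMeasurable (f j) volume) :
    ∫⁻ x, iteratedConv n f x = ∏ j, ∫⁻ x, f j x := by
  suffices H : ∀ {g : Fin (n + 1) → EuclideanSpace ℝ (Fin d) → ℝ≥0∞}, (∀ j, Measurable (g j)) →
      ∫⁻ x, iteratedConv n g x = ∏ j, ∫⁻ x, g j x by
    rw [lintegral_congr_ae (iteratedConv_congr_ae n fun j => (hf j).ae_eq_mk),
      H fun j => (hf j).measurable_mk]
    exact Finset.prod_congr rfl fun j _ => lintegral_congr_ae (hf j).ae_eq_mk.symm
  clear hf f
  intro f hf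
  induction n with
  | zero => simp [iteratedConv]
  | succ n ih =>
    rw [Fin.prod_univ_succ, iteratedConv,
      lintegral_lconvolution (hf 0) (measurable_iteratedConv n fun j => hf j.succ),
      ih fun j => hf j.succ]

theorem eq_one_of_sum (n : ℕ) {p : Fin (n + 1) → ℝ} {q : ℝ} (hq : 0 < q)
    (h : ∑ j, 1 / p j = n + 1 / q) (hp : ∀ j, p j = 1) : q = 1 := by
  simp only [hp, div_one, Finset.sum_const, Finset.card_univ, Fintype.card_fin, nsmul_eq_mul,
    mul_one] at h
  push_cast at h
  have h1 : 1 / q = 1 := by linarith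
  field_simp at h1
  exact h1.symm

theorem lqNorm_one_eq {α : Type*} [MeasurableSpace α] {μ : Measure α} (f : α → ℝ≥0∞) :
    lqNorm 1 f μ = ∫⁻ x, f x ∂μ := by simp [lqNorm]

/-- The diffusion coefficients are multiples of `|1 - 1 / p j| / p j`. -/
theorem eq_flowTime_of_rel {pj pk σj σk : ℝ} (hj : ExpDir b pj) (hk : ExpDir b pk) (hk1 : pk ≠ 1)
    (h : 1 / pj * (1 - 1 / pj) * σk = 1 / pk * (1 - 1 / pk) * σj) :
    σj = flowTime (σk * pk / |1 - 1 / pk|) pj := by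
  have hne : 1 - 1 / pk ≠ 0 := abs_pos.1 (abs_one_sub_pos hk.1 hk1)
  have habs : |1 - 1 / pj| / |1 - 1 / pk| = (1 - 1 / pj) / (1 - 1 / pk) := by
    cases b
    · have le : ∀ {s : ℝ}, ExpDir false s → 1 - 1 / s ≤ 0 := fun hs => by
        have := one_div_le_one_div_of_le hs.1 (show _ ≤ (1 : ℝ) from hs.2)
        rw [one_div_one] at this
        linarith
      rw [abs_of_nonpos (le hj), abs_of_nonpos (le hk), neg_div_neg_eq]
    · have le : ∀ {s : ℝ}, ExpDir true s → 0 ≤ 1 - 1 / s := fun hs => by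
        have := one_div_le_one_div_of_le one_pos (show (1 : ℝ) ≤ _ from hs.2)
        rw [one_div_one] at this
        linarith
      rw [abs_of_nonneg (le hj), abs_of_nonneg (le hk)]
  have e : flowTime (σk * pk / |1 - 1 / pk|) pj =
      σk * pk / pj * (|1 - 1 / pj| / |1 - 1 / pk|) := by unfold flowTime; ring
  have p0 := hj.1.ne'
  have p1 := hk.1.ne'
  have e1 : σj = pk / (1 - 1 / pk) * (1 / pk * (1 - 1 / pk) * σj) := by
    generalize 1 - 1 / pk = a at hne
    field_simp
  rw [e, habs, e1, ← h]
  ring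

/-- Translates the evolution of `u` from `s` to `t` into the flow on `u^(1/p)`. The case `p = 1` has
flow time zero, hence `σ = 0` and no evolution. -/
theorem IsHeatSolution.flowT_ae_eq {σ : ℝ} {μ : Measure (EuclideanSpace ℝ (Fin d))}
    {u : ℝ → EuclideanSpace ℝ (Fin d) → ℝ} (h : IsHeatSolution σ μ u) {lam p s t : ℝ} (hp : 0 < p)
    (hlam : 0 < lam) (hs : 0 < s) (hst : s < t) (hσ : flowTime lam p = σ * (t - s))
    {f : EuclideanSpace ℝ (Fin d) → ℝ≥0∞}
    (hf : (fun x => ENNReal.ofReal (u s x ^ (1 / p))) =ᵐ[volume] f) :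
    (fun x => ENNReal.ofReal (u t x ^ (1 / p))) =ᵐ[volume] flowT lam p f := by
  have ht := hs.trans hst
  by_cases hp1 : p = 1
  · subst hp1
    have : σ = 0 := by
      have h1 : σ * (t - s) = 0 := by rw [← hσ]; simp [flowTime]
      exact (mul_eq_zero.1 h1).resolve_right (sub_pos.2 hst).ne'
    subst this
    rw [flowT_one, ← h.eq_of_zero hs ht]
    exact hf
  · have σ0 : 0 < σ := by
      have := flowTime_pos hlam hp hp1
      rw [hσ] at this
      exact pos_of_mul_pos_left this (sub_pos.2 hst).le
    have e : (fun x => f x ^ p) =ᵐ[volume] fun x => ENNReal.ofReal (u s x) := by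
      filter_upwards [hf] with x hx
      rw [← hx, ENNReal.ofReal_rpow_of_nonneg (Real.rpow_nonneg (h.nonneg s hs x) _) hp.le,
        ← Real.rpow_mul (h.nonneg s hs x), one_div_mul_cancel hp.ne', Real.rpow_one]
    rw [flowT, if_neg hp1, lconvolution_congr_ae e (ae_eq_refl _), hσ]
    filter_upwards [h.ae_eq_lconvolution σ0 hs hst] with x hx
    rw [← hx, ENNReal.ofReal_rpow_of_nonneg (h.nonneg t ht x) (by positivity)]

theorem IsHeatSolution.aemeasurable_rpow {σ : ℝ} {μ : Measure (EuclideanSpace ℝ (Fin d))}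
    {u : ℝ → EuclideanSpace ℝ (Fin d) → ℝ} (h : IsHeatSolution σ μ u) {t : ℝ} (ht : 0 < t) (p : ℝ) :
    AEMeasurable (fun x => ENNReal.ofReal (u t x ^ p)) volume :=
  ((h.aestronglyMeasurable t ht).aemeasurable.pow_const p).ennreal_ofReal

/-- Monotonicity of the norm of the convolution along heat flows. -/
theorem leDir_convNorm_heat (n : ℕ) {p : Fin (n + 1) → ℝ} {q : ℝ}
    (hp : ∀ j, ExpDir b (p j)) (hq : 0 < q) (h : ∑ j, 1 / p j = n + 1 / q)
    {σ : Fin (n + 1) → ℝ} (hσ : ∀ j, 0 ≤ σ j)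
    (hrel : ∀ j k, 1 / p j * (1 - 1 / p j) * σ k = 1 / p k * (1 - 1 / p k) * σ j)
    {μ : Fin (n + 1) → Measure (EuclideanSpace ℝ (Fin d))}
    {u : Fin (n + 1) → ℝ → EuclideanSpace ℝ (Fin d) → ℝ}
    (hu : ∀ j, IsHeatSolution (σ j) (μ j) (u j)) {s t : ℝ} (hs : 0 < s) (hst : s ≤ t) :
    leDir b (convNorm n q fun j x => u j s x ^ (1 / p j))
      (convNorm n q fun j x => u j t x ^ (1 / p j)) := by
  have ht := hs.trans_le hst
  rcases hst.eq_or_lt with rfl | hst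
  · exact leDir_of_eq rfl
  rw [convNorm_eq_lqNorm n hq, convNorm_eq_lqNorm n hq]
  -- The relation between the `σ j` is then void, but the norm is the product of the masses, which
  -- are conserved.
  by_cases h1 : ∀ j, p j = 1
  · rw [eq_one_of_sum n hq h h1, lqNorm_one_eq, lqNorm_one_eq,
      lintegral_iteratedConv n fun j => (hu j).aemeasurable_rpow hs _,
      lintegral_iteratedConv n fun j => (hu j).aemeasurable_rpow ht _]
    refine leDir_of_eq (Finset.prod_congr rfl fun j _ => ?_)
    simp only [h1, div_one, Real.rpow_one]
    exact (hu j).lintegral_eq (hσ j) hs ht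
  · push Not at h1
    obtain ⟨k, hk⟩ := h1
    set lam := σ k * p k / |1 - 1 / p k| with hlam
    have hfl : ∀ j, σ j = flowTime lam (p j) := fun j =>
      eq_flowTime_of_rel (hp j) (hp k) hk (hrel j k)
    -- A vanishing `σ k` with `p k ≠ 1` forces every `σ j` to vanish, and nothing moves.
    rcases (hσ k).eq_or_lt with h0 | h0
    · have : ∀ j, u j s = u j t := fun j => by
        have hj := hu j
        have e : σ j = 0 := by rw [hfl j, hlam, ← h0]; simp [flowTime]
        rw [e] at hj
        exact hj.eq_of_zero hs ht
      simp only [this]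
      exact leDir_of_eq rfl
    · have lam0 : 0 < lam * (t - s) :=
        mul_pos (div_pos (mul_pos h0 (hp k).1) (abs_one_sub_pos (hp k).1 hk)) (sub_pos.2 hst)
      have hm := fun j => (hu j).aemeasurable_rpow hs (1 / p j)
      have key := lqNorm_iteratedConv_flowT lam0 n hp hq h fun j => (hm j).measurable_mk
      rw [lqNorm_congr_ae (iteratedConv_congr_ae n fun j => (hm j).ae_eq_mk),
        lqNorm_congr_ae (iteratedConv_congr_ae n fun j => (hu j).flowT_ae_eq (hp j).1 lam0 hs hst
          (by rw [hfl j, flowTime, flowTime]; ring) (hm j).ae_eq_mk)]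
      exact key

end Monotone

/-! ### Polynomial weights. -/

section Weight

variable {d : ℕ}

/-- The polynomial weight `(1 + ‖x‖) ^ k`. -/
noncomputable def polyWeight (k : ℝ) (x : EuclideanSpace ℝ (Fin d)) : ℝ≥0∞ :=
  ENNReal.ofReal ((1 + ‖x‖) ^ k)

@[fun_prop]
theorem measurable_polyWeight (k : ℝ) : Measurable (polyWeight (d := d) k) := by
  unfold polyWeight; fun_prop

theorem polyWeight_ne_top (k : ℝ) (x : EuclideanSpace ℝ (Fin d)) : polyWeight k x ≠ ∞ :=
  ENNReal.ofReal_ne_top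

theorem polyWeight_ne_zero (k : ℝ) (x : EuclideanSpace ℝ (Fin d)) : polyWeight k x ≠ 0 :=
  (ENNReal.ofReal_pos.2 (by positivity)).ne'

theorem polyWeight_rpow (k r : ℝ) (x : EuclideanSpace ℝ (Fin d)) :
    polyWeight k x ^ r = polyWeight (k * r) x := by
  rw [polyWeight, polyWeight, ENNReal.ofReal_rpow_of_pos (by positivity),
    ← Real.rpow_mul (by positivity)]

theorem lintegral_polyWeight_lt_top : ∫⁻ x : EuclideanSpace ℝ (Fin d), polyWeight (-(d + 1)) x < ∞ :=
  finite_integral_one_add_norm (by rw [finrank_euclideanSpace_fin]; linarith)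

theorem one_add_norm_le (x y : EuclideanSpace ℝ (Fin d)) :
    1 + ‖x‖ ≤ (1 + ‖y‖) * (1 + ‖-y + x‖) := by
  have h : ‖x‖ ≤ ‖y‖ + ‖-y + x‖ := by
    calc ‖x‖ = ‖y + (-y + x)‖ := by congr 1; abel
      _ ≤ _ := norm_add_le _ _
  nlinarith [norm_nonneg y, norm_nonneg (-y + x)]

theorem polyWeight_le {k : ℝ} (hk : 0 ≤ k) (x y : EuclideanSpace ℝ (Fin d)) :
    polyWeight k x ≤ polyWeight k y * polyWeight k (-y + x) := by
  rw [polyWeight, polyWeight, polyWeight, ← ENNReal.ofReal_mul (by positivity),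
    ← Real.mul_rpow (by positivity) (by positivity)]
  exact ENNReal.ofReal_le_ofReal (Real.rpow_le_rpow (by positivity) (one_add_norm_le x y) hk)

/-- The weight is submultiplicative along sums, so it distributes over the factors of a convolution.
-/
theorem iteratedConv_mul_polyWeight_le {k : ℝ} (hk : 0 ≤ k) (n : ℕ)
    (f : Fin (n + 1) → EuclideanSpace ℝ (Fin d) → ℝ≥0∞) (x : EuclideanSpace ℝ (Fin d)) :
    iteratedConv n f x * polyWeight k x ≤ iteratedConv n (fun j x => f j x * polyWeight k x) x := by
  induction n generalizing x with
  | zero => exact le_rfl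
  | succ n ih =>
    simp only [iteratedConv, lconvolution_def]
    rw [← lintegral_mul_const' _ _ (polyWeight_ne_top k x)]
    refine lintegral_mono fun y => ?_
    calc f 0 y * iteratedConv n (fun j => f j.succ) (-y + x) * polyWeight k x
        ≤ f 0 y * iteratedConv n (fun j => f j.succ) (-y + x) *
          (polyWeight k y * polyWeight k (-y + x)) := by gcongr; exact polyWeight_le hk x y
      _ = f 0 y * polyWeight k y *
          (iteratedConv n (fun j => f j.succ) (-y + x) * polyWeight k (-y + x)) := by ring
      _ ≤ _ := by gcongr; exact ih (fun j => f j.succ) (-y + x)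

/-- Weighted integrability controls small powers. -/
theorem lintegral_rpow_lt_top {q : ℝ} (hq : 0 < q) (hq1 : q ≤ 1)
    {F : EuclideanSpace ℝ (Fin d) → ℝ≥0∞} (hF : AEMeasurable F volume)
    (h : ∫⁻ x, F x * polyWeight ((d + 1) * ((1 - q) / q)) x < ∞) : ∫⁻ x, F x ^ q < ∞ := by
  rcases hq1.eq_or_lt with rfl | hq1
  · simpa [polyWeight] using h
  have hc : (1 / q).HolderConjugate (1 / (1 - q)) := by
    rw [Real.holderConjugate_iff]
    refine ⟨by rw [lt_div_iff₀ hq]; linarith, by simp⟩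
  -- Hölder with exponent `1/q` splits `F^q` into `(F w)^q` and `w^(-q)`, where `w` is the weight.
  -- This `k` makes the second factor, raised to the conjugate exponent, equal to `(1 +
  -- ‖x‖)^(-(d+1))`, which is integrable.
  set k := (d + 1 : ℝ) * ((1 - q) / q) with hk
  have key := ENNReal.lintegral_mul_le_Lp_mul_Lq volume hc
    (f := fun x => (F x * polyWeight k x) ^ q) (g := fun x => polyWeight k x ^ (-q))
    (by fun_prop) (by fun_prop)
  have e : ∀ x, F x ^ q = ((fun x => (F x * polyWeight k x) ^ q) * fun x => polyWeight k x ^ (-q) :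
      EuclideanSpace ℝ (Fin d) → ℝ≥0∞) x := by
    intro x
    simp only [Pi.mul_apply]
    rw [ENNReal.mul_rpow_of_nonneg _ _ hq.le, mul_assoc, ← ENNReal.rpow_add _ _
      (polyWeight_ne_zero k x) (polyWeight_ne_top k x), add_neg_cancel, ENNReal.rpow_zero, mul_one]
  simp_rw [e]
  refine key.trans_lt (ENNReal.mul_lt_top ?_ ?_)
  · simp_rw [← ENNReal.rpow_mul, mul_one_div_cancel hq.ne', ENNReal.rpow_one]
    exact ENNReal.rpow_lt_top_of_nonneg (by positivity) h.ne
  · have e2 : k * (-q * (1 / (1 - q))) = -(d + 1) := by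
      have : 1 - q ≠ 0 := (sub_pos.2 hq1).ne'
      rw [hk]; field_simp
    simp_rw [← ENNReal.rpow_mul, polyWeight_rpow, e2]
    exact ENNReal.rpow_lt_top_of_nonneg (one_div_nonneg.2 (one_div_nonneg.2 (sub_pos.2 hq1).le))
      lintegral_polyWeight_lt_top.ne

/-- With `r = ‖x - y‖`, use `1 + ‖x‖ ≤ (1 + R)(1 + r)` and `(1 + r)^N ≤ exp (N r)`, then absorb `N
r` into the Gaussian by completing the square. -/
theorem exp_neg_sq_le {a N : ℝ} (ha : 0 < a) (hN : 0 ≤ N) {R : ℝ}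
    {x y : EuclideanSpace ℝ (Fin d)} (hy : ‖y‖ ≤ R) :
    Real.exp (-a * ‖-y + x‖ ^ 2) ≤
      Real.exp (N ^ 2 / (4 * a)) * (1 + R) ^ N * (1 + ‖x‖) ^ (-N) := by
  set r := ‖-y + x‖ with hr
  have r0 : 0 ≤ r := norm_nonneg _
  have R0 : 0 ≤ R := (norm_nonneg y).trans hy
  have h1 : (1 + r) ^ N ≤ Real.exp (N * r) := by
    rw [Real.rpow_def_of_pos (by positivity), mul_comm N]
    refine Real.exp_le_exp.2 (mul_le_mul_of_nonneg_right ?_ hN)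
    have := Real.log_le_sub_one_of_pos (show 0 < 1 + r by positivity)
    linarith
  have h2 : (1 + ‖x‖) ^ N ≤ (1 + R) ^ N * (1 + r) ^ N := by
    rw [← Real.mul_rpow (by positivity) (by positivity)]
    refine Real.rpow_le_rpow (by positivity) ((one_add_norm_le x y).trans ?_) hN
    gcongr
  rw [Real.rpow_neg (by positivity), ← div_eq_mul_inv, le_div_iff₀ (by positivity)]
  have h3 : N * r ≤ N ^ 2 / (4 * a) + a * r ^ 2 := by
    have : N ^ 2 / (4 * a) + a * r ^ 2 - N * r = (N - 2 * a * r) ^ 2 / (4 * a) := by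
      field_simp; ring
    have h4 : 0 ≤ (N - 2 * a * r) ^ 2 / (4 * a) := by positivity
    linarith
  calc Real.exp (-a * r ^ 2) * (1 + ‖x‖) ^ N
      ≤ Real.exp (-a * r ^ 2) * ((1 + R) ^ N * Real.exp (N ^ 2 / (4 * a) + a * r ^ 2)) := by
        gcongr
        exact h2.trans (by gcongr; exact h1.trans (Real.exp_le_exp.2 h3))
    _ = Real.exp (-a * r ^ 2) * Real.exp (a * r ^ 2) * (Real.exp (N ^ 2 / (4 * a)) * (1 + R) ^ N) := by
        rw [Real.exp_add]; ring
    _ = _ := by rw [← Real.exp_add]; simp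

end Weight

/-! ### Gaussian decay of solutions with compactly supported data. -/

section Decay

variable {d : ℕ} {σ : ℝ} {μ : Measure (EuclideanSpace ℝ (Fin d))}
  {u : ℝ → EuclideanSpace ℝ (Fin d) → ℝ}

theorem tendsto_exp_neg_sq_cocompact {a : ℝ} (ha : 0 < a) (x : EuclideanSpace ℝ (Fin d)) :
    Tendsto (fun y => Real.exp (-a * ‖-y + x‖ ^ 2)) (cocompact (EuclideanSpace ℝ (Fin d)))
      (𝓝 0) := by
  have h1 : Tendsto (fun y : EuclideanSpace ℝ (Fin d) => ‖-y + x‖) (cocompact _) atTop := by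
    refine tendsto_atTop_mono (fun y => ?_)
      (tendsto_atTop_add_const_right _ (-‖x‖) (tendsto_norm_cocompact_atTop))
    have := norm_sub_le (-y + x) x
    rw [add_sub_cancel_right, norm_neg] at this
    linarith
  have h2 : Tendsto (fun y : EuclideanSpace ℝ (Fin d) => -a * ‖-y + x‖ ^ 2) (cocompact _) atBot :=
    ((tendsto_pow_atTop two_ne_zero).comp h1).const_mul_atTop_of_neg (neg_neg_of_pos ha)
  exact Real.tendsto_exp_atBot.comp h2

/-- The remaining time `t - s` lies between `t / 2` and `t`, so the bound is uniform as `s` tends to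
zero. -/
theorem heatE_le {σ s t : ℝ} (hσ : 0 < σ) (hs : 0 < s) (hst : s ≤ t / 2)
    (z : EuclideanSpace ℝ (Fin d)) :
    heatE (σ * (t - s)) z ≤ ENNReal.ofReal ((σ * (t / 2)) ^ (-(d / 2) : ℝ) *
      Real.exp (-(Real.pi / (σ * t)) * ‖z‖ ^ 2)) := by
  have ht : 0 < t := by linarith
  have h1 : 0 < t - s := by linarith
  rw [heatE, gaussE, ENNReal.ofReal_mul (by positivity)]
  gcongr ENNReal.ofReal ?_ * ENNReal.ofReal ?_
  · refine Real.rpow_le_rpow_of_nonpos (by positivity) ?_ (by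
      have : (0 : ℝ) ≤ d / 2 := by positivity
      linarith)
    gcongr; linarith
  · refine Real.exp_le_exp.2 (mul_le_mul_of_nonneg_right (neg_le_neg ?_) (by positivity))
    gcongr; linarith

/-- Pointwise bound by the Gauss kernel, for initial data supported in a ball. -/
theorem IsHeatSolution.ae_le (h : IsHeatSolution σ μ u) (hσ : 0 < σ) [IsFiniteMeasure μ] {R : ℝ}
    (hμ : ∀ᵐ y ∂μ, ‖y‖ ≤ R) {t : ℝ} (ht : 0 < t) :
    ∃ C : ℝ, 0 ≤ C ∧ ∀ᵐ x, ∀ H : ℝ, 0 ≤ H →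
      (∀ y, ‖y‖ ≤ R → Real.exp (-(Real.pi / (σ * t)) * ‖-y + x‖ ^ 2) ≤ H) → u t x ≤ C * H := by
  set a := Real.pi / (σ * t) with ha
  have a0 : 0 < a := by positivity
  set c := (σ * (t / 2)) ^ (-(d / 2) : ℝ) with hc
  have c0 : 0 ≤ c := by positivity
  obtain ⟨M, M0, hM⟩ := h.integral_le ht
  -- A sequence of starting times, so that the almost everywhere identities hold simultaneously
  -- outside one null set.
  set s : ℕ → ℝ := fun n => t / 2 / (n + 1) with hs
  have s0 : ∀ n, 0 < s n := fun n => by positivity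
  have s1 : ∀ n, s n ≤ t / 2 := fun n =>
    div_le_self (by positivity) (by linarith [(n.cast_nonneg : (0 : ℝ) ≤ n)])
  have slim : Tendsto s atTop (𝓝[>] 0) := by
    refine tendsto_nhdsWithin_iff.2 ⟨?_, Eventually.of_forall s0⟩
    have := (tendsto_one_div_add_atTop_nhds_zero_nat (𝕜 := ℝ)).const_mul (t / 2)
    simpa [hs, div_eq_mul_inv] using this
  refine ⟨c * μ.real univ, by positivity, ?_⟩
  have hae : ∀ᵐ x, ∀ n, ENNReal.ofReal (u t x) =
      lconvolution (fun x => ENNReal.ofReal (u (s n) x)) (heatE (σ * (t - s n))) volume x :=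
    ae_all_iff.2 fun n => h.ae_eq_lconvolution hσ (s0 n) ((s1 n).trans_lt (by linarith))
  filter_upwards [hae] with x hx H H0 hH
  have key : ∀ ε, 0 < ε → u t x ≤ c * (μ.real univ * H + ε * M) := by
    intro ε hε
    -- The initial data are tested only on compactly supported functions. The Gaussian minus `ε`,
    -- cut at zero, is one, and the remainder contributes at most `ε M`.
    set φ : EuclideanSpace ℝ (Fin d) → ℝ := fun y =>
      max (Real.exp (-a * ‖-y + x‖ ^ 2) - ε) 0 with hφ
    have φc : Continuous φ := by fun_prop
    have φs : HasCompactSupport φ := by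
      have := (tendsto_exp_neg_sq_cocompact a0 x).eventually (gt_mem_nhds hε)
      obtain ⟨K, hK, hKs⟩ := mem_cocompact.1 this
      refine HasCompactSupport.intro hK fun y hy => max_eq_right ?_
      have : Real.exp (-a * ‖-y + x‖ ^ 2) < ε := hKs hy
      linarith
    have φ0 : ∀ y, 0 ≤ φ y := fun y => le_max_right _ _
    have φle : ∀ y, Real.exp (-a * ‖-y + x‖ ^ 2) ≤ φ y + ε := fun y => by
      have : Real.exp (-a * ‖-y + x‖ ^ 2) - ε ≤ φ y := le_max_left _ _
      linarith
    have step : ∀ n, u t x ≤ c * ((∫ y, φ y * u (s n) y) + ε * M) := by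
      intro n
      have hi := h.integrable (s0 n)
      have cu := (h.contDiff hσ _ (s0 n)).continuous
      have i1 : Integrable (fun y => φ y * u (s n) y) volume :=
        (φc.mul cu).integrable_of_hasCompactSupport φs.mul_right
      have i2 : Integrable (fun y => ε * u (s n) y) volume := hi.const_mul _
      have i3 : Integrable (fun y => c * (φ y * u (s n) y + ε * u (s n) y)) volume :=
        (i1.add i2).const_mul c
      have n0 : ∀ y, 0 ≤ c * (φ y * u (s n) y + ε * u (s n) y) := fun y => by
        have := h.nonneg _ (s0 n) y
        have := φ0 y
        positivity
      have le1 : ENNReal.ofReal (u t x) ≤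
          ENNReal.ofReal (∫ y, c * (φ y * u (s n) y + ε * u (s n) y)) := by
        rw [hx n, lconvolution_def, ofReal_integral_eq_lintegral_ofReal i3 (ae_of_all _ n0)]
        refine lintegral_mono fun y => ?_
        refine (mul_le_mul_right (heatE_le hσ (s0 n) (s1 n) _) _).trans ?_
        rw [← ENNReal.ofReal_mul (h.nonneg _ (s0 n) y)]
        refine ENNReal.ofReal_le_ofReal ?_
        calc _ ≤ u (s n) y * (c * (φ y + ε)) :=
              mul_le_mul_of_nonneg_left (mul_le_mul_of_nonneg_left (φle y) c0)
                (h.nonneg _ (s0 n) y)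
          _ = _ := by ring
      have le2 := (ENNReal.ofReal_le_ofReal_iff (integral_nonneg n0)).1 le1
      rw [integral_const_mul, integral_add i1 i2, integral_const_mul] at le2
      refine le2.trans ?_
      gcongr
      exact hM _ (s0 n) ((s1 n).trans (by linarith))
    have lim := ((h.initial_data φ φc φs).comp slim).add_const (ε * M) |>.const_mul c
    refine (ge_of_tendsto' lim step).trans ?_
    have hle : ∫ y, φ y ∂μ ≤ μ.real univ * H := by
      calc _ ≤ ∫ _, H ∂μ := by
            refine integral_mono_of_nonneg (ae_of_all _ φ0) (integrable_const H) ?_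
            filter_upwards [hμ] with y hy
            exact max_le (by linarith [hH y hy]) H0
        _ = _ := by simp
    gcongr
  have lim : Tendsto (fun ε : ℝ => c * (μ.real univ * H + ε * M)) (𝓝[>] 0)
      (𝓝 (c * (μ.real univ * H + 0 * M))) :=
    tendsto_nhdsWithin_of_tendsto_nhds (Continuous.tendsto (by fun_prop) 0)
  have := ge_of_tendsto lim (eventually_mem_nhdsWithin.mono key)
  rw [zero_mul, add_zero, ← mul_assoc] at this
  exact this

theorem IsHeatSolution.lintegral_polyWeight_lt_top (h : IsHeatSolution σ μ u) (hσ : 0 < σ)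
    [IsFiniteMeasure μ] {R : ℝ} (hμ : ∀ᵐ y ∂μ, ‖y‖ ≤ R) {t p k : ℝ} (ht : 0 < t) (hp : 0 < p)
    (hk : 0 ≤ k) :
    ∫⁻ x, ENNReal.ofReal (u t x ^ (1 / p)) * polyWeight k x < ∞ := by
  obtain ⟨C, C0, hC⟩ := h.ae_le hσ hμ ht
  -- The power `1/p` of a function decaying like `(1 + ‖x‖)^(-N)` then beats the weight by the
  -- integrable factor `(1 + ‖x‖)^(-(d+1))`.
  set N := p * (k + (d + 1)) with hN
  have N0 : 0 ≤ N := by positivity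
  have a0 : 0 < Real.pi / (σ * t) := by positivity
  set B := Real.exp (N ^ 2 / (4 * (Real.pi / (σ * t)))) * (1 + |R|) ^ N with hB
  have B0 : 0 ≤ B := by positivity
  have hle : ∀ᵐ x, ENNReal.ofReal (u t x ^ (1 / p)) * polyWeight k x ≤
      ENNReal.ofReal ((C * B) ^ (1 / p)) * polyWeight (-(d + 1)) x := by
    filter_upwards [hC] with x hx
    have h1 := hx (B * (1 + ‖x‖) ^ (-N)) (by positivity) fun y hy =>
      exp_neg_sq_le a0 N0 (hy.trans (le_abs_self R))
    rw [polyWeight, polyWeight, ← ENNReal.ofReal_mul (Real.rpow_nonneg (h.nonneg t ht x) _),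
      ← ENNReal.ofReal_mul (by positivity)]
    refine ENNReal.ofReal_le_ofReal ?_
    have e : -N * (1 / p) + k = -(d + 1) := by rw [hN]; field_simp; ring
    calc _ ≤ (C * B * (1 + ‖x‖) ^ (-N)) ^ (1 / p) * (1 + ‖x‖) ^ k := by
          gcongr
          · exact h.nonneg t ht x
          · rw [mul_assoc]; exact h1
      _ = _ := by
          rw [Real.mul_rpow (by positivity) (by positivity), ← Real.rpow_mul (by positivity),
            mul_assoc, ← Real.rpow_add (by positivity), e]
  refine (lintegral_mono_ae hle).trans_lt ?_
  rw [lintegral_const_mul _ (by fun_prop)]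
  exact ENNReal.mul_lt_top ENNReal.ofReal_lt_top _root_.lintegral_polyWeight_lt_top

end Decay

/-! ### Consequences of the initial data. -/

section InitialData

variable {d : ℕ} {σ : ℝ} {μ : Measure (EuclideanSpace ℝ (Fin d))}
  {u : ℝ → EuclideanSpace ℝ (Fin d) → ℝ}

/-- Without diffusion `u` is constant in time, so the limit at time zero is attained at every `t`.
-/
theorem IsHeatSolution.withDensity_eq (h : IsHeatSolution 0 μ u) [IsFiniteMeasure μ] {t : ℝ}
    (ht : 0 < t) : volume.withDensity (fun x => ENNReal.ofReal (u t x)) = μ := by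
  have := isFiniteMeasure_withDensity (h.lintegral_ne_top ht)
  refine Measure.ext_of_integral_eq_on_compactlySupported fun φ => ?_
  rw [integral_withDensity_eq_integral_toReal_smul₀ (h.aemeasurable_ofReal ht)
    (ae_of_all _ fun x => ENNReal.ofReal_lt_top)]
  have e : ∀ x, (ENNReal.ofReal (u t x)).toReal • φ x = φ x * u t x := fun x => by
    rw [ENNReal.toReal_ofReal (h.nonneg t ht x), smul_eq_mul, mul_comm]
  simp_rw [e]
  refine tendsto_nhds_unique ?_ (h.initial_data φ φ.continuous φ.hasCompactSupport)
  refine tendsto_const_nhds.congr' ?_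
  filter_upwards [self_mem_nhdsWithin] with s hs
  rw [h.eq_of_zero ht hs]

/-- By conservation of mass, zero mass at one time means zero mass at all positive times, and the
weak limit `μ` would vanish. -/
theorem IsHeatSolution.lintegral_ne_zero (h : IsHeatSolution σ μ u) (hσ : 0 ≤ σ)
    [IsFiniteMeasure μ] (hμ : μ ≠ 0) {t : ℝ} (ht : 0 < t) :
    ∫⁻ x, ENNReal.ofReal (u t x) ≠ 0 := by
  intro h0
  apply hμ
  refine Measure.ext_of_integral_eq_on_compactlySupported fun φ => ?_
  rw [integral_zero_measure]
  refine tendsto_nhds_unique (h.initial_data φ φ.continuous φ.hasCompactSupport) ?_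
  refine tendsto_const_nhds.congr' ?_
  filter_upwards [self_mem_nhdsWithin] with s hs
  rw [h.lintegral_eq hσ ht hs, lintegral_eq_zero_iff' (h.aemeasurable_ofReal hs)] at h0
  refine (integral_eq_zero_of_ae ?_).symm
  filter_upwards [h0] with x hx
  have : u s x = 0 := le_antisymm (ENNReal.ofReal_eq_zero.1 hx) (h.nonneg s hs x)
  simp [this]

/-- The integral is one against `μ` itself, and the weight is bounded on the ball carrying `μ`. -/
theorem IsHeatSolution.lintegral_mul_polyWeight_lt_top_of_zero (h : IsHeatSolution 0 μ u)
    [IsFiniteMeasure μ] {R : ℝ} (hμ : ∀ᵐ y ∂μ, ‖y‖ ≤ R) {t k : ℝ} (ht : 0 < t) (hk : 0 ≤ k) :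
    ∫⁻ x, ENNReal.ofReal (u t x) * polyWeight k x < ∞ := by
  have e := lintegral_withDensity_eq_lintegral_mul₀ (h.aemeasurable_ofReal ht)
    (measurable_polyWeight (d := d) k).aemeasurable
  rw [h.withDensity_eq ht] at e
  calc _ = ∫⁻ x, polyWeight k x ∂μ := e.symm
    _ ≤ ∫⁻ _, ENNReal.ofReal ((1 + R) ^ k) ∂μ := by
        refine lintegral_mono_ae ?_
        filter_upwards [hμ] with x hx
        exact ENNReal.ofReal_le_ofReal (Real.rpow_le_rpow (by positivity) (by linarith) hk)
    _ < ∞ := by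
        rw [lintegral_const]
        exact ENNReal.mul_lt_top ENNReal.ofReal_lt_top (measure_lt_top μ _)

end InitialData

/-! ### Positivity and finiteness of `Q`. -/

section PositiveFinite

variable {d : ℕ}

/-- A zero quasi-norm would make the convolution vanish almost everywhere; but its integral is the
product of the integrals of the factors, none of which is zero. -/
theorem convNorm_heat_pos (n : ℕ) {p : Fin (n + 1) → ℝ} {q : ℝ} (hp : ∀ j, 0 < p j) (hq : 0 < q)
    {σ : Fin (n + 1) → ℝ} (hσ : ∀ j, 0 ≤ σ j)
    {μ : Fin (n + 1) → Measure (EuclideanSpace ℝ (Fin d))} [∀ j, IsFiniteMeasure (μ j)]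
    (hμ : ∀ j, μ j ≠ 0) {u : Fin (n + 1) → ℝ → EuclideanSpace ℝ (Fin d) → ℝ}
    (hu : ∀ j, IsHeatSolution (σ j) (μ j) (u j)) {t : ℝ} (ht : 0 < t) :
    0 < convNorm n q fun j x => u j t x ^ (1 / p j) := by
  have hm := fun j => (hu j).aemeasurable_rpow ht (1 / p j)
  have hF : AEMeasurable (iteratedConv n fun j x => ENNReal.ofReal (u j t x ^ (1 / p j))) volume :=
    ⟨_, measurable_iteratedConv n fun j => (hm j).measurable_mk,
      iteratedConv_congr_ae n fun j => (hm j).ae_eq_mk⟩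
  rw [convNorm_eq_lqNorm n hq, lqNorm, pos_iff_ne_zero]
  intro h0
  rw [ENNReal.rpow_eq_zero_iff_of_pos (by positivity), lintegral_eq_zero_iff' (hF.pow_const q)] at h0
  have h1 : ∫⁻ x, iteratedConv n (fun j x => ENNReal.ofReal (u j t x ^ (1 / p j))) x = 0 := by
    rw [lintegral_eq_zero_iff' hF]
    filter_upwards [h0] with x hx
    exact (ENNReal.rpow_eq_zero_iff_of_pos hq).1 hx
  rw [lintegral_iteratedConv n hm, Finset.prod_eq_zero_iff] at h1
  obtain ⟨j, -, hj⟩ := h1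
  refine (hu j).lintegral_ne_zero (hσ j) (hμ j) ht ?_
  rw [lintegral_eq_zero_iff' (hm j)] at hj
  rw [lintegral_eq_zero_iff' ((hu j).aemeasurable_ofReal ht)]
  filter_upwards [hj] with x hx
  have h2 := ENNReal.ofReal_eq_zero.1 hx
  have h3 : u j t x ^ (1 / p j) = 0 :=
    le_antisymm h2 (Real.rpow_nonneg ((hu j).nonneg t ht x) _)
  rw [Real.rpow_eq_zero ((hu j).nonneg t ht x) (one_div_pos.2 (hp j)).ne'] at h3
  simp [h3]

/-- Young's inequality bounds the norm by powers of the masses. -/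
theorem convNorm_heat_lt_top_of_one_le (n : ℕ) {p : Fin (n + 1) → ℝ} {q : ℝ}
    (hp : ∀ j, 1 ≤ p j) (hq : 0 < q) (h : ∑ j, 1 / p j = n + 1 / q)
    {σ : Fin (n + 1) → ℝ} {μ : Fin (n + 1) → Measure (EuclideanSpace ℝ (Fin d))}
    {u : Fin (n + 1) → ℝ → EuclideanSpace ℝ (Fin d) → ℝ}
    (hu : ∀ j, IsHeatSolution (σ j) (μ j) (u j)) {t : ℝ} (ht : 0 < t) :
    (convNorm n q fun j x => u j t x ^ (1 / p j)) < ∞ := by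
  have p0 : ∀ j, 0 < p j := fun j => one_pos.trans_le (hp j)
  have nn : ∀ j x, 0 ≤ u j t x ^ (1 / p j) := fun j x => Real.rpow_nonneg ((hu j).nonneg t ht x) _
  have key : leDir true _ _ := leDir_convNorm (b := true) n (fun j => ⟨p0 j, hp j⟩) hq h nn fun j =>
    ((hu j).aestronglyMeasurable t ht).aemeasurable.pow_const _ |>.aestronglyMeasurable
  refine lt_of_le_of_lt (show _ ≤ _ from key) (ENNReal.mul_lt_top ENNReal.ofReal_lt_top
    (ENNReal.prod_lt_top fun j _ => ?_))
  rw [eLpNorm_ofReal_eq_lqNorm (p0 j) (nn j), lqNorm]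
  refine ENNReal.rpow_lt_top_of_nonneg (one_div_pos.2 (p0 j)).le ?_
  have e : ∀ x, ENNReal.ofReal (u j t x ^ (1 / p j)) ^ p j = ENNReal.ofReal (u j t x) := fun x => by
    rw [ENNReal.ofReal_rpow_of_nonneg (nn j x) (p0 j).le, ← Real.rpow_mul ((hu j).nonneg t ht x),
      one_div_mul_cancel (p0 j).ne', Real.rpow_one]
  simp_rw [e]
  exact (hu j).lintegral_ne_top ht

/-- For `q ≤ 1` a weighted `L¹` bound on the convolution controls its `L^q` quasi-norm, and it
factors into weighted `L¹` bounds on the individual powers. -/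
theorem convNorm_heat_lt_top_of_le_one (n : ℕ) {p : Fin (n + 1) → ℝ} {q : ℝ}
    (hp : ∀ j, 0 < p j) (hq : 0 < q) (hq1 : q ≤ 1)
    {σ : Fin (n + 1) → ℝ} (hσ : ∀ j, 0 < σ j ∨ σ j = 0 ∧ p j = 1)
    {μ : Fin (n + 1) → Measure (EuclideanSpace ℝ (Fin d))} [∀ j, IsFiniteMeasure (μ j)]
    (hμ : ∀ j, ∃ K, IsCompact K ∧ μ j Kᶜ = 0)
    {u : Fin (n + 1) → ℝ → EuclideanSpace ℝ (Fin d) → ℝ}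
    (hu : ∀ j, IsHeatSolution (σ j) (μ j) (u j)) {t : ℝ} (ht : 0 < t) :
    (convNorm n q fun j x => u j t x ^ (1 / p j)) < ∞ := by
  have hm := fun j => (hu j).aemeasurable_rpow ht (1 / p j)
  have hF : AEMeasurable (iteratedConv n fun j x => ENNReal.ofReal (u j t x ^ (1 / p j))) volume :=
    ⟨_, measurable_iteratedConv n fun j => (hm j).measurable_mk,
      iteratedConv_congr_ae n fun j => (hm j).ae_eq_mk⟩
  rw [convNorm_eq_lqNorm n hq, lqNorm]
  refine ENNReal.rpow_lt_top_of_nonneg (by positivity) (lintegral_rpow_lt_top hq hq1 hF ?_).ne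
  set k := (d + 1 : ℝ) * ((1 - q) / q) with hk
  have k0 : 0 ≤ k := mul_nonneg (by positivity) (div_nonneg (sub_nonneg.2 hq1) hq.le)
  refine (lintegral_mono fun x => iteratedConv_mul_polyWeight_le k0 n _ x).trans_lt ?_
  have hm' : ∀ j, AEMeasurable (fun x => ENNReal.ofReal (u j t x ^ (1 / p j)) * polyWeight k x)
      volume := fun j => (hm j).mul (measurable_polyWeight k).aemeasurable
  rw [lintegral_iteratedConv n hm']
  refine ENNReal.prod_lt_top fun j _ => ?_
  obtain ⟨K, hK, hK0⟩ := hμ j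
  obtain ⟨R, hR⟩ := hK.isBounded.exists_norm_le
  have hae : ∀ᵐ y ∂μ j, ‖y‖ ≤ R := by
    have : ∀ᵐ y ∂μ j, y ∈ K := hK0
    exact this.mono hR
  rcases hσ j with h | ⟨h0, h1⟩
  · exact (hu j).lintegral_polyWeight_lt_top h hae ht (hp j) k0
  · have hj := hu j
    rw [h0] at hj
    simp_rw [h1, div_one, Real.rpow_one]
    exact hj.lintegral_mul_polyWeight_lt_top_of_zero hae ht k0

/-- The exponents are not assumed to lie on one side of one: with positive `σ j` wherever `p j ≠ 1`,
the relation forces the numbers `1 - 1/p_j` that are nonzero to share a sign. -/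
theorem convNorm_heat_lt_top (n : ℕ) {p : Fin (n + 1) → ℝ} {q : ℝ}
    (hp : ∀ j, 0 < p j) (hq : 0 < q) (h : ∑ j, 1 / p j = n + 1 / q) {σ : Fin (n + 1) → ℝ}
    (hrel : ∀ j k, 1 / p j * (1 - 1 / p j) * σ k = 1 / p k * (1 - 1 / p k) * σ j)
    (hσ : ∀ j, p j ≠ 1 → 0 < σ j)
    {μ : Fin (n + 1) → Measure (EuclideanSpace ℝ (Fin d))} [∀ j, IsFiniteMeasure (μ j)]
    (hμ : ∀ j, ∃ K, IsCompact K ∧ μ j Kᶜ = 0)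
    {u : Fin (n + 1) → ℝ → EuclideanSpace ℝ (Fin d) → ℝ}
    (hu : ∀ j, IsHeatSolution (σ j) (μ j) (u j)) {t : ℝ} (ht : 0 < t) :
    (convNorm n q fun j x => u j t x ^ (1 / p j)) < ∞ := by
  by_cases h1 : ∀ j, 1 ≤ p j
  · exact convNorm_heat_lt_top_of_one_le n h1 hq h hu ht
  push Not at h1
  obtain ⟨k, hk⟩ := h1
  have ak : 1 / p k * (1 - 1 / p k) < 0 := by
    have := one_lt_one_div (hp k) hk
    exact mul_neg_of_pos_of_neg (one_div_pos.2 (hp k)) (by linarith)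
  have hle : ∀ j, p j ≤ 1 := fun j => by
    by_contra! hj
    have aj : 0 < 1 / p j * (1 - 1 / p j) := by
      have := (div_lt_one (hp j)).2 hj
      exact mul_pos (one_div_pos.2 (hp j)) (by linarith)
    have := hrel j k
    have := mul_pos aj (hσ k hk.ne)
    have := mul_neg_of_neg_of_pos ak (hσ j hj.ne')
    linarith
  have hq1 : q ≤ 1 := (expDir_of_sum (b := false) n (fun j => ⟨hp j, hle j⟩) hq h).2
  refine convNorm_heat_lt_top_of_le_one n hp hq hq1 (fun j => ?_) hμ hu ht
  by_cases hj : p j = 1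
  -- For `p j = 1`, the relation with an index `k` such that `p k < 1` reads `0 = a σ_j` with `a ≠
  -- 0`.
  · refine Or.inr ⟨?_, hj⟩
    have := hrel j k
    rw [hj] at this
    simp only [div_one, sub_self, mul_zero, zero_mul] at this
    exact (mul_eq_zero.1 this.symm).resolve_left ak.ne
  · exact Or.inl (hσ j hj)

end PositiveFinite

/-- There are `n + 1` functions, indexed by `Fin (n + 1)`; the exponent of the target space is
`q`. Values of norms are in `[0, ∞]`. -/
theorem corollary1p5 (d : ℕ) (hd : 0 < d) (n : ℕ) (p : Fin (n + 1) → ℝ) (q : ℝ)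
    (hp : ∀ j, 0 < p j) (hq : 0 < q) (hscale : ∑ j, 1 / p j = n + 1 / q) :
    -- monotonicity of `Q` along the heat flows
    (∀ σ : Fin (n + 1) → ℝ, (∀ j, 0 ≤ σ j) →
      (∀ j k, 1 / p j * (1 - 1 / p j) * σ k = 1 / p k * (1 - 1 / p k) * σ j) →
      ∀ μ : Fin (n + 1) → Measure (EuclideanSpace ℝ (Fin d)),
      (∀ j, IsFiniteMeasure (μ j)) → (∀ j, ∃ K, IsCompact K ∧ μ j Kᶜ = 0) →
      ∀ u : Fin (n + 1) → ℝ → EuclideanSpace ℝ (Fin d) → ℝ,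
      (∀ j, IsHeatSolution (σ j) (μ j) (u j)) →
      ((∀ j, 1 ≤ p j) →
        MonotoneOn (fun t => convNorm n q fun j x => u j t x ^ (1 / p j)) (Ioi 0)) ∧
      ((∀ j, p j ≤ 1) →
        AntitoneOn (fun t => convNorm n q fun j x => u j t x ^ (1 / p j)) (Ioi 0)) ∧
      -- `Q` has values in `(0, ∞)`, apart from zero data and the degenerate choice `σ = 0`
      ((∀ j, μ j ≠ 0) → (∀ j, p j ≠ 1 → 0 < σ j) → ∀ t, 0 < t →
        0 < (convNorm n q fun j x => u j t x ^ (1 / p j)) ∧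
          (convNorm n q fun j x => u j t x ^ (1 / p j)) < ∞)) ∧
    -- the Young inequality, with best constant
    ((∀ j, 1 ≤ p j) →
      IsLeast {K : ℝ≥0∞ | ∀ f : Fin (n + 1) → EuclideanSpace ℝ (Fin d) → ℝ,
        (∀ j x, 0 ≤ f j x) → (∀ j, MemLp (f j) (ENNReal.ofReal (p j)) volume) →
        convNorm n q f ≤ K * ∏ j, eLpNorm (f j) (ENNReal.ofReal (p j)) volume}
      (youngConst d n p q)) ∧
    -- the reverse Young inequality, with best constant
    ((∀ j, p j ≤ 1) →
      IsGreatest {K : ℝ≥0∞ | ∀ f : Fin (n + 1) → EuclideanSpace ℝ (Fin d) → ℝ,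
        (∀ j x, 0 ≤ f j x) → (∀ j, MemLp (f j) (ENNReal.ofReal (p j)) volume) →
        K * ∏ j, eLpNorm (f j) (ENNReal.ofReal (p j)) volume ≤ convNorm n q f}
      (youngConst d n p q)) := by
  refine ⟨fun σ hσ hrel μ hfin hK u hu => ⟨fun h1 => ?_, fun h1 => ?_, fun hμ hσ1 t ht => ?_⟩,
    fun h1 => ?_, fun h1 => ?_⟩
  · intro s hs t _ hst
    exact leDir_convNorm_heat (b := true) n (fun j => ⟨hp j, h1 j⟩) hq hscale hσ hrel hu hs hst
  · intro s hs t _ hst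
    exact leDir_convNorm_heat (b := false) n (fun j => ⟨hp j, h1 j⟩) hq hscale hσ hrel hu hs hst
  · exact ⟨convNorm_heat_pos n hp hq hσ hμ hu ht,
      convNorm_heat_lt_top n hp hq hscale hrel hσ1 hK hu ht⟩
  · have hp' : ∀ j, ExpDir true (p j) := fun j => ⟨hp j, h1 j⟩
    exact ⟨fun f hf hm => leDir_convNorm n hp' hq hscale hf fun j => (hm j).1,
      fun K hK => leDir_youngConst n hp' hq hscale hK⟩
  · have hp' : ∀ j, ExpDir false (p j) := fun j => ⟨hp j, h1 j⟩
    exact ⟨fun f hf hm => leDir_convNorm n hp' hq hscale hf fun j => (hm j).1,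
      fun K hK => leDir_youngConst n hp' hq hscale hK⟩
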